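/- An instance of Maximum Happy Vertices (MHV) is a triple $(G,p,k)$ consisting of a finite simple undirected graph $G$, a partial coloring $p : S \to \{1,\dots,\ell\}$ of its vertices (with $S \subseteq V(G)$ and a positive number $\ell$ of colors, which is part of the input), and an integer $k$. Given a coloring $c : V(G) \to \{1,\dots,\ell\}$, a vertex is happy if all its neighbours have the same color as the vertex itself. The instance is a yes-instance if some coloring $c : V(G)\to\{1,\dots,\ell\}$ extending $p$ makes at least $k$ vertices happy. The distance to clique $d(G)$ of $G$ is the smallest size of a set $S \subseteq V(G)$ such that the vertices of $V(G)\setminus S$ are pairwise adjacent. Instances are encoded as strings, with graphs given by their adjacency matrices and integers in binary. **Theorem.** Maximum Happy Vertices admits a polynomial kernel with $O(d^3)$ vertices, where $d$ is the distance to clique of the input graph, and neither $d$ nor a set realizing it is given as part of the input. That is, there are a constant $C$, a polynomial $q$ with natural number coefficients, and an algorithm that, given an instance $(G,p,k)$ of MHV alone, runs in time polynomial in the length of its encoding and outputs an instance $(G',p',k')$ of MHV such that, with $d = d(G)$, 1. $(G',p',k')$ is a yes-instance if and only if $(G,p,k)$ is a yes-instance; 2. $|V(G')| \le C\, d^3$;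 3. the encoding of $(G',p',k')$ has length at most $q(d)$. -/

import Mathlib

namespace HappyVertices

open Computability

/-- An instance `(G, p, k)` of Maximum Happy Vertices: a simple graph on a finite vertex set, a
positive number `ℓ` of colors, a partial coloring of the vertices with `ℓ` colors (`none` means
that the vertex is not precolored), and an integer target `k`. -/
structure MHVInstance where
  /-- the number of vertices -/
  n : ℕ
  /-- the graph -/
  graph : SimpleGraph (Fin n)
  /-- the number of colors -/
  ℓ : ℕ
  ℓ_pos : 0 < ℓ
  /-- the precoloring -/
  precoloring : Fin n → Option (Fin ℓ)
  /-- the required number of happy vertices -/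
  k : ℤ

/-- A vertex is happy with respect to a coloring if all its neighbours have its color. -/
def IsHappy {V α : Type*} (G : SimpleGraph V) (c : V → α) (v : V) : Prop :=
  ∀ u, G.Adj v u → c u = c v

/-- The full coloring `c` extends the partial coloring `p`. -/
def Extends {V α : Type*} (p : V → Option α) (c : V → α) : Prop :=
  ∀ v a, p v = some a → c v = a

/-- The question of Maximum Happy Vertices: is there a coloring extending the precoloring for which
at least `k` vertices are happy? -/
def MHVInstance.IsYes (I : MHVInstance) : Prop :=
  ∃ c : Fin I.n → Fin I.ℓ, Extends I.precoloring c ∧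
    I.k ≤ ({v | IsHappy I.graph c v}.ncard : ℤ)

/-- `S` is a clique modulator of `G`: the vertices outside `S` are pairwise adjacent. -/
def IsCliqueModulator {V : Type*} (G : SimpleGraph V) (S : Finset V) : Prop :=
  G.IsClique {v | v ∉ S}

/-- The distance to clique: the smallest size of a clique modulator. -/
noncomputable def distanceToClique {V : Type*} (G : SimpleGraph V) : ℕ :=
  sInf {d | ∃ S : Finset V, IsCliqueModulator G S ∧ S.card = d}

/-! ### Instances as strings over the alphabet `Γ'`

The string of an instance is `k , ℓ , r₁ r₂ … rₙ`, where numbers are written in binary and the record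
`r_v` of the vertex `v` is `row , color )`, with `row` the `v`-th row of the adjacency matrix and
`color ∈ {1, …, ℓ}` the color of `v`, or the empty word if `v` is not precolored. -/

/-- A natural number in binary. -/
def encodeBinary (m : ℕ) : List Γ' := (encodeNat m).map Γ'.bit

/-- An integer: a sign bit (`true` for negative) followed by the absolute value in binary. -/
def encodeInt (z : ℤ) : List Γ' := Γ'.bit (decide (z < 0)) :: encodeBinary z.natAbs

/-- A precolor; the color `i : Fin ℓ` is the `(i + 1)`-st one. -/
def encodeColor {ℓ : ℕ} : Option (Fin ℓ) → List Γ'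
  | none => []
  | some i => encodeBinary (i.val + 1)

open Classical in
/-- The row of the vertex `v` in the adjacency matrix. -/
noncomputable def encodeRow {n : ℕ} (G : SimpleGraph (Fin n)) (v : Fin n) : List Γ' :=
  (List.finRange n).map fun u => Γ'.bit (decide (G.Adj v u))

/-- The record of the vertex `v`, without the closing bracket. -/
noncomputable def MHVInstance.record (I : MHVInstance) (v : Fin I.n) : List Γ' :=
  encodeRow I.graph v ++ Γ'.comma :: encodeColor (I.precoloring v)

/-- The string of an instance. -/
noncomputable def MHVInstance.encode (I : MHVInstance) : List Γ' :=
  encodeInt I.k ++ Γ'.comma :: (encodeBinary I.ℓ ++ Γ'.comma ::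
    ((List.finRange I.n).map fun v => I.record v ++ [Γ'.ket]).flatten)

/-! Distinct instances have distinct strings. -/

theorem eq_of_append_cons_eq {x y s t : List Γ'} {a : Γ'} (hx : a ∉ x) (hy : a ∉ y) :
    x ++ a :: s = y ++ a :: t → x = y ∧ s = t := by
  induction x generalizing y with
  | nil => cases y with
    | nil => simp
    | cons b y =>
      intro h
      simp only [List.nil_append, List.cons_append, List.cons.injEq] at h
      exact absurd (h.1 ▸ List.mem_cons_self) hy
  | cons b x ih => cases y with
    | nil =>
      intro h
      simp only [List.nil_append, List.cons_append, List.cons.injEq] at h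
      exact absurd (h.1 ▸ List.mem_cons_self) hx
    | cons c y =>
      simp only [List.cons_append, List.cons.injEq, List.mem_cons, not_or] at hx hy ⊢
      rintro ⟨rfl, h⟩
      exact ⟨⟨rfl, (ih hx.2 hy.2 h).1⟩, (ih hx.2 hy.2 h).2⟩

theorem bit_injective : Function.Injective Γ'.bit := fun _ _ h => by cases h; rfl

theorem encodeBinary_injective : Function.Injective encodeBinary :=
  (bit_injective.list_map).comp encodingNatBool.encode_injective

theorem comma_notMem_encodeBinary (m : ℕ) : Γ'.comma ∉ encodeBinary m := by simp [encodeBinary]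

theorem ket_notMem_encodeBinary (m : ℕ) : Γ'.ket ∉ encodeBinary m := by simp [encodeBinary]

theorem encodeInt_injective : Function.Injective encodeInt := by
  intro a b h
  simp only [encodeInt, List.cons.injEq, Γ'.bit.injEq, decide_eq_decide] at h
  have := encodeBinary_injective h.2
  omega

theorem comma_notMem_encodeInt (z : ℤ) : Γ'.comma ∉ encodeInt z := by
  simp [encodeInt, comma_notMem_encodeBinary]

theorem encodeColor_injective {ℓ : ℕ} : Function.Injective (encodeColor (ℓ := ℓ)) := by
  have h0 : encodeBinary 0 = [] := by decide
  rintro (_ | i) (_ | j) h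
  · rfl
  · exact absurd (encodeBinary_injective (h0.trans h)) (by omega)
  · exact absurd (encodeBinary_injective (h.trans h0.symm)) (by omega)
  · have := encodeBinary_injective (show encodeBinary (i.val + 1) = encodeBinary (j.val + 1) from h)
    congr 1
    ext
    omega

theorem notMem_encodeRow {n : ℕ} (G : SimpleGraph (Fin n)) (v : Fin n) :
    Γ'.comma ∉ encodeRow G v ∧ Γ'.ket ∉ encodeRow G v := by
  simp [encodeRow]

theorem ket_notMem_record (I : MHVInstance) (v : Fin I.n) : Γ'.ket ∉ I.record v := by
  have hc : ∀ c : Option (Fin I.ℓ), Γ'.ket ∉ encodeColor c := by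
    rintro (_ | i)
    · simp [encodeColor]
    · exact ket_notMem_encodeBinary _
  simp [MHVInstance.record, (notMem_encodeRow I.graph v).2, hc]

theorem eq_of_flatten_eq {L M : List (List Γ')} (hL : ∀ w ∈ L, Γ'.ket ∉ w)
    (hM : ∀ w ∈ M, Γ'.ket ∉ w)
    (h : (L.map (· ++ [Γ'.ket])).flatten = (M.map (· ++ [Γ'.ket])).flatten) : L = M := by
  induction L generalizing M with
  | nil => cases M with
    | nil => rfl
    | cons b M => simp at h
  | cons a L ih => cases M with
    | nil => simp at h
    | cons b M =>
      simp only [List.map_cons, List.flatten_cons, List.append_assoc, List.singleton_append] at h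
      have h' := eq_of_append_cons_eq (hL a (by simp)) (hM b (by simp)) h
      rw [h'.1, ih (fun w hw => hL w (by simp [hw])) (fun w hw => hM w (by simp [hw])) h'.2]

theorem MHVInstance.encode_injective : Function.Injective MHVInstance.encode := by
  intro I J h
  obtain ⟨hk, h⟩ := eq_of_append_cons_eq (comma_notMem_encodeInt _)
    (comma_notMem_encodeInt _) h
  obtain ⟨hl, h⟩ := eq_of_append_cons_eq (comma_notMem_encodeBinary _)
    (comma_notMem_encodeBinary _) h
  have h : (List.finRange I.n).map I.record = (List.finRange J.n).map J.record := by
    refine eq_of_flatten_eq ?_ ?_ (by simpa [List.map_map, Function.comp_def] using h)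
    · simp only [List.mem_map]
      rintro _ ⟨v, -, rfl⟩
      exact ket_notMem_record I v
    · simp only [List.mem_map]
      rintro _ ⟨v, -, rfl⟩
      exact ket_notMem_record J v
  have hn : I.n = J.n := by simpa using congrArg List.length h
  have hk' := encodeInt_injective hk
  have hl' := encodeBinary_injective hl
  obtain ⟨n, G, l, hl0, p, k⟩ := I
  obtain ⟨m, G', l', hl0', p', z⟩ := J
  dsimp only at hn hk' hl'
  subst hn hk' hl'
  have hr : ∀ v : Fin n, encodeRow G v = encodeRow G' v ∧ p v = p' v := by
    intro v
    have hv := List.map_inj_left.1 h v (by simp)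
    obtain ⟨h1, h2⟩ := eq_of_append_cons_eq (notMem_encodeRow _ _).1
      (notMem_encodeRow _ _).1 hv
    exact ⟨h1, encodeColor_injective h2⟩
  have hG : G = G' := by
    ext v u
    have := List.map_inj_left.1 (hr v).1 u (by simp)
    simpa using this
  have hp : p = p' := funext fun v => (hr v).2
  subst hG hp
  rfl

end HappyVertices

/-! ### Structured stack programs and their compilation to Turing machines. -/

namespace StackProgram

open Turing Computability

/-! Kernel. Let S be the set of endpoints of a greedy maximal matching of the complement graph, and
s = |S|. The other vertices form a clique K. Every modulator contains an endpoint of each matched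
pair, so s ≤ 2d; this is why neither d nor a modulator has to be given.

If a vertex of K is happy, then all of K has its colour i, and the happy vertices of K are
candidates for i: vertices of K with no precolour other than i in their closed neighbourhood. If
some colour has k candidates, giving it to all uncoloured vertices proves a yes-instance; so assume
that every colour has fewer than k candidates. A vertex of K that sees two precolours is dead. Any
other one is a candidate for exactly one colour, its signature, or for all colours if it sees no
precolour.

The kernel is an induced subgraph containing S and the marked vertices of K: a common neighbour in K
for each pair from S; two differently coloured vertices, if there are any, of K and of each N(u) ∩ K
with u ∈ S; and for each u ∈ S and each signature, s living neighbours of u with it (all of them if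
there are fewer). Unmarked dead vertices are deleted. Moreover, with t = 3(s² + s + 1) and D = max(k
- t, 0), D unmarked candidates of each colour are deleted and k is lowered by D. Deleting vertices
of empty signature before the others makes a single order serve all colours
(`Represents.deletionRank_eq`). A colour with fewer than D unmarked candidates keeps so few that
even together with S they miss the new target.

`yesOn_iff_of_kept` is the combinatorial core. A good colouring of the kernel extends: if K has a
happy vertex, K is given its colour i, and the s marked neighbours force every u ∈ S next to a
deleted candidate to have colour i as well, so that D happy vertices are gained; if all happy
vertices lie in S, then D = 0 and the common neighbours make the colours demanded of a deleted
vertex consistent. Conversely, at most D deleted vertices are happy, all being candidates for the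
same colour.

Since s + 2 colours suffice for all living vertices and each retains fewer than t candidates, O(s³)
vertices remain (`Represents.length_kept_le`). The precolours are renumbered, and more colours than
vertices are useless (`YesOn.change_colors`), so the encoding is polynomial in d.

Running time. Small stack programs compile to Turing machines
(`Cmd.nonempty_tm2ComputableInPolyTime`). Data are binary trees on a stack, and the predicate `PT`
is closed under composition, pairing, case distinction and folds with polynomially bounded states.
The algorithm is written as a list function from such pieces, and `fun_prop` assembles the proof
that it is in `PT`. -/

/-- Structured programs over a family of stacks. The command `loop k body finish` pops the stack `k`,
runs the body belonging to the popped symbol, and repeats this unless `finish` holds for it. -/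
inductive Cmd (K Γ : Type)
  | skip : Cmd K Γ
  | push : K → Γ → Cmd K Γ
  | seq : Cmd K Γ → Cmd K Γ → Cmd K Γ
  | loop : K → (Option Γ → Cmd K Γ) → (Option Γ → Bool) → Cmd K Γ

namespace Cmd

variable {K Γ : Type}

/-- The program points of a command. -/
def Lab : Cmd K Γ → Type
  | skip => Unit
  | push _ _ => Unit
  | seq c d => Lab c ⊕ Lab d
  | loop _ body _ => Option (Σ o, Lab (body o))

/-- The first program point of a command. -/
def entry : (c : Cmd K Γ) → Lab c
  | skip => ()
  | push _ _ => ()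
  | seq c _ => Sum.inl (entry c)
  | loop _ _ _ => none

noncomputable instance Lab.fintype [Fintype Γ] : (c : Cmd K Γ) → Fintype (Lab c)
  | skip => inferInstanceAs (Fintype Unit)
  | push _ _ => inferInstanceAs (Fintype Unit)
  | seq c d =>
    have := Lab.fintype c
    have := Lab.fintype d
    inferInstanceAs (Fintype (Lab c ⊕ Lab d))
  | loop _ body _ =>
    have := fun o => Lab.fintype (body o)
    inferInstanceAs (Fintype (Option (Σ o, Lab (body o))))

/-- The statements at the program points of a command, where the program points are placed by `emb`
and control passes to `exit` at the end. -/
def code : (c : Cmd K Γ) → {Λ : Type} → (Lab c → Λ) → Λ → Lab c →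
    TM2.Stmt (fun _ : K => Γ) Λ (Option Γ)
  | skip, _, _, exit, _ => .goto fun _ => exit
  | push k a, _, _, exit, _ => .push k (fun _ => a) (.goto fun _ => exit)
  | seq c d, _, emb, _, Sum.inl l => code c (emb ∘ Sum.inl) (emb (Sum.inr (entry d))) l
  | seq _ d, _, emb, exit, Sum.inr l => code d (emb ∘ Sum.inr) exit l
  | loop k body _, _, emb, _, none =>
    .pop k (fun _ o => o) (.goto fun o => emb (some ⟨o, entry (body o)⟩))
  | loop _ body finish, _, emb, exit, some ⟨o, l⟩ =>
    code (body o) (fun l => emb (some ⟨o, l⟩)) (bif finish o then exit else emb none) l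

variable [DecidableEq K]

/-- `Run c S T t`: the command `c` started with the stacks `S` ends with the stacks `T` after
`t` steps. -/
inductive Run : Cmd K Γ → (K → List Γ) → (K → List Γ) → ℕ → Prop
  | skip (S) : Run skip S S 1
  | push (k a S) : Run (push k a) S (Function.update S k (a :: S k)) 1
  | seq {c d S T U m n} : Run c S T m → Run d T U n → Run (seq c d) S U (m + n)
  | finish {k body finish S T m} (o) (ho : (S k).head? = o) : finish o = true →
      Run (body o) (Function.update S k (S k).tail) T m → Run (loop k body finish) S T (m + 1)
  | next {k body finish S T U m n} (o) (ho : (S k).head? = o) : finish o = false →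
      Run (body o) (Function.update S k (S k).tail) T m → Run (loop k body finish) T U n →
      Run (loop k body finish) S U (m + 1 + n)

theorem step_loop {Λ : Type} {q : TM2.Stmt (fun _ : K => Γ) Λ (Option Γ)} {k : K} {l : Option Γ → Λ}
    (hq : q = .pop k (fun _ o => o) (.goto l)) (v : Option Γ) (S : K → List Γ) {o : Option Γ}
    (ho : (S k).head? = o) :
    TM2.stepAux q v S = ⟨some (l o), o, Function.update S k (S k).tail⟩ := by
  simp [hq, ho]

/-- Correctness of compilation, by induction on the run. The placement `emb`, the exit label and the
register value are arbitrary because a subcommand sits inside a larger program and inherits whatever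
symbol was popped last. -/
theorem Run.iterate_step {Λ : Type} {M : Λ → TM2.Stmt (fun _ : K => Γ) Λ (Option Γ)}
    {c : Cmd K Γ} {S T : K → List Γ} {t : ℕ} (h : Run c S T t) :
    ∀ (emb : Lab c → Λ) (exit : Λ) (_ : ∀ l, M (emb l) = code c emb exit l) (v : Option Γ),
      ∃ v', (flip bind (TM2.step M))^[t] (some ⟨some (emb (entry c)), v, S⟩) =
        some ⟨some exit, v', T⟩ := by
  induction h with
  | skip S =>
    intro emb exit hM v
    exact ⟨v, by simp [flip, hM, code]⟩
  | push k a S =>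
    intro emb exit hM v
    exact ⟨v, by simp [flip, hM, code]⟩
  | @seq c d S T U m n _ _ ihc ihd =>
    intro emb exit hM v
    obtain ⟨v₁, h₁⟩ := ihc (emb ∘ Sum.inl) (emb (Sum.inr (entry d))) (fun l => hM (Sum.inl l)) v
    obtain ⟨v₂, h₂⟩ := ihd (emb ∘ Sum.inr) exit (fun l => hM (Sum.inr l)) v₁
    refine ⟨v₂, ?_⟩
    rw [add_comm, Function.iterate_add_apply]
    exact (congrArg _ h₁).trans h₂
  | @finish k body finish S T m o ho hs _ ih =>
    intro emb exit hM v
    obtain ⟨v₁, h₁⟩ := ih (fun l => emb (some ⟨o, l⟩)) exit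
      (fun l => (hM (some ⟨o, l⟩)).trans (by simp [code, hs])) o
    refine ⟨v₁, ?_⟩
    rw [Function.iterate_succ_apply, ← h₁]
    congr 1
    exact congrArg some (step_loop (hM none) v S ho)
  | @next k body finish S T U m n o ho hs _ _ ih ih' =>
    intro emb exit hM v
    obtain ⟨v₁, h₁⟩ := ih (fun l => emb (some ⟨o, l⟩)) (emb none)
      (fun l => (hM (some ⟨o, l⟩)).trans (by simp [code, hs])) o
    obtain ⟨v₂, h₂⟩ := ih' emb exit hM v₁
    refine ⟨v₂, ?_⟩
    rw [add_comm, Function.iterate_add_apply, Function.iterate_succ_apply, ← h₂]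
    congr 1
    refine Eq.trans ?_ h₁
    congr 1
    exact congrArg some (step_loop (hM none) v S ho)

/-- A run adds at most one symbol to a stack in each step. -/
theorem Run.length_le {c : Cmd K Γ} {S T : K → List Γ} {t : ℕ} (h : Run c S T t) (k : K) :
    (T k).length ≤ (S k).length + t := by
  have hpop : ∀ (S : K → List Γ) (k' : K),
      (Function.update S k' (S k').tail k).length ≤ (S k).length := by
    intro S k'
    rcases eq_or_ne k k' with rfl | h <;> simp [*]
  induction h with
  | skip => omega
  | push k' a S => rcases eq_or_ne k k' with rfl | h <;> simp [*]
  | seq _ _ h₁ h₂ => omega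
  | @finish k' _ _ S _ _ _ _ _ _ ih => have := hpop S k'; omega
  | @next k' _ _ S _ _ _ _ _ _ _ _ _ ih ih' => have := hpop S k'; omega

/-- The Turing machine that runs a command. -/
noncomputable def toFinTM2 [Fintype K] [Fintype Γ] (k : K) (c : Cmd K Γ) : FinTM2 where
  K := K
  k₀ := k
  k₁ := k
  Γ _ := Γ
  Λ := Option (Lab c)
  main := some (entry c)
  σ := Option Γ
  initialState := none
  m
    -- A halting configuration must have the initial register value, so the register is cleared;
    -- this costs one step beyond the run of the command.
    | none => .load (fun _ => none) .halt
    | some l => code c some none l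

/-- A command that turns the encoding of `a` on one of the stacks into the encoding of `f a` in
polynomial time, starting and ending with the other stacks empty, yields a Turing machine. -/
theorem nonempty_tm2ComputableInPolyTime [Fintype K] [Fintype Γ] {α β : Type} {ea : α → List Γ}
    {eb : β → List Γ} {f : α → β} (k : K) (c : Cmd K Γ) (p : Polynomial ℕ)
    (h : ∀ a, ∃ t ≤ p.eval (ea a).length,
      Run c (Function.update (fun _ => []) k (ea a)) (Function.update (fun _ => []) k (eb (f a))) t) :
    Nonempty (TM2ComputableInPolyTime ea eb f) := by
  choose t ht hr using h
  refine ⟨{ tm := toFinTM2 k c, inputAlphabet := Equiv.refl _, outputAlphabet := Equiv.refl _,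
            time := p + 1, outputsFun := fun a => ⟨⟨t a + 1, ?_⟩, by simpa using ht a⟩ }⟩
  obtain ⟨v, hv⟩ := (hr a).iterate_step (M := (toFinTM2 k c).m) some none (fun _ => rfl) none
  rw [add_comm, Function.iterate_add_apply]
  have hinit : initList (toFinTM2 k c) (List.map (Equiv.refl Γ).invFun (ea a)) =
      ⟨some (some (entry c)), none, Function.update (fun _ => []) k (ea a)⟩ := by
    simp only [initList]
    congr 1
    funext k'
    by_cases hk : k' = k
    · refine (dif_pos hk).trans (Eq.trans ?_ (congrArg _ hk.symm))
      exact (List.map_id' (ea a)).trans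
        (Function.update_self (β := fun _ : K => List Γ) k (ea a) (fun _ => [])).symm
    · exact (dif_neg hk).trans
        (Function.update_of_ne (β := fun _ : K => List Γ) hk (ea a) (fun _ => [])).symm
  have hhalt : haltList (toFinTM2 k c) (List.map (Equiv.refl Γ).invFun (eb (f a))) =
      ⟨none, none, Function.update (fun _ => []) k (eb (f a))⟩ := by
    simp only [haltList]
    congr 1
    funext k'
    by_cases hk : k' = k
    · refine (dif_pos hk).trans (Eq.trans ?_ (congrArg _ hk.symm))
      exact (List.map_id' (eb (f a))).trans
        (Function.update_self (β := fun _ : K => List Γ) k (eb (f a)) (fun _ => [])).symm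
    · exact (dif_neg hk).trans
        (Function.update_of_ne (β := fun _ : K => List Γ) hk (eb (f a)) (fun _ => [])).symm
  refine Eq.trans (congrArg _ ((congrArg _ (congrArg some hinit)).trans hv)) ?_
  exact Eq.trans (by rfl) (congrArg some hhalt.symm)

end Cmd

end StackProgram

namespace StackProgram

open Turing Computability

theorem eval_mono (p : Polynomial ℕ) : Monotone fun n => p.eval n := by
  intro a b h
  simp only [Polynomial.eval_eq_sum_range]
  exact Finset.sum_le_sum fun i _ => Nat.mul_le_mul_left _ (Nat.pow_le_pow_left h i)

/-! ### Binary trees on a stack -/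

/-- Binary trees, the universal data type of stack programs. -/
inductive BinTree
  | nil : BinTree
  | cons : BinTree → BinTree → BinTree

/-- The prefix code of a tree. -/
def BinTree.code : BinTree → List Γ'
  | nil => [Γ'.bit false]
  | cons l r => Γ'.bit true :: (l.code ++ r.code)

/-- Programs over five stacks: the main stack and four auxiliary ones. -/
abbrev Prog := Cmd (Fin 5) Γ'

/-- The contents of the five stacks. -/
def store (m a b c d : List Γ') : Fin 5 → List Γ' := ![m, a, b, c, d]

/-- The main stack is given and the other store are empty. -/
abbrev onMain (m : List Γ') : Fin 5 → List Γ' := store m [] [] [] []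

section update

variable (m a b c d x : List Γ')

@[simp] theorem store_zero : store m a b c d 0 = m := rfl
@[simp] theorem store_one : store m a b c d 1 = a := rfl
@[simp] theorem store_two : store m a b c d 2 = b := rfl
@[simp] theorem store_three : store m a b c d 3 = c := rfl
@[simp] theorem store_four : store m a b c d 4 = d := rfl

@[simp] theorem update_store_zero : Function.update (store m a b c d) 0 x = store x a b c d := by
  ext i; fin_cases i <;> rfl

@[simp] theorem update_store_one : Function.update (store m a b c d) 1 x = store m x b c d := by
  ext i; fin_cases i <;> rfl

@[simp] theorem update_store_two : Function.update (store m a b c d) 2 x = store m a x c d := by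
  ext i; fin_cases i <;> rfl

@[simp] theorem update_store_three :
    Function.update (store m a b c d) 3 x = store m a b x d := by
  ext i; fin_cases i <;> rfl

@[simp] theorem update_store_four : Function.update (store m a b c d) 4 x = store m a b c x := by
  ext i; fin_cases i <;> rfl

end update

/-- The program `c` leads from the stacks `S` to the stacks `T` in at most `n` steps. -/
def Runs (c : Prog) (S T : Fin 5 → List Γ') (n : ℕ) : Prop := ∃ t ≤ n, Cmd.Run c S T t

theorem Runs.mono {c : Prog} {S T : Fin 5 → List Γ'} {m n : ℕ} (h : Runs c S T m) (hmn : m ≤ n) :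
    Runs c S T n :=
  let ⟨t, ht, h⟩ := h
  ⟨t, ht.trans hmn, h⟩

theorem Runs.skip (S : Fin 5 → List Γ') : Runs .skip S S 1 := ⟨1, le_rfl, .skip S⟩

theorem Runs.push {k : Fin 5} {a : Γ'} {S T : Fin 5 → List Γ'}
    (h : Function.update S k (a :: S k) = T) : Runs (.push k a) S T 1 :=
  ⟨1, le_rfl, h ▸ .push k a S⟩

theorem Runs.seq {c d : Prog} {S T U : Fin 5 → List Γ'} {m n : ℕ} (h₁ : Runs c S T m)
    (h₂ : Runs d T U n) : Runs (.seq c d) S U (m + n) :=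
  let ⟨t₁, ht₁, h₁⟩ := h₁
  let ⟨t₂, ht₂, h₂⟩ := h₂
  ⟨t₁ + t₂, by omega, .seq h₁ h₂⟩

theorem Runs.finish {k : Fin 5} {body : Option Γ' → Prog} {finish : Option Γ' → Bool}
    {S S' T : Fin 5 → List Γ'} {m : ℕ} (o : Option Γ') (ho : (S k).head? = o) (hs : finish o = true)
    (hS : Function.update S k (S k).tail = S') (h : Runs (body o) S' T m) :
    Runs (.loop k body finish) S T (m + 1) :=
  let ⟨t, ht, h⟩ := h
  ⟨t + 1, by omega, .finish o ho hs (hS ▸ h)⟩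

theorem Runs.next {k : Fin 5} {body : Option Γ' → Prog} {finish : Option Γ' → Bool}
    {S S' T U : Fin 5 → List Γ'} {m n : ℕ} (o : Option Γ') (ho : (S k).head? = o)
    (hs : finish o = false) (hS : Function.update S k (S k).tail = S') (h : Runs (body o) S' T m)
    (h' : Runs (.loop k body finish) T U n) : Runs (.loop k body finish) S U (m + 1 + n) :=
  let ⟨t, ht, h⟩ := h
  let ⟨t', ht', h'⟩ := h'
  ⟨t + 1 + t', by omega, .next o ho hs (hS ▸ h) h'⟩

/-- Pop a symbol and branch on it. -/
def popCase (k : Fin 5) (body : Option Γ' → Prog) : Prog := .loop k body fun _ => true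

theorem Runs.popCase {k : Fin 5} {body : Option Γ' → Prog} {S S' T : Fin 5 → List Γ'} {m : ℕ}
    (o : Option Γ') (ho : (S k).head? = o) (hS : Function.update S k (S k).tail = S')
    (h : Runs (body o) S' T m) : Runs (popCase k body) S T (m + 1) :=
  .finish o ho rfl hS h

/-- Empty the stack `k`, running a program on each symbol. -/
def drain (k : Fin 5) (body : Γ' → Prog) : Prog :=
  .loop k (fun o => o.elim .skip body) Option.isNone

/-- Move the stack `k` to the stack `j`, reversing it. -/
def transfer (k j : Fin 5) : Prog := drain k (.push j)

theorem runs_drain {k : Fin 5} {body : Γ' → Prog} {m : ℕ} (S : List Γ' → Fin 5 → List Γ')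
    (T : List Γ' → Fin 5 → List Γ')
    (hk : ∀ w, S w k = w) (hS : ∀ x w, Function.update (S (x :: w)) k w = T (x :: w))
    (h : ∀ x w, Runs (body x) (T (x :: w)) (S w) m) (w : List Γ') :
    Runs (drain k body) (S w) (S []) ((m + 1) * w.length + 2) := by
  induction w with
  | nil => exact .finish none (by simp [hk]) rfl (by simp [hk]) (.skip _)
  | cons x w ih =>
    exact (Runs.next (some x) (by simp [hk]) rfl (by simpa [hk] using hS x w) (h x w) ih).mono
      (by simp only [List.length_cons]; ring_nf; omega)

theorem runs_transfer_one (m b c d w : List Γ') :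
    Runs (transfer 1 0) (store m w b c d) (store (w.reverse ++ m) [] b c d) (2 * w.length + 2) := by
  induction w generalizing m with
  | nil => exact .finish none rfl rfl (by simp) (.skip _)
  | cons x w ih =>
    exact (Runs.next (some x) rfl rfl (update_store_one ..) (.push (by simp; rfl))
      (by
        simp only [List.reverse_cons, List.append_assoc]
        exact ih (x :: m))).mono (by simp only [List.length_cons]; omega)

theorem runs_transfer_zero_one (a b c d w : List Γ') :
    Runs (transfer 0 1) (store w a b c d) (store [] (w.reverse ++ a) b c d) (2 * w.length + 2) := by
  induction w generalizing a with
  | nil => exact .finish none rfl rfl (by simp) (.skip _)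
  | cons x w ih =>
    exact (Runs.next (some x) rfl rfl (update_store_zero ..) (.push (by simp; rfl))
      (by
        simp only [List.reverse_cons, List.append_assoc]
        exact ih (x :: a))).mono (by simp only [List.length_cons]; omega)

theorem runs_transfer_two (m a c d w : List Γ') :
    Runs (transfer 2 0) (store m a w c d) (store (w.reverse ++ m) a [] c d) (2 * w.length + 2) := by
  induction w generalizing m with
  | nil => exact .finish none rfl rfl (by simp) (.skip _)
  | cons x w ih =>
    exact (Runs.next (some x) rfl rfl (update_store_two ..) (.push (by simp; rfl))
      (by
        simp only [List.reverse_cons, List.append_assoc]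
        exact ih (x :: m))).mono (by simp only [List.length_cons]; omega)

theorem runs_transfer_four (m a b c w : List Γ') :
    Runs (transfer 4 0) (store m a b c w) (store (w.reverse ++ m) a b c []) (2 * w.length + 2) := by
  induction w generalizing m with
  | nil => exact .finish none rfl rfl (by simp) (.skip _)
  | cons x w ih =>
    exact (Runs.next (some x) rfl rfl (update_store_four ..) (.push (by simp; rfl))
      (by
        simp only [List.reverse_cons, List.append_assoc]
        exact ih (x :: m))).mono (by simp only [List.length_cons]; omega)

theorem runs_transfer_two_one (m a c d w : List Γ') :
    Runs (transfer 2 1) (store m a w c d) (store m (w.reverse ++ a) [] c d) (2 * w.length + 2) := by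
  induction w generalizing a with
  | nil => exact .finish none rfl rfl (by simp) (.skip _)
  | cons x w ih =>
    exact (Runs.next (some x) rfl rfl (update_store_two ..) (.push (by simp; rfl))
      (by
        simp only [List.reverse_cons, List.append_assoc]
        exact ih (x :: a))).mono (by simp only [List.length_cons]; omega)

/-- One round of `lift`: move a symbol and update the number of trees that are still expected. -/
def liftBody (j : Fin 5) : Option Γ' → Prog
  | none => .skip
  | some _ => popCase 0 fun o =>
    if o = some (.bit true) then
      .seq (.push j (.bit true)) (.seq (.push 3 .blank) (.push 3 .blank))
    else .push j (.bit false)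

/-- Move a tree from the main stack to the stack `j`, reversing its code. -/
def lift (j : Fin 5) : Prog := .seq (.push 3 .blank) (.loop 3 (liftBody j) Option.isNone)

/-- Put the word `w` onto the stack `j`. -/
def onto (j : Fin 5) (w : List Γ') (S : Fin 5 → List Γ') : Fin 5 → List Γ' :=
  Function.update S j (w ++ S j)

/-- Each blank on stack 3 stands for a tree still to be read: a leaf uses up one, an inner node
replaces one by two. The statement is in continuation form, with the rest of the loop as hypothesis
`h`, so that the runs for the two subtrees can be chained in the induction. -/
theorem runs_lift_loop {j : Fin 5} (hj : j = 1 ∨ j = 2 ∨ j = 4) (t : BinTree)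
    (m a b c d : List Γ') (U : Fin 5 → List Γ') (n : ℕ)
    (h : Runs (.loop 3 (liftBody j) Option.isNone) (onto j t.code.reverse (store m a b c d)) U n) :
    Runs (.loop 3 (liftBody j) Option.isNone) (store (t.code ++ m) a b (.blank :: c) d) U
      (n + 5 * t.code.length) := by
  induction t generalizing m a b c d n with
  | nil =>
    have key : Runs (liftBody j (some .blank)) (store (BinTree.nil.code ++ m) a b c d)
        (onto j BinTree.nil.code.reverse (store m a b c d)) 2 := by
      refine .popCase (S' := store m a b c d) (some (.bit false)) rfl (by simp [BinTree.code]) ?_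
      simp only [Option.some.injEq, Γ'.bit.injEq, Bool.false_eq_true, if_false]
      exact .push (by simp [onto, BinTree.code])
    exact (Runs.next (some .blank) rfl rfl (by simp) key h).mono (by simp [BinTree.code]; omega)
  | cons l r ihl ihr =>
    have key : Runs (liftBody j (some .blank)) (store ((l.cons r).code ++ m) a b c d)
        (onto j [.bit true] (store (l.code ++ (r.code ++ m)) a b (.blank :: .blank :: c) d)) 4 := by
      refine .popCase (S' := store (l.code ++ (r.code ++ m)) a b c d) (some (.bit true)) rfl
        (by simp [BinTree.code]) ?_
      simp only [if_true]
      refine Runs.seq (m := 1) (n := 2) (.push rfl) (.seq (m := 1) (n := 1) (.push rfl) (.push ?_))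
      rcases hj with rfl | rfl | rfl <;> simp [onto]
    refine (Runs.next (n := n + 5 * r.code.length + 5 * l.code.length)
      (some .blank) rfl rfl (update_store_three ..) key ?_).mono
      (by simp [BinTree.code]; omega)
    rcases hj with rfl | rfl | rfl <;>
    · simp only [onto, store_one, store_two, store_four, update_store_one, update_store_two,
        update_store_four] at h ihl ihr ⊢
      exact ihl _ _ _ _ _ _ (ihr _ _ _ _ _ _ (by simpa [BinTree.code] using h))

theorem runs_lift {j : Fin 5} (hj : j = 1 ∨ j = 2 ∨ j = 4) (t : BinTree) (m a b d : List Γ') :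
    Runs (lift j) (store (t.code ++ m) a b [] d) (onto j t.code.reverse (store m a b [] d))
      (5 * t.code.length + 3) := by
  refine (Runs.seq (.push (update_store_three ..))
    (runs_lift_loop hj t m a b [] d _ 2 ?_)).mono (by omega)
  refine .finish none ?_ rfl ?_ (.skip _) <;> rcases hj with rfl | rfl | rfl <;> simp [onto]

theorem runs_lift_one (t : BinTree) (m a b d : List Γ') :
    Runs (lift 1) (store (t.code ++ m) a b [] d) (store m (t.code.reverse ++ a) b [] d)
      (5 * t.code.length + 3) := by
  simpa [onto] using runs_lift (j := 1) (by simp) t m a b d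

theorem runs_lift_two (t : BinTree) (m a b d : List Γ') :
    Runs (lift 2) (store (t.code ++ m) a b [] d) (store m a (t.code.reverse ++ b) [] d)
      (5 * t.code.length + 3) := by
  simpa [onto] using runs_lift (j := 2) (by simp) t m a b d

theorem runs_lift_four (t : BinTree) (m a b d : List Γ') :
    Runs (lift 4) (store (t.code ++ m) a b [] d) (store m a b [] (t.code.reverse ++ d))
      (5 * t.code.length + 3) := by
  simpa [onto] using runs_lift (j := 4) (by simp) t m a b d

/-- Remove a symbol from the main stack. -/
def pop : Prog := popCase 0 fun _ => .skip

theorem runs_pop (x : Γ') (m : List Γ') {a b c d : List Γ'} :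
    Runs pop (store (x :: m) a b c d) (store m a b c d) 2 :=
  .popCase (some x) rfl (by simp) (.skip _)

theorem runs_push (x : Γ') (m : List Γ') : Runs (.push 0 x) (onMain m) (onMain (x :: m)) 1 :=
  .push (by simp)

/-- Remove a tree from the main stack. -/
def drop : Prog := .seq (lift 1) (drain 1 fun _ => .skip)

theorem runs_drop (t : BinTree) (m : List Γ') :
    Runs drop (onMain (t.code ++ m)) (onMain m) (7 * t.code.length + 5) :=
  ((runs_lift_one t m [] [] []).seq
    (runs_drain (m := 1) (fun w => store m w [] [] []) (fun w => store m w.tail [] [] [])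
      (by simp) (by simp) (fun _ _ => .skip _) _)).mono
    (by simp; omega)

/-- Swap the two topmost trees on the main stack. -/
def swap : Prog := .seq (.seq (lift 1) (lift 2)) (.seq (transfer 1 0) (transfer 2 0))

theorem runs_swap (t u : BinTree) (m : List Γ') :
    Runs swap (onMain (t.code ++ (u.code ++ m))) (onMain (u.code ++ (t.code ++ m)))
      (7 * t.code.length + 7 * u.code.length + 10) := by
  have h := ((runs_lift_one t (u.code ++ m) [] [] []).seq (runs_lift_two u m _ [] [])).seq
    ((runs_transfer_one _ _ _ _ _).seq (runs_transfer_two _ _ _ _ _))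
  simp only [List.append_nil, List.reverse_reverse, List.length_reverse] at h
  exact h.mono (by omega)

/-- Duplicate the topmost tree on the main stack. -/
def dup : Prog :=
  .seq (lift 1) (.seq (drain 1 fun x => .seq (.push 0 x) (.push 2 x))
    (.seq (transfer 2 1) (transfer 1 0)))

theorem runs_dup_drain (m b w : List Γ') :
    Runs (drain 1 fun x => .seq (.push 0 x) (.push 2 x)) (store m w b [] [])
      (store (w.reverse ++ m) [] (w.reverse ++ b) [] []) (3 * w.length + 2) := by
  induction w generalizing m b with
  | nil => exact .finish none rfl rfl (by simp) (.skip _)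
  | cons x w ih =>
    exact (Runs.next (some x) rfl rfl (update_store_one ..)
      (.seq (.push (update_store_zero ..)) (.push (update_store_two ..)))
      (by
        simp only [List.reverse_cons, List.append_assoc]
        exact ih (x :: m) (x :: b))).mono (by simp only [List.length_cons]; omega)

theorem runs_dup (t : BinTree) (m : List Γ') :
    Runs dup (onMain (t.code ++ m)) (onMain (t.code ++ (t.code ++ m)))
      (12 * t.code.length + 9) := by
  have h := (runs_lift_one t m [] [] []).seq ((runs_dup_drain m [] _).seq
    ((runs_transfer_two_one _ _ _ _ _).seq (runs_transfer_one _ _ _ _ _)))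
  simp only [List.append_nil, List.reverse_reverse, List.length_reverse] at h
  exact h.mono (by omega)

/-- Swap the second and the third tree on the main stack. -/
def swapBelow : Prog :=
  .seq (.seq (lift 1) (.seq (lift 2) (lift 4)))
    (.seq (transfer 2 0) (.seq (transfer 4 0) (transfer 1 0)))

theorem runs_swapBelow (t u v : BinTree) (m : List Γ') :
    Runs swapBelow (onMain (t.code ++ (u.code ++ (v.code ++ m))))
      (onMain (t.code ++ (v.code ++ (u.code ++ m))))
      (7 * (t.code.length + u.code.length + v.code.length) + 15) := by
  have h := ((runs_lift_one t (u.code ++ (v.code ++ m)) [] [] []).seq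
    ((runs_lift_two u (v.code ++ m) _ [] []).seq (runs_lift_four v m _ _ []))).seq
    ((runs_transfer_two _ _ _ _ _).seq
      ((runs_transfer_four _ _ _ _ _).seq (runs_transfer_one _ _ _ _ _)))
  simp only [List.append_nil, List.reverse_reverse, List.length_reverse] at h
  exact h.mono (by omega)

/-- Push a word on the main stack. -/
def pushWord (w : List Γ') : Prog := w.foldr (fun x c => .seq c (.push 0 x)) .skip

theorem runs_pushWord (w m : List Γ') :
    Runs (pushWord w) (onMain m) (onMain (w ++ m)) (w.length + 1) := by
  induction w with
  | nil => exact .skip _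
  | cons x w ih => exact ih.seq (runs_push x _)

end StackProgram

namespace StackProgram

open Turing Computability

/-! ### Polynomial time functions between encoded types -/

/-- An encoding of a type by binary trees. -/
class Enc (α : Type) where
  /-- the tree of an element -/
  toTree : α → BinTree

/-- The code of an element of an encoded type. -/
def word {α : Type} [Enc α] (a : α) : List Γ' := (Enc.toTree a).code

/-- The length of the code of an element of an encoded type. -/
def size {α : Type} [Enc α] (a : α) : ℕ := (word a).length

instance : Enc Unit := ⟨fun _ => .nil⟩

instance {α β : Type} [Enc α] [Enc β] : Enc (α × β) :=
  ⟨fun x => .cons (Enc.toTree x.1) (Enc.toTree x.2)⟩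

instance {α : Type} [Enc α] : Enc (List α) :=
  ⟨fun l => l.foldr (fun a t => .cons (Enc.toTree a) t) .nil⟩

/-- Truth values are lists of length at most one, which reduces conditionals to case distinction on
lists. -/
instance : Enc Bool := ⟨fun b => Enc.toTree (bif b then [()] else [])⟩

/-- Numbers are unary here. Hence arithmetic is list manipulation, but a binary input must be
truncated at a polynomial bound before it is turned into a number. -/
instance : Enc ℕ := ⟨fun n => Enc.toTree (List.replicate n ())⟩

section word

variable {α β : Type} [Enc α] [Enc β]

theorem word_prod (a : α) (b : β) : word (a, b) = .bit true :: (word a ++ word b) := rfl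

theorem word_nil : word ([] : List α) = [.bit false] := rfl

theorem word_cons (a : α) (l : List α) : word (a :: l) = .bit true :: (word a ++ word l) := rfl

@[simp] theorem size_prod (a : α) (b : β) : size (a, b) = size a + size b + 1 := by
  simp [size, word_prod]

@[simp] theorem size_nil : size ([] : List α) = 1 := rfl

@[simp] theorem size_cons (a : α) (l : List α) : size (a :: l) = size a + size l + 1 := by
  simp [size, word_cons]

@[simp] theorem size_unit (u : Unit) : size u = 1 := rfl

theorem size_bool (b : Bool) : size b ≤ 3 := by cases b <;> decide

@[simp] theorem size_nat (n : ℕ) : size n = 2 * n + 1 := by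
  change size (List.replicate n ()) = _
  induction n with
  | zero => rfl
  | succ n ih => rw [List.replicate_succ, size_cons, ih, size_unit]; omega

theorem size_pos (a : α) : 1 ≤ size a := by
  unfold size word
  cases Enc.toTree a <;> simp [BinTree.code]

theorem length_le_size (l : List α) : l.length ≤ size l := by
  induction l with
  | nil => simp
  | cons a l ih => simp; omega

theorem size_append (l l' : List α) : size (l ++ l') + 1 = size l + size l' := by
  induction l with
  | nil => simp; omega
  | cons a l ih => simp; omega

theorem size_le_of_mem {a : α} {l : List α} (h : a ∈ l) : size a ≤ size l := by
  induction l with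
  | nil => simp at h
  | cons b l ih =>
    rcases List.mem_cons.1 h with rfl | h
    · simp; omega
    · have := ih h; simp; omega

end word

/-- The function `f` is computed by a stack program in polynomial time. -/
@[fun_prop]
def PT {α β : Type} [Enc α] [Enc β] (f : α → β) : Prop :=
  ∃ (c : Prog) (p : Polynomial ℕ), ∀ x m,
    Runs c (onMain (word x ++ m)) (onMain (word (f x) ++ m)) (p.eval (size x))

section closure

variable {α β γ δ σ : Type} [Enc α] [Enc β] [Enc γ] [Enc δ] [Enc σ]

/-- A step pushes at most one symbol, so the running time also bounds the growth of the data. This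
is what makes composition possible. -/
theorem PT.exists_size_le {f : α → β} (hf : PT f) :
    ∃ p : Polynomial ℕ, ∀ x, size (f x) ≤ p.eval (size x) := by
  obtain ⟨c, p, h⟩ := hf
  refine ⟨Polynomial.X + p, fun x => ?_⟩
  obtain ⟨t, ht, h⟩ := h x []
  have := h.length_le 0
  simp only [store_zero, List.append_nil] at this
  simp only [Polynomial.eval_add, Polynomial.eval_X]
  exact this.trans (Nat.add_le_add_left ht _)

theorem PT.of_word_eq {f : α → β} (h : ∀ x, word (f x) = word x) : PT f :=
  ⟨.skip, 1, fun x m => by rw [h, Polynomial.eval_one]; exact .skip _⟩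

@[fun_prop]
theorem PT.id : PT fun x : α => x := .of_word_eq fun _ => rfl

@[fun_prop]
theorem PT.const (b : β) : PT fun _ : α => b := by
  refine ⟨.seq drop (pushWord (word b)),
    7 * Polynomial.X + (5 + (size b + 1 : ℕ) : Polynomial ℕ), fun x m => ?_⟩
  refine ((runs_drop _ m).seq (runs_pushWord (word b) m)).mono ?_
  simp [size, word]
  omega

@[fun_prop]
theorem PT.comp {g : β → γ} {f : α → β} (hg : PT g) (hf : PT f) : PT fun x => g (f x) := by
  obtain ⟨r, hr⟩ := hf.exists_size_le
  obtain ⟨c, p, hf⟩ := hf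
  obtain ⟨d, q, hg⟩ := hg
  refine ⟨.seq c d, p + q.comp r, fun x m => ((hf x m).seq (hg (f x) m)).mono ?_⟩
  simp only [Polynomial.eval_add, Polynomial.eval_comp]
  exact Nat.add_le_add_left (eval_mono q (hr x)) _

@[fun_prop]
theorem PT.fst : PT (Prod.fst : α × β → α) := by
  refine ⟨.seq pop (.seq swap drop), 14 * Polynomial.X + 17, fun x m => ?_⟩
  obtain ⟨a, b⟩ := x
  have h := (runs_pop (.bit true) (word a ++ (word b ++ m))).seq
    ((runs_swap (Enc.toTree a) (Enc.toTree b) m).seq (runs_drop (Enc.toTree b) _))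
  simp only [word_prod, List.cons_append, List.append_assoc]
  refine h.mono ?_
  have := size_prod a b
  simp only [size, word, Polynomial.eval_add, Polynomial.eval_mul, Polynomial.eval_X,
    Polynomial.eval_ofNat] at *
  omega

@[fun_prop]
theorem PT.snd : PT (Prod.snd : α × β → β) := by
  refine ⟨.seq pop drop, 7 * Polynomial.X + 7, fun x m => ?_⟩
  obtain ⟨a, b⟩ := x
  have h := (runs_pop (.bit true) (word a ++ (word b ++ m))).seq (runs_drop (Enc.toTree a) _)
  simp only [word_prod, List.cons_append, List.append_assoc]
  refine h.mono ?_
  have := size_prod a b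
  simp only [size, word, Polynomial.eval_add, Polynomial.eval_mul, Polynomial.eval_X,
    Polynomial.eval_ofNat] at *
  omega

@[fun_prop]
theorem PT.prodMk {f : α → β} {g : α → γ} (hf : PT f) (hg : PT g) : PT fun x => (f x, g x) := by
  obtain ⟨r, hr⟩ := hf.exists_size_le
  obtain ⟨s, hs⟩ := hg.exists_size_le
  obtain ⟨c, p, hf⟩ := hf
  obtain ⟨d, q, hg⟩ := hg
  refine ⟨.seq dup (.seq c (.seq swap (.seq d (.seq swap (.push 0 (.bit true)))))),
    12 * Polynomial.X + 9 + p + q + 14 * r + 7 * s + 7 * Polynomial.X + 21, fun x m => ?_⟩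
  have h := (runs_dup (Enc.toTree x) m).seq ((hf x (word x ++ m)).seq
    ((runs_swap (Enc.toTree (f x)) (Enc.toTree x) m).seq ((hg x (word (f x) ++ m)).seq
      ((runs_swap (Enc.toTree (g x)) (Enc.toTree (f x)) m).seq (runs_push (.bit true) _)))))
  simp only [word_prod, List.cons_append, List.append_assoc]
  refine h.mono ?_
  have := hr x
  have := hs x
  simp only [size, word, Polynomial.eval_add, Polynomial.eval_mul, Polynomial.eval_X,
    Polynomial.eval_ofNat] at *
  omega

/-- Choose the program `c` after the symbol `true` and `d` otherwise. -/
def onTrue (c d : Prog) : Option Γ' → Prog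
  | some (.bit true) => c
  | _ => d

/-- Case distinction on a list. -/
def listCase (l : List α) (b : β) (h : α → List α → β) : β :=
  match l with
  | [] => b
  | a :: l => h a l

-- The list is computed next to a copy of the input, and popping its tag decides the case. In the
-- empty case only the input is left; otherwise two pushed tags turn head, tail and input into
-- nested pairs.
@[fun_prop]
theorem PT.listCase {l : γ → List α} {g : γ → β} {h : γ → α → List α → β} (hl : PT l) (hg : PT g)
    (hh : PT fun y : γ × α × List α => h y.1 y.2.1 y.2.2) :
    PT fun x => listCase (l x) (g x) fun a t => h x a t := by
  have hh' : PT fun y : (α × List α) × γ => h y.2 y.1.1 y.1.2 :=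
    hh.comp (PT.snd.prodMk PT.fst)
  have hlx : PT fun x => (l x, x) := hl.prodMk .id
  obtain ⟨r, hr⟩ := hl.exists_size_le
  obtain ⟨c, p, hlx⟩ := hlx
  obtain ⟨d, q, hg⟩ := hg
  obtain ⟨e, s, hh⟩ := hh'
  refine ⟨.seq c (.seq pop (popCase 0 (onTrue
    (.seq (.push 0 (.bit true)) (.seq (.push 0 (.bit true)) e)) d))),
    p + q + s.comp (r + Polynomial.X + 1) + 5, fun x m => ?_⟩
  have h₁ := (hlx x m)
  simp only [word_prod, List.cons_append, List.append_assoc] at h₁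
  have hx := hr x
  change Runs _ _ (onMain (word (StackProgram.listCase (l x) (g x) (h x)) ++ m)) _
  cases hlx : l x with
  | nil =>
    rw [hlx] at h₁
    refine (h₁.seq ((runs_pop _ _).seq (.popCase (S' := onMain (word x ++ m))
      (some (.bit false)) rfl (by simp [word_nil]) (hg x m)))).mono ?_
    simp only [Polynomial.eval_add, Polynomial.eval_ofNat]
    omega
  | cons a t =>
    rw [hlx] at h₁ hx
    have h₂ := hh ((a, t), x) m
    simp only [word_prod, List.cons_append, List.append_assoc] at h₂
    refine (h₁.seq ((runs_pop _ _).seq (.popCase (S' := onMain (word a ++ (word t ++ (word x ++ m))))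
      (some (.bit true)) rfl (by simp [word_cons])
      ((runs_push _ _).seq ((runs_push _ _).seq h₂))))).mono ?_
    have := eval_mono s (show size ((a, t), x) ≤ r.eval (size x) + size x + 1 by simp at *; omega)
    simp only [Polynomial.eval_add, Polynomial.eval_ofNat, Polynomial.eval_comp, Polynomial.eval_X,
      Polynomial.eval_one] at *
    omega

/-- The bound `B` on the states after all prefixes is essential: a step that is only known to run in
polynomial time could square the size in every round. -/
theorem runs_foldl {f : σ → α → σ} (hf : PT fun y : α × σ => f y.2 y.1) :
    ∃ (c : Prog) (q : Polynomial ℕ), ∀ (l : List α) (s : σ) (m : List Γ') (B : ℕ),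
      (∀ l', l' <+: l → size (l'.foldl f s) ≤ B) →
      Runs c (onMain (word l ++ (word s ++ m))) (onMain (word (l.foldl f s) ++ m))
        (q.eval (size l + B)) := by
  obtain ⟨c, p, hf⟩ := hf
  let body : Prog := .seq swapBelow (.seq (.push 0 (.bit true)) (.seq c swap))
  let loop : Prog := .loop 0 (onTrue body .skip)
    fun o => o ≠ some (.bit true)
  have key : ∀ (N B : ℕ) (m : List Γ') (l : List α) (s : σ), size l ≤ N →
      (∀ l', l' <+: l → size (l'.foldl f s) ≤ B) →
      Runs loop (onMain (word l ++ (word s ++ m))) (onMain (word (l.foldl f s) ++ m))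
        (l.length * (p.eval (N + B) + 14 * (N + B) + 30) + 2) := by
    intro N B m l
    induction l with
    | nil =>
      intro s _ _
      refine (Runs.finish (S' := onMain (word s ++ m)) (some (.bit false)) rfl rfl
        (by simp [word_nil]) (.skip _)).mono (by omega)
    | cons a l ih =>
      intro s hN hB
      have h₁ := runs_swapBelow (Enc.toTree a) (Enc.toTree l) (Enc.toTree s) m
      have h₂ := hf (a, s) (word l ++ m)
      simp only [word_prod, List.cons_append, List.append_assoc] at h₂
      have h₃ := runs_swap (Enc.toTree (f s a)) (Enc.toTree l) m
      have h₄ := ih (f s a) (by simp at hN; omega)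
        (fun l' hl' => by simpa using hB (a :: l') (by simpa using hl'))
      refine (Runs.next (S' := onMain (word a ++ (word l ++ (word s ++ m)))) (some (.bit true)) rfl
        rfl (by simp [word_cons]) (h₁.seq ((runs_push _ _).seq (h₂.seq h₃))) h₄).mono ?_
      have hs : size s ≤ B := by simpa using hB [] (by simp)
      have hs' : size (f s a) ≤ B := by simpa using hB [a] (by simp)
      simp only [size_cons] at hN
      have := eval_mono p (show size (a, s) ≤ N + B by simp; omega)
      simp only [List.length_cons, Nat.succ_mul]
      simp only [size, word] at hN hs hs' this ⊢
      omega
  refine ⟨loop, Polynomial.X * (p + 14 * Polynomial.X + 30) + 2, fun l s m B hB => ?_⟩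
  refine (key (size l) B m l s le_rfl hB).mono ?_
  simp only [Polynomial.eval_add, Polynomial.eval_mul, Polynomial.eval_X, Polynomial.eval_ofNat]
  have := length_le_size l
  gcongr
  omega

/-- Folds whose intermediate results have polynomial size. -/
theorem PT.foldl_of_size_le {l : γ → List α} {init : γ → σ} {step : γ → σ → α → σ} (hl : PT l)
    (hi : PT init) (hs : PT fun y : γ × σ × α => step y.1 y.2.1 y.2.2)
    (hb : ∃ p : Polynomial ℕ, ∀ x l', l' <+: l x →
      size (l'.foldl (step x) (init x)) ≤ p.eval (size x)) :
    PT fun x => (l x).foldl (step x) (init x) := by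
  -- The program of a step sees only the state and the element, so the context `x` is carried along
  -- inside the state.
  have hfold : ∀ (x : γ) (l : List α) (s : σ),
      l.foldl (fun (y : γ × σ) a => (y.1, step y.1 y.2 a)) (x, s) = (x, l.foldl (step x) s) := by
    intro x l
    induction l with
    | nil => simp
    | cons a l ih => intro s; simp [ih]
  have hf : PT fun y : α × γ × σ => (y.2.1, step y.2.1 y.2.2 y.1) :=
    (PT.fst.comp .snd).prodMk
      (hs.comp ((PT.fst.comp .snd).prodMk ((PT.snd.comp .snd).prodMk .fst)))
  obtain ⟨p, hb⟩ := hb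
  obtain ⟨r, hr⟩ := hl.exists_size_le
  obtain ⟨c, q, hc⟩ := runs_foldl (f := fun (y : γ × σ) a => (y.1, step y.1 y.2 a)) hf
  obtain ⟨d, u, hd⟩ := hl.prodMk (PT.id.prodMk hi)
  obtain ⟨e, v, he⟩ := PT.snd (α := γ) (β := σ)
  refine ⟨.seq d (.seq pop (.seq c e)),
    u + 2 + q.comp (r + (Polynomial.X + p + 1)) + v.comp (Polynomial.X + p + 1), fun x m => ?_⟩
  have h₁ := hd x m
  have h₂ := hc (l x) (x, init x) m (size x + p.eval (size x) + 1) (fun l' hl' => by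
    have := hb x l' hl'
    rw [hfold, size_prod]; omega)
  have h₃ := he (x, (l x).foldl (step x) (init x)) m
  rw [word_prod (l x), List.cons_append, List.append_assoc] at h₁
  rw [hfold] at h₂
  refine (h₁.seq ((runs_pop _ _).seq (h₂.seq h₃))).mono ?_
  have := hb x (l x) List.prefix_rfl
  have h₅ := eval_mono v (show size (x, (l x).foldl (step x) (init x)) ≤ size x + p.eval (size x) + 1 by
    rw [size_prod]; omega)
  have h₆ := eval_mono q (show size (l x) + (size x + p.eval (size x) + 1) ≤
    r.eval (size x) + (size x + p.eval (size x) + 1) by have := hr x; omega)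
  simp only [Polynomial.eval_add, Polynomial.eval_comp, Polynomial.eval_X,
      Polynomial.eval_one, Polynomial.eval_ofNat] at *
  omega

/-- Folds in which every step adds an amount that is polynomial in the context. -/
theorem PT.foldl_of_step {l : γ → List α} {init : γ → σ} {step : γ → σ → α → σ} (hl : PT l)
    (hi : PT init) (hs : PT fun y : γ × σ × α => step y.1 y.2.1 y.2.2)
    (hb : ∃ p : Polynomial ℕ, ∀ x s a, a ∈ l x → size (step x s a) ≤ size s + p.eval (size x)) :
    PT fun x => (l x).foldl (step x) (init x) := by
  refine .foldl_of_size_le hl hi hs ?_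
  obtain ⟨p, hb⟩ := hb
  obtain ⟨q, hq⟩ := hi.exists_size_le
  obtain ⟨r, hr⟩ := hl.exists_size_le
  refine ⟨q + r * p, fun x l' hl' => ?_⟩
  have key : ∀ (l' : List α) (s : σ), (∀ a ∈ l', a ∈ l x) →
      size (l'.foldl (step x) s) ≤ size s + l'.length * p.eval (size x) := by
    intro l'
    induction l' with
    | nil => simp
    | cons a l' ih =>
      intro s h
      have h₁ := ih (step x s a) fun b hb => h b (by simp [hb])
      have h₂ := hb x s a (h a (by simp))
      simp only [List.foldl_cons, List.length_cons, Nat.succ_mul]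
      omega
  refine (key l' _ fun a ha => hl'.subset ha).trans ?_
  simp only [Polynomial.eval_add, Polynomial.eval_mul]
  gcongr
  · exact hq x
  · exact hl'.length_le.trans ((length_le_size _).trans (hr x))

end closure

end StackProgram

namespace StackProgram

open Turing Computability

/-! ### Polynomial time functions on lists and numbers -/

section lists

variable {α β γ σ : Type} [Enc α] [Enc β] [Enc γ] [Enc σ]

@[fun_prop]
theorem PT.cons {f : γ → α} {g : γ → List α} (hf : PT f) (hg : PT g) : PT fun x => f x :: g x :=
  (PT.of_word_eq (f := fun y : α × List α => y.1 :: y.2) fun _ => rfl).comp (hf.prodMk hg)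

@[fun_prop]
theorem PT.cond {b : γ → Bool} {f g : γ → β} (hb : PT b) (hf : PT f) (hg : PT g) :
    PT fun x => bif b x then f x else g x := by
  have h : PT fun x => bif b x then [()] else [] :=
    (PT.of_word_eq (f := fun b : Bool => bif b then [()] else []) fun _ => rfl).comp hb
  have h' : PT fun x => StackProgram.listCase (bif b x then [()] else []) (g x) fun _ _ => f x := by
    fun_prop
  convert h' using 2 with x
  cases b x <;> rfl

@[fun_prop]
theorem PT.and {b c : γ → Bool} (hb : PT b) (hc : PT c) : PT fun x => b x && c x := by
  have h : PT fun x => bif b x then c x else false := by fun_prop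
  convert h using 2 with x
  cases b x <;> rfl

@[fun_prop]
theorem PT.or {b c : γ → Bool} (hb : PT b) (hc : PT c) : PT fun x => b x || c x := by
  have h : PT fun x => bif b x then true else c x := by fun_prop
  convert h using 2 with x
  cases b x <;> rfl

@[fun_prop]
theorem PT.not {b : γ → Bool} (hb : PT b) : PT fun x => !b x := by
  have h : PT fun x => bif b x then false else true := by fun_prop
  convert h using 2 with x
  cases b x <;> rfl

@[fun_prop]
theorem PT.tail {l : γ → List α} (hl : PT l) : PT fun x => (l x).tail := by
  have h : PT fun x => StackProgram.listCase (l x) [] fun _ t => t := by fun_prop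
  convert h using 2 with x
  cases l x <;> rfl

@[fun_prop]
theorem PT.headD {l : γ → List α} {d : γ → α} (hl : PT l) (hd : PT d) :
    PT fun x => (l x).headD (d x) := by
  have h : PT fun x => StackProgram.listCase (l x) (d x) fun a _ => a := by fun_prop
  convert h using 2 with x
  cases l x <;> rfl

@[fun_prop]
theorem PT.isEmpty {l : γ → List α} (hl : PT l) : PT fun x => (l x).isEmpty := by
  have h : PT fun x => StackProgram.listCase (l x) true fun _ _ => false := by fun_prop
  convert h using 2 with x
  cases l x <;> rfl

@[fun_prop]
theorem PT.reverse {l : γ → List α} (hl : PT l) : PT fun x => (l x).reverse := by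
  have h : PT fun x => (l x).foldl (fun s a => a :: s) [] := by
    obtain ⟨p, hp⟩ := hl.exists_size_le
    refine .foldl_of_step hl (.const _) (by fun_prop) ⟨p + 1, fun x s a ha => ?_⟩
    have := hp x
    have := size_le_of_mem ha
    simp
    omega
  convert h using 2 with x
  simp

/-- A bound for the results of a polynomial time function on the elements of a list. -/
theorem PT.exists_size_le_of_mem {l : γ → List α} {f : γ → α → β} (hl : PT l)
    (hf : PT fun y : γ × α => f y.1 y.2) :
    ∃ p : Polynomial ℕ, ∀ x, ∀ a ∈ l x, size (f x a) ≤ p.eval (size x) := by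
  obtain ⟨p, hp⟩ := hl.exists_size_le
  obtain ⟨q, hq⟩ := hf.exists_size_le
  refine ⟨q.comp (Polynomial.X + p + 1), fun x a ha => (hq (x, a)).trans ?_⟩
  rw [Polynomial.eval_comp]
  refine eval_mono q ?_
  have := hp x
  have := size_le_of_mem ha
  simp
  omega

-- Collecting results by `cons` reverses the order, hence the fold over the reversed list; `filter`,
-- `append` and `flatMap` use the same device.
@[fun_prop]
theorem PT.map {l : γ → List α} {f : γ → α → β} (hl : PT l) (hf : PT fun y : γ × α => f y.1 y.2) :
    PT fun x => (l x).map (f x) := by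
  have h : PT fun x => (l x).reverse.foldl (fun s a => f x a :: s) [] := by
    obtain ⟨p, hp⟩ := PT.exists_size_le_of_mem hl hf
    refine .foldl_of_step hl.reverse (.const _) (by fun_prop) ⟨p + 1, fun x s a ha => ?_⟩
    have := hp x a (by simpa using ha)
    simp
    omega
  convert h using 2 with x
  rw [List.foldl_reverse]
  induction l x with
  | nil => rfl
  | cons a l ih => rw [List.map_cons, ih, List.foldr_cons]

@[fun_prop]
theorem PT.filter {l : γ → List α} {f : γ → α → Bool} (hl : PT l)
    (hf : PT fun y : γ × α => f y.1 y.2) : PT fun x => (l x).filter (f x) := by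
  have h : PT fun x => (l x).reverse.foldl (fun s a => bif f x a then a :: s else s) [] := by
    obtain ⟨p, hp⟩ := hl.exists_size_le
    refine .foldl_of_step hl.reverse (.const _) (by fun_prop) ⟨p + 1, fun x s a ha => ?_⟩
    have := hp x
    have := size_le_of_mem (List.mem_reverse.1 ha)
    cases f x a <;> simp
    omega
  convert h using 2 with x
  rw [List.foldl_reverse]
  induction l x with
  | nil => rfl
  | cons a l ih => simp only [List.filter_cons, ih, List.foldr_cons]; cases f x a <;> simp

@[fun_prop]
theorem PT.any {l : γ → List α} {f : γ → α → Bool} (hl : PT l)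
    (hf : PT fun y : γ × α => f y.1 y.2) : PT fun x => (l x).any (f x) := by
  have h : PT fun x => !((l x).filter (f x)).isEmpty := by fun_prop
  convert h using 2 with x
  induction l x with
  | nil => rfl
  | cons a l ih => simp only [List.filter_cons, List.any_cons, ih]; cases f x a <;> simp

@[fun_prop]
theorem PT.append {l l' : γ → List α} (hl : PT l) (hl' : PT l') : PT fun x => l x ++ l' x := by
  have h : PT fun x => (l x).reverse.foldl (fun s a => a :: s) (l' x) := by
    obtain ⟨p, hp⟩ := hl.exists_size_le
    refine .foldl_of_step hl.reverse hl' (by fun_prop) ⟨p + 1, fun x s a ha => ?_⟩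
    have := hp x
    have := size_le_of_mem (List.mem_reverse.1 ha)
    simp
    omega
  convert h using 2 with x
  simp

@[fun_prop]
theorem PT.flatMap {l : γ → List α} {f : γ → α → List β} (hl : PT l)
    (hf : PT fun y : γ × α => f y.1 y.2) : PT fun x => (l x).flatMap (f x) := by
  have h : PT fun x => (l x).reverse.foldl (fun s a => f x a ++ s) [] := by
    obtain ⟨p, hp⟩ := PT.exists_size_le_of_mem hl hf
    refine .foldl_of_step hl.reverse (.const _) (by fun_prop) ⟨p + 1, fun x s a ha => ?_⟩
    have := hp x a (by simpa using ha)
    have := size_append (f x a) s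
    simp
    omega
  convert h using 2 with x
  rw [List.foldl_reverse]
  induction l x with
  | nil => rfl
  | cons a l ih => simp [ih]

@[fun_prop]
theorem PT.replicate {n : γ → ℕ} (hn : PT n) : PT fun x => List.replicate (n x) () :=
  (PT.of_word_eq (f := fun n : ℕ => List.replicate n ()) fun _ => rfl).comp hn

-- A list of units has the same code as its length, so it suffices to map all elements to the unit.
@[fun_prop]
theorem PT.length {l : γ → List α} (hl : PT l) : PT fun x => (l x).length := by
  have h : PT fun l : List Unit => l.length := .of_word_eq fun l => by
    change word (List.replicate l.length ()) = word l
    rw [← (List.eq_replicate_iff.2 ⟨rfl, fun _ _ => rfl⟩ : l = List.replicate l.length ())]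
  convert h.comp (hl.map (f := fun _ _ => ()) (.const _)) using 2 with x
  simp

@[fun_prop]
theorem PT.add {m n : γ → ℕ} (hm : PT m) (hn : PT n) : PT fun x => m x + n x := by
  convert (hm.replicate.append hn.replicate).length using 2 with x
  simp

@[fun_prop]
theorem PT.drop {l : γ → List α} {n : γ → ℕ} (hl : PT l) (hn : PT n) :
    PT fun x => (l x).drop (n x) := by
  have h : PT fun x => (List.replicate (n x) ()).foldl (fun s _ => s.tail) (l x) := by
    refine .foldl_of_step hn.replicate hl (by fun_prop) ⟨0, fun x s a ha => ?_⟩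
    cases s <;> simp
    omega
  convert h using 2 with x
  generalize l x = l
  induction n x generalizing l with
  | zero => rfl
  | succ n ih => rw [List.replicate_succ, List.foldl_cons, ← ih, List.drop_tail]

@[fun_prop]
theorem PT.sub {m n : γ → ℕ} (hm : PT m) (hn : PT n) : PT fun x => m x - n x := by
  convert (hm.replicate.drop hn).length using 2 with x
  simp

@[fun_prop]
theorem PT.mul {m n : γ → ℕ} (hm : PT m) (hn : PT n) : PT fun x => m x * n x := by
  convert (hm.replicate.flatMap (f := fun x _ => List.replicate (n x) ()) (by fun_prop)).length
    using 2 with x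
  simp

@[fun_prop]
theorem PT.ble {m n : γ → ℕ} (hm : PT m) (hn : PT n) : PT fun x => (m x).ble (n x) := by
  convert (hm.sub hn).replicate.isEmpty using 2 with x
  rw [Bool.eq_iff_iff, Nat.ble_eq, List.isEmpty_iff, List.replicate_eq_nil_iff]
  omega

@[fun_prop]
theorem PT.beq {m n : γ → ℕ} (hm : PT m) (hn : PT n) : PT fun x => (m x).beq (n x) := by
  convert (hm.ble hn).and (hn.ble hm) using 2 with x
  rw [Bool.eq_iff_iff, Nat.beq_eq, Bool.and_eq_true, Nat.ble_eq, Nat.ble_eq]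
  omega

@[fun_prop]
theorem PT.getD {l : γ → List α} {n : γ → ℕ} {d : γ → α} (hl : PT l) (hn : PT n) (hd : PT d) :
    PT fun x => (l x).getD (n x) (d x) := by
  convert (hl.drop hn).headD hd using 2 with x
  rw [List.headD_eq_head?_getD, List.head?_drop, List.getD_eq_getElem?_getD]

@[fun_prop]
theorem PT.take {l : γ → List α} {n : γ → ℕ} (hl : PT l) (hn : PT n) :
    PT fun x => (l x).take (n x) := by
  have h : PT fun x => (l x).foldl (fun (s : ℕ × List α) a =>
      bif s.1.beq 0 then s else (s.1 - 1, a :: s.2)) (n x, []) := by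
    obtain ⟨p, hp⟩ := hl.exists_size_le
    refine .foldl_of_step hl (by fun_prop) (by fun_prop) ⟨p + 1, fun x s a ha => ?_⟩
    have := hp x
    have := size_le_of_mem ha
    obtain ⟨m, s⟩ := s
    cases m.beq 0 <;> simp
    omega
  have key : ∀ (l s : List α) (m : ℕ), (l.foldl (fun (s : ℕ × List α) a =>
      bif s.1.beq 0 then s else (s.1 - 1, a :: s.2)) (m, s)).2 = (l.take m).reverse ++ s := by
    intro l
    induction l with
    | nil => simp
    | cons a l ih =>
      intro s m
      cases m with
      | zero => simpa using ih s 0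
      | succ m =>
        rw [List.foldl_cons, show (m + 1).beq 0 = false from rfl]
        simpa using ih (a :: s) m
  convert (PT.snd.comp h).reverse using 2 with x
  rw [key]
  simp

@[fun_prop]
theorem PT.range {n : γ → ℕ} (hn : PT n) : PT fun x => List.range (n x) := by
  have key : ∀ m : ℕ, (List.replicate m ()).foldl (fun (s : List ℕ) _ => s.length :: s) [] =
      (List.range m).reverse := by
    intro m
    induction m with
    | zero => rfl
    | succ m ih =>
      rw [List.replicate_succ', List.foldl_append, ih]
      simp [List.range_succ]
  -- The state after m rounds is known explicitly, which gives a quadratic bound on its size.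
  have hsize : ∀ m : ℕ, size (List.range m).reverse ≤ m * (2 * m + 2) + 1 := by
    intro m
    induction m with
    | zero => simp
    | succ m ih => simp [List.range_succ]; nlinarith
  have h : PT fun x => (List.replicate (n x) ()).foldl (fun (s : List ℕ) _ => s.length :: s) [] := by
    obtain ⟨p, hp⟩ := hn.exists_size_le
    refine .foldl_of_size_le hn.replicate (.const _) (by fun_prop)
      ⟨p * (2 * p + 2) + 1, fun x l' hl' => ?_⟩
    rw [List.eq_replicate_of_mem (a := ()) (l := l') (fun _ _ => rfl), key]
    refine (hsize _).trans ?_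
    have h₁ := hp x
    have h₂ := hl'.length_le
    simp only [size_nat, List.length_replicate] at h₁ h₂
    have h₃ : l'.length ≤ p.eval (size x) := by omega
    simp only [Polynomial.eval_add, Polynomial.eval_mul, Polynomial.eval_ofNat, Polynomial.eval_one]
    gcongr
  convert h.reverse using 2 with x
  rw [key, List.reverse_reverse]

/-- Equality of words of bits. -/
def eqBits (l l' : List Bool) : Bool := decide (l = l')

@[simp] theorem eqBits_iff {l l' : List Bool} : eqBits l l' = true ↔ l = l' := decide_eq_true_iff

@[fun_prop]
theorem PT.eqBits {l l' : γ → List Bool} (hl : PT l) (hl' : PT l') :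
    PT fun x => eqBits (l x) (l' x) := by
  -- The state records whether all symbols agreed so far and what is left of the second word.
  -- Running out of the second word sets the flag to false for good.
  let step (s : Bool × List Bool) (a : Bool) : Bool × List Bool :=
    StackProgram.listCase s.2 (false, []) fun b r => (s.1 && (bif a then b else !b), r)
  have h : PT fun x => (l x).foldl step (true, l' x) := by
    refine .foldl_of_step hl (by fun_prop) (by fun_prop) ⟨2, fun x s a ha => ?_⟩
    obtain ⟨b, r⟩ := s
    have h₁ := size_pos b
    cases r with
    | nil =>
      have := size_bool false
      simp [step, StackProgram.listCase]
      omega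
    | cons c r =>
      have := size_bool (b && (bif a then c else !c))
      have := size_pos c
      simp [step, StackProgram.listCase]
      omega
  have key : ∀ (l r : List Bool) (b : Bool),
      (let s := l.foldl step (b, r); s.1 && s.2.isEmpty) = (b && StackProgram.eqBits l r) := by
    intro l
    induction l with
    | nil => intro r b; cases r <;> simp [StackProgram.eqBits]
    | cons a l ih =>
      intro r b
      rw [List.foldl_cons]
      cases r with
      | nil => simpa [step, StackProgram.listCase, StackProgram.eqBits] using ih [] false
      | cons c r =>
        refine (ih r (b && (bif a then c else !c))).trans ?_
        cases a <;> cases b <;> cases c <;> simp [StackProgram.eqBits]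
  have h' : PT fun x => (let s := (l x).foldl step (true, l' x); s.1 && s.2.isEmpty) :=
    (PT.fst.comp h).and (PT.snd.comp h).isEmpty
  convert h' using 2 with x
  rw [key]
  simp

/-- Membership in a list of numbers. -/
def memNat (a : ℕ) (l : List ℕ) : Bool := l.any fun b => Nat.beq a b

@[simp] theorem memNat_iff {a : ℕ} {l : List ℕ} : memNat a l = true ↔ a ∈ l := by
  simp [memNat]

@[fun_prop]
theorem PT.memNat {a : γ → ℕ} {l : γ → List ℕ} (ha : PT a) (hl : PT l) :
    PT fun x => memNat (a x) (l x) := by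
  unfold StackProgram.memNat
  fun_prop

end lists

end StackProgram

namespace StackProgram

open Turing Computability

/-! ### Reading and writing words over `Γ'` -/

/-- A symbol as a pair of Booleans. -/
def ofSymbol : Γ' → Bool × Bool
  | .bit b => (true, b)
  | .comma => (false, false)
  -- Encodings of instances contain neither `blank` nor `bra`, so these may share the pair of `ket`.
  | _ => (false, true)

/-- The symbol of a pair of Booleans. -/
def toSymbol : Bool × Bool → Γ'
  | (true, b) => .bit b
  | (false, false) => .comma
  | (false, true) => .ket

/-- Turn a word on the main stack into the code of a list. -/
def readInput : Prog :=
  .seq (transfer 0 1) (.seq (.push 0 (.bit false))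
    (drain 1 fun x => .seq (pushWord (word (ofSymbol x))) (.push 0 (.bit true))))

/-- The code of a list is built from its end. Moving the word to stack 1 reverses it, so its last
symbol is the first to be processed. -/
theorem runs_readInput (w : List Γ') :
    Runs readInput (onMain w) (onMain (word (w.map ofSymbol))) (13 * w.length + 5) := by
  have hdrain : ∀ (w : List Γ') (l : List (Bool × Bool)),
      Runs (drain 1 fun x => .seq (pushWord (word (ofSymbol x))) (.push 0 (.bit true)))
        (store (word l) w [] [] []) (onMain (word (w.reverse.map ofSymbol ++ l)))
        (11 * w.length + 2) := by
    intro w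
    induction w with
    | nil => intro l; exact .finish none rfl rfl (by simp) (.skip _)
    | cons x w ih =>
      intro l
      have hword : ∀ (v m : List Γ'), Runs (pushWord v) (store m w [] [] [])
          (store (v ++ m) w [] [] []) (v.length + 1) := by
        intro v
        induction v with
        | nil => intro m; exact .skip _
        | cons y v ihv => intro m; exact (ihv m).seq (.push (update_store_zero ..))
      have hlen : (word (ofSymbol x)).length ≤ 7 := by
        rcases x with _ | (_ | _) | _ | _ | _ <;> decide
      have h := ih (ofSymbol x :: l)
      rw [List.reverse_cons, List.map_append, List.append_assoc]
      exact (Runs.next (some x) rfl rfl (update_store_one ..)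
        ((hword _ _).seq (.push (update_store_zero ..))) h).mono
        (by simp only [List.length_cons]; omega)
  have h := (runs_transfer_zero_one [] [] [] [] w).seq
    ((Runs.push (update_store_zero ..)).seq (hdrain (w.reverse ++ []) []))
  simp only [List.append_nil, List.reverse_reverse] at h
  exact h.mono (by simp; omega)

/-- Read a Boolean from the main stack and choose a program. -/
def readBool (c d : Prog) : Prog := popCase 0 (onTrue (.seq pop (.seq pop c)) d)

theorem runs_readBool {c d : Prog} (b : Bool) {m w : List Γ'} {S : Fin 5 → List Γ'} {n : ℕ}
    (h : Runs (bif b then c else d) (store m w [] [] []) S n) :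
    Runs (readBool c d) (store (word b ++ m) w [] [] []) S (n + 5) := by
  cases b with
  | false =>
    exact (Runs.popCase (some (.bit false)) rfl (update_store_zero ..) h).mono (by omega)
  | true =>
    exact (Runs.popCase (some (.bit true)) rfl (update_store_zero ..)
      ((runs_pop _ _).seq ((runs_pop _ _).seq h))).mono (by omega)

/-- Read a pair of Booleans from the main stack and write its symbol on the first auxiliary
stack. -/
def writeSymbol : Prog :=
  .seq pop (readBool (readBool (.push 1 (.bit true)) (.push 1 (.bit false)))
    (readBool (.push 1 .ket) (.push 1 .comma)))

theorem runs_writeSymbol (x : Bool × Bool) (m w : List Γ') :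
    Runs writeSymbol (store (word x ++ m) w [] [] []) (store m (toSymbol x :: w) [] [] []) 13 := by
  obtain ⟨a, b⟩ := x
  rw [word_prod, List.cons_append, List.append_assoc]
  refine (runs_pop _ _).seq (n := 11) (runs_readBool (n := 6) a ?_)
  cases a <;> refine runs_readBool (n := 1) b ?_ <;> cases b <;>
    exact .push (update_store_one ..)

/-- Turn the code of a list on the main stack into a word. -/
def writeOutput : Prog :=
  .seq (.loop 0 (onTrue writeSymbol .skip) fun o => o ≠ some (.bit true)) (transfer 1 0)

theorem runs_writeOutput (l : List (Bool × Bool)) :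
    Runs writeOutput (onMain (word l)) (onMain (l.map toSymbol)) (16 * l.length + 4) := by
  have hloop : ∀ (l : List (Bool × Bool)) (w : List Γ'),
      Runs (.loop 0 (onTrue writeSymbol .skip) fun o => o ≠ some (.bit true))
        (store (word l) w [] [] []) (store [] ((l.map toSymbol).reverse ++ w) [] [] [])
        (14 * l.length + 2) := by
    intro l
    induction l with
    | nil => intro w; exact .finish (some (.bit false)) rfl rfl (update_store_zero ..) (.skip _)
    | cons x l ih =>
      intro w
      rw [List.map_cons, List.reverse_cons, List.append_assoc]
      exact (Runs.next (some (.bit true)) rfl rfl (update_store_zero ..)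
        (runs_writeSymbol x _ _) (ih (toSymbol x :: w))).mono
        (by simp only [List.length_cons]; omega)
  have h := (hloop l []).seq (runs_transfer_one _ _ _ _ _)
  simp only [List.append_nil, List.reverse_reverse] at h
  exact h.mono (by simp; omega)

/-- A polynomial time function on lists of symbols yields a polynomial time Turing machine. -/
theorem PT.nonempty_tm2ComputableInPolyTime {α β : Type} {ea : α → List Γ'} {eb : β → List Γ'}
    {f : α → β} {F : List (Bool × Bool) → List (Bool × Bool)} (hF : PT F)
    (h : ∀ a, (F ((ea a).map ofSymbol)).map toSymbol = eb (f a)) :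
    Nonempty (TM2ComputableInPolyTime ea eb f) := by
  obtain ⟨r, hr⟩ := hF.exists_size_le
  obtain ⟨c, p, hF⟩ := hF
  refine Cmd.nonempty_tm2ComputableInPolyTime (0 : Fin 5) (.seq readInput (.seq c writeOutput))
    (13 * Polynomial.X + 5 + p.comp (8 * Polynomial.X + 1) +
      (16 * r.comp (8 * Polynomial.X + 1) + 4)) fun a => ?_
  have hstore : ∀ w : List Γ', Function.update (fun _ : Fin 5 => []) 0 w = onMain w := by
    intro w
    ext i
    fin_cases i <;> rfl
  rw [hstore, hstore, ← h]
  have hsize : ∀ w : List Γ', size (w.map ofSymbol) ≤ 8 * w.length + 1 := by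
    intro w
    induction w with
    | nil => simp
    | cons x w ih =>
      have : size (ofSymbol x) ≤ 7 := by rcases x with _ | (_ | _) | _ | _ | _ <;> decide
      simp
      omega
  have h₁ := hF ((ea a).map ofSymbol) []
  simp only [List.append_nil] at h₁
  refine ((runs_readInput (ea a)).seq (h₁.seq (runs_writeOutput _))).mono ?_
  have h₂ := eval_mono p (hsize (ea a))
  have h₃ := eval_mono r (hsize (ea a))
  have h₄ := hr ((ea a).map ofSymbol)
  have h₅ := length_le_size (F ((ea a).map ofSymbol))
  simp only [Polynomial.eval_add, Polynomial.eval_comp, Polynomial.eval_mul, Polynomial.eval_X,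
    Polynomial.eval_ofNat, Polynomial.eval_one] at *
  omega

end StackProgram

namespace StackProgram

open Turing Computability

/-! ### Fields and binary numbers -/

section

variable {α β γ σ : Type} [Enc α] [Enc β] [Enc γ] [Enc σ]

@[fun_prop]
theorem PT.min {m n : γ → ℕ} (hm : PT m) (hn : PT n) : PT fun x => Min.min (m x) (n x) := by
  have h : PT fun x => m x - (m x - n x) := hm.sub (hm.sub hn)
  convert h using 2 with x
  omega

/-- The words of bits in a word, each of which is closed by a separator. -/
def fields (w : List (Bool × Bool)) : List (List Bool) :=
  -- The word is read from right to left: a bit joins the newest field, a separator opens a new one.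
  -- Comma and bracket count alike, so each vertex contributes two fields.
  w.reverse.foldl (fun s x => bif x.1 then (x.2 :: s.headD []) :: s.tail else [] :: s) []

@[fun_prop]
theorem PT.fields {w : γ → List (Bool × Bool)} (hw : PT w) : PT fun x => fields (w x) := by
  refine .foldl_of_step (step := fun _ (s : List (List Bool)) (x : Bool × Bool) =>
    bif x.1 then (x.2 :: s.headD []) :: s.tail else [] :: s) hw.reverse (.const _) (by fun_prop)
    ⟨6, fun x s a _ => ?_⟩
  obtain ⟨_ | _, b⟩ := a
  · simp
    omega
  · have := size_bool b
    cases s <;> simp <;> omega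

/-- The number with a given binary representation, truncated at `cap`. -/
def bitsVal (cap : ℕ) (l : List Bool) : ℕ :=
  l.reverse.foldl (fun v b => min (2 * v + bif b then 1 else 0) cap) 0

@[fun_prop]
theorem PT.bitsVal {cap : γ → ℕ} {l : γ → List Bool} (hc : PT cap) (hl : PT l) :
    PT fun x => bitsVal (cap x) (l x) := by
  obtain ⟨p, hp⟩ := hc.exists_size_le
  refine .foldl_of_step (step := fun x v (b : Bool) => Min.min (2 * v + bif b then 1 else 0) (cap x))
    hl.reverse (.const _) (by fun_prop) ⟨p, fun x s a _ => ?_⟩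
  have := hp x
  simp only [size_nat] at *
  omega

/-- Binary increment, least significant bit first. -/
def incr : List Bool → List Bool
  | [] => [true]
  | false :: l => true :: l
  | true :: l => false :: incr l

@[fun_prop]
theorem PT.incr {l : γ → List Bool} (hl : PT l) : PT fun x => incr (l x) := by
  let step (s : Bool × List Bool) (a : Bool) : Bool × List Bool :=
    (s.1 && a, (bif s.1 then !a else a) :: s.2)
  have h : PT fun x => (l x).foldl step (true, []) := by
    refine .foldl_of_step hl (.const _) (by fun_prop) ⟨6, fun x s a _ => ?_⟩
    obtain ⟨b, r⟩ := s
    have := size_bool (b && a)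
    have := size_pos b
    have := size_bool (bif b then !a else a)
    simp [step]
    omega
  have key : ∀ (l r : List Bool) (b : Bool),
      (let s := l.foldl step (b, r); s.2.reverse ++ bif s.1 then [true] else []) =
        r.reverse ++ bif b then StackProgram.incr l else l := by
    intro l
    induction l with
    | nil => intro r b; cases b <;> simp [StackProgram.incr]
    | cons a l ih =>
      intro r b
      refine (ih _ _).trans ?_
      cases a <;> cases b <;> simp [StackProgram.incr]
  have h' : PT fun x => (let s := (l x).foldl step (true, []);
      s.2.reverse ++ bif s.1 then [true] else []) :=
    (PT.snd.comp h).reverse.append ((PT.fst.comp h).cond (.const _) (.const _))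
  convert h' using 2 with x
  rw [key]
  rfl

theorem encodePosNum_succ (n : PosNum) : encodePosNum n.succ = incr (encodePosNum n) := by
  induction n with
  | one => rfl
  | bit0 n => rfl
  | bit1 n ih => exact congrArg (false :: ·) ih

theorem encodeNat_succ (n : ℕ) : encodeNat (n + 1) = incr (encodeNat n) := by
  unfold encodeNat
  rw [Nat.cast_add_one, Num.add_one]
  cases (n : Num) with
  | zero => rfl
  | pos p => exact encodePosNum_succ p

/-- Truncating in every round is the same as truncating once at the end, because min(2 min(v, c) +
b, c) = min(2v + b, c). Without intermediate truncation the unary value could be exponential. -/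
theorem bitsVal_encodeNat (cap n : ℕ) : bitsVal cap (encodeNat n) = min n cap := by
  let val (l : List Bool) : ℕ := l.foldr (fun b v => 2 * v + bif b then 1 else 0) 0
  have hincr : ∀ l, val (incr l) = val l + 1 := by
    intro l
    induction l with
    | nil => rfl
    | cons b l ih =>
      cases b
      · rfl
      · change 2 * val (incr l) + 0 = 2 * val l + 1 + 1
        omega
  have hval : val (encodeNat n) = n := by
    induction n with
    | zero => rfl
    | succ n ih => rw [encodeNat_succ, hincr, ih]
  have hmin : ∀ l, bitsVal cap l = min (val l) cap := by
    intro l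
    unfold bitsVal
    rw [List.foldl_reverse]
    induction l with
    | nil => exact (Nat.zero_min cap).symm
    | cons b l ih =>
      rw [List.foldr_cons, ih]
      change min (2 * min (val l) cap + bif b then 1 else 0) cap =
        min (2 * val l + bif b then 1 else 0) cap
      omega
  rw [hmin, hval]

theorem length_incr_le (l : List Bool) : (incr l).length ≤ l.length + 1 := by
  induction l with
  | nil => simp [incr]
  | cons b l ih => cases b <;> simp [incr]; omega

theorem length_encodeNat_le (n : ℕ) : (encodeNat n).length ≤ n := by
  induction n with
  | zero => exact le_rfl
  | succ n ih => rw [encodeNat_succ]; exact (length_incr_le _).trans (by omega)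

-- Unary to binary by repeated increment; the intermediate words stay short since each increment
-- adds at most one bit.
@[fun_prop]
theorem PT.encodeNat {n : γ → ℕ} (hn : PT n) : PT fun x => encodeNat (n x) := by
  have key : ∀ m : ℕ, (List.replicate m ()).foldl (fun s _ => StackProgram.incr s) [] =
      Computability.encodeNat m := by
    intro m
    induction m with
    | zero => rfl
    | succ m ih =>
      rw [List.replicate_succ', List.foldl_append, ih, encodeNat_succ]
      rfl
  have hsize : ∀ l : List Bool, size l ≤ 4 * l.length + 1 := by
    intro l
    induction l with
    | nil => simp
    | cons b l ih => have := size_bool b; simp; omega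
  have h : PT fun x => (List.replicate (n x) ()).foldl (fun s _ => StackProgram.incr s) [] := by
    obtain ⟨p, hp⟩ := hn.exists_size_le
    refine .foldl_of_size_le (step := fun _ s _ => StackProgram.incr s) hn.replicate (.const _)
      (by fun_prop) ⟨4 * p + 1, fun x l' hl' => ?_⟩
    rw [List.eq_replicate_of_mem (a := ()) (l := l') (fun _ _ => rfl), key]
    refine (hsize _).trans ?_
    have h₁ := hp x
    have h₂ := hl'.length_le
    have h₃ := length_encodeNat_le l'.length
    simp only [size_nat, List.length_replicate, Polynomial.eval_add, Polynomial.eval_mul,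
      Polynomial.eval_ofNat, Polynomial.eval_one] at *
    omega
  convert h using 2 with x
  rw [key]

end

end StackProgram

namespace HappyVertices

open Turing Computability StackProgram

/-! ### The kernelization algorithm

The algorithm works on the fields of the string of an instance: `k`, `ℓ`, and the row and the color
of every vertex. -/

section algorithm

variable (F : List (List Bool))

/-- The number of vertices. -/
def vertexCount : ℕ := (F.getD 2 []).length

/-- Adjacency of two vertices. -/
def adj (u v : ℕ) : Bool := (F.getD (2 + 2 * u) []).getD v false

/-- The color of a vertex in binary, empty if it is not precolored. -/
def color (v : ℕ) : List Bool := F.getD (3 + 2 * v) []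

/-- The vertices of a greedily chosen maximal matching of the complement graph. -/
def modulator : List ℕ :=
  (List.range (vertexCount F)).foldl (fun S u => (List.range (vertexCount F)).foldl
    (fun S v => bif !u.beq v && !adj F u v && !memNat u S && !memNat v S then u :: v :: S else S) S) []

/-- The vertices outside the modulator. -/
def clique : List ℕ := (List.range (vertexCount F)).filter fun v => !memNat v (modulator F)

/-- The precolors in the closed neighbourhood of a vertex. -/
def palette (v : ℕ) : List (List Bool) :=
  ((List.range (vertexCount F)).filter fun u =>
    (u.beq v || adj F v u) && !(color F u).isEmpty).map (color F)

/-- A vertex is dead if there are two precolors in its closed neighbourhood. -/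
def isDead (v : ℕ) : Bool := (palette F v).any fun a => (palette F v).any fun b => !eqBits a b

/-- The precolor in the closed neighbourhood of a vertex that is not dead. -/
def signature (v : ℕ) : List Bool := (palette F v).headD []

/-- The vertices of the clique that are not dead. -/
def alive : List ℕ := (clique F).filter fun v => !isDead F v

/-- The vertices of the clique that can be happy when it has the signature of `v` as its color. -/
def aliveWith (v : ℕ) : List ℕ :=
  (alive F).filter fun u => (signature F u).isEmpty || eqBits (signature F u) (signature F v)

/-- The required number of happy vertices, truncated at `n + 1`. -/
def target : ℕ := bitsVal (vertexCount F + 1) (F.getD 0 []).tail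

/-- Instances that are recognized as yes-instances. -/
def isTrivialYes : Bool :=
  (F.getD 0 []).headD false || (target F).beq 0 ||
    (alive F).any fun v => (target F).ble (aliveWith F v).length

/-- Instances that are recognized as no-instances. -/
def isTrivialNo : Bool := (modulator F).isEmpty || (vertexCount F + 1).ble (target F)

/-- The first vertex of a list, and the first one of a different color. -/
def spread (l : List ℕ) : List ℕ :=
  l.take 1 ++ (l.take 1).flatMap fun x => (l.filter fun y => !eqBits (color F x) (color F y)).take 1

/-- Common neighbours of the pairs of vertices of the modulator. -/
def commonMarks : List ℕ :=
  (modulator F).flatMap fun u => (modulator F).flatMap fun w =>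
    ((clique F).filter fun v => adj F u v && adj F w v).take 1

/-- Precolored vertices of the clique. -/
def colorMarks : List ℕ :=
  spread F ((clique F).filter fun v => !(color F v).isEmpty) ++
    (modulator F).flatMap fun u =>
      spread F ((clique F).filter fun v => !(color F v).isEmpty && adj F u v)

/-- The first neighbours of `u` among the vertices that are not dead and have the signature `a`. -/
def neighbourMarks (u : ℕ) (a : List Bool) : List ℕ :=
  ((alive F).filter fun x => adj F u x && eqBits (signature F x) a).take
    (modulator F).length

/-- The marked vertices, which are kept. -/
def isMarked (v : ℕ) : Bool :=
  memNat v (commonMarks F) || memNat v (colorMarks F) ||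
    (modulator F).any fun u => memNat v (neighbourMarks F u (signature F v))

/-- A bound for the number of happy vertices that the kernel has to require. -/
def threshold : ℕ :=
  -- A colour has at most 3s² + 2(s + 1) marked candidates; the constant is the smallest one that
  -- exceeds this number plus s.
  3 * ((modulator F).length * (modulator F).length + (modulator F).length + 1)

/-- The deletion order: first the vertices with empty signature. -/
def deletionKey (v : ℕ) : ℕ := bif (signature F v).isEmpty then v else vertexCount F + v

/-- The number of vertices that are deleted before `v` can be deleted. -/
def deletionRank (v : ℕ) : ℕ :=
  ((aliveWith F v).filter fun u =>
    !isMarked F u && (deletionKey F u + 1).ble (deletionKey F v)).length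

/-- The vertices that are deleted. -/
def isDeleted (v : ℕ) : Bool :=
  !memNat v (modulator F) && !isMarked F v &&
    -- The truncated difference is the number D of candidates to delete for each colour; it vanishes
    -- if the target is already small.
    (isDead F v || (deletionRank F v + 1).ble (target F - threshold F))

/-- The vertices of the kernel. -/
def kept : List ℕ := (List.range (vertexCount F)).filter fun v => !isDeleted F v

/-- The colors that occur in the kernel. -/
def keptColors : List (List Bool) :=
  ((kept F).map (color F)).foldl
    (fun s a => bif a.isEmpty || s.any (eqBits a) then s else a :: s) []

/-- The position of a color in a list of colors. -/
def colorIndex (l : List (List Bool)) (a : List Bool) : ℕ :=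
  l.reverse.foldl (fun r b => bif eqBits b a then 0 else r + 1) 0

/-- The number of colors of the kernel. -/
def keptColorCount : ℕ := bitsVal (kept F).length (F.getD 1 [])

/-- A number in binary, as symbols. -/
def bitSymbols (n : ℕ) : List (Bool × Bool) := (encodeNat n).map fun b => (true, b)

/-- The color of a vertex of the kernel, as symbols. -/
def colorSymbols (v : ℕ) : List (Bool × Bool) :=
  bif (color F v).isEmpty then [] else bitSymbols (colorIndex (keptColors F) (color F v) + 1)

/-- The record of a vertex of the kernel, as symbols. -/
def recordSymbols (v : ℕ) : List (Bool × Bool) :=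
  (kept F).map (fun u => (true, adj F v u)) ++
    (false, false) :: (colorSymbols F v ++ [(false, true)])

/-- The string of the kernel, as symbols. -/
def kernelSymbols : List (Bool × Bool) :=
  -- The two constant outputs encode the graph without vertices with one color and target 0 or 1,
  -- respectively.
  bif isTrivialYes F then [(true, false), (false, false), (true, true), (false, false)]
  else bif isTrivialNo F then
    [(true, false), (true, true), (false, false), (true, true), (false, false)]
  else (true, false) :: (bitSymbols (target F - (target F - threshold F)) ++ (false, false) ::
    (bitSymbols (keptColorCount F) ++ (false, false) :: (kept F).flatMap (recordSymbols F)))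

end algorithm

/-! ### The kernelization runs in polynomial time. -/

section polytime

variable {γ : Type} [Enc γ] {F : γ → List (List Bool)} {u v : γ → ℕ}

@[fun_prop]
theorem pt_vertexCount (hF : PT F) : PT fun x => vertexCount (F x) := by
  unfold vertexCount; fun_prop

@[fun_prop]
theorem pt_adj (hF : PT F) (hu : PT u) (hv : PT v) : PT fun x => adj (F x) (u x) (v x) := by
  unfold adj; fun_prop

@[fun_prop]
theorem pt_color (hF : PT F) (hv : PT v) : PT fun x => color (F x) (v x) := by
  unfold color; fun_prop

theorem size_modulator_step (F : List (List Bool)) (u v : ℕ) (S : List ℕ) :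
    size (bif !u.beq v && !adj F u v && !memNat u S && !memNat v S then u :: v :: S else S) ≤
      size S + (size u + size v + 2) := by
  cases !u.beq v && !adj F u v && !memNat u S && !memNat v S <;> simp
  omega

@[fun_prop]
theorem pt_modulator (hF : PT F) : PT fun x => modulator (F x) := by
  obtain ⟨p, hp⟩ := (pt_vertexCount hF).exists_size_le
  have hn : ∀ x : γ, vertexCount (F x) ≤ p.eval (size x) := fun x => by
    have := hp x
    simp at this
    omega
  refine .foldl_of_step (by fun_prop) (.const _) ?_ ⟨p * (4 * p + 4), fun x S u hu => ?_⟩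
  · have hl : PT fun y : γ × List ℕ × ℕ => List.range (vertexCount (F y.1)) := by fun_prop
    obtain ⟨r, hr⟩ := PT.exists_size_le hl
    refine .foldl_of_step hl (by fun_prop) (by fun_prop) ⟨2 * Polynomial.X + r + 2, fun y S v hv => ?_⟩
    have h₁ := size_modulator_step (F y.1) y.2.2 v S
    have h₂ := size_le_of_mem hv
    have h₃ := hr y
    obtain ⟨x, T, u⟩ := y
    simp only [size_prod, Polynomial.eval_add, Polynomial.eval_mul, Polynomial.eval_X,
      Polynomial.eval_ofNat] at *
    omega
  -- For the outer loop the growth per round must be bounded in terms of the input alone, not of the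
  -- current list. An inner round adds two numbers below the vertex count.
  · have hstep : ∀ (l : List ℕ) (S : List ℕ), (∀ v ∈ l, v ≤ p.eval (size x)) →
        size (l.foldl (fun S v => bif !u.beq v && !adj (F x) u v && !memNat u S && !memNat v S then
          u :: v :: S else S) S) ≤ size S + l.length * (4 * p.eval (size x) + 4) := by
      intro l
      induction l with
      | nil => simp
      | cons v l ih =>
        intro S hl
        have h₁ := size_modulator_step (F x) u v S
        have h₂ := hl v (by simp)
        have h₃ := (List.mem_range.1 hu).le.trans (hn x)
        rw [List.foldl_cons, List.length_cons, Nat.succ_mul]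
        refine (ih _ fun w hw => hl w (by simp [hw])).trans ?_
        simp only [size_nat] at *
        omega
    refine (hstep _ S fun v hv => (List.mem_range.1 hv).le.trans (hn x)).trans ?_
    simp only [List.length_range, Polynomial.eval_add, Polynomial.eval_mul, Polynomial.eval_ofNat]
    have := hn x
    gcongr

@[fun_prop]
theorem pt_clique (hF : PT F) : PT fun x => clique (F x) := by
  unfold clique; fun_prop

@[fun_prop]
theorem pt_palette (hF : PT F) (hv : PT v) : PT fun x => palette (F x) (v x) := by
  unfold palette; fun_prop

@[fun_prop]
theorem pt_isDead (hF : PT F) (hv : PT v) : PT fun x => isDead (F x) (v x) := by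
  unfold isDead; fun_prop

@[fun_prop]
theorem pt_signature (hF : PT F) (hv : PT v) : PT fun x => signature (F x) (v x) := by
  unfold signature; fun_prop

@[fun_prop]
theorem pt_alive (hF : PT F) : PT fun x => alive (F x) := by
  unfold alive; fun_prop

@[fun_prop]
theorem pt_aliveWith (hF : PT F) (hv : PT v) : PT fun x => aliveWith (F x) (v x) := by
  unfold aliveWith; fun_prop

@[fun_prop]
theorem pt_target (hF : PT F) : PT fun x => target (F x) := by
  unfold target; fun_prop

@[fun_prop]
theorem pt_isTrivialYes (hF : PT F) : PT fun x => isTrivialYes (F x) := by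
  unfold isTrivialYes; fun_prop

@[fun_prop]
theorem pt_isTrivialNo (hF : PT F) : PT fun x => isTrivialNo (F x) := by
  unfold isTrivialNo; fun_prop

@[fun_prop]
theorem pt_spread {l : γ → List ℕ} (hF : PT F) (hl : PT l) : PT fun x => spread (F x) (l x) := by
  unfold spread; fun_prop

@[fun_prop]
theorem pt_commonMarks (hF : PT F) : PT fun x => commonMarks (F x) := by
  unfold commonMarks; fun_prop

@[fun_prop]
theorem pt_colorMarks (hF : PT F) : PT fun x => colorMarks (F x) := by
  unfold colorMarks; fun_prop

@[fun_prop]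
theorem pt_neighbourMarks {a : γ → List Bool} (hF : PT F) (hu : PT u) (ha : PT a) :
    PT fun x => neighbourMarks (F x) (u x) (a x) := by
  unfold neighbourMarks; fun_prop

@[fun_prop]
theorem pt_isMarked (hF : PT F) (hv : PT v) : PT fun x => isMarked (F x) (v x) := by
  unfold isMarked; fun_prop

@[fun_prop]
theorem pt_threshold (hF : PT F) : PT fun x => threshold (F x) := by
  unfold threshold; fun_prop

@[fun_prop]
theorem pt_deletionKey (hF : PT F) (hv : PT v) : PT fun x => deletionKey (F x) (v x) := by
  unfold deletionKey; fun_prop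

@[fun_prop]
theorem pt_deletionRank (hF : PT F) (hv : PT v) : PT fun x => deletionRank (F x) (v x) := by
  unfold deletionRank; fun_prop

@[fun_prop]
theorem pt_isDeleted (hF : PT F) (hv : PT v) : PT fun x => isDeleted (F x) (v x) := by
  unfold isDeleted; fun_prop

@[fun_prop]
theorem pt_kept (hF : PT F) : PT fun x => kept (F x) := by
  unfold kept; fun_prop

@[fun_prop]
theorem pt_keptColors (hF : PT F) : PT fun x => keptColors (F x) := by
  have hl : PT fun x => (kept (F x)).map (color (F x)) := by fun_prop
  obtain ⟨p, hp⟩ := hl.exists_size_le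
  refine .foldl_of_step hl (.const _) (by fun_prop) ⟨p + 1, fun x s a ha => ?_⟩
  have := hp x
  have := size_le_of_mem ha
  cases a.isEmpty || s.any (eqBits a) <;> simp
  omega

@[fun_prop]
theorem pt_colorIndex {l : γ → List (List Bool)} {a : γ → List Bool} (hl : PT l) (ha : PT a) :
    PT fun x => colorIndex (l x) (a x) := by
  refine .foldl_of_step hl.reverse (.const _) (by fun_prop) ⟨2, fun x s b _ => ?_⟩
  cases eqBits b (a x) <;> simp
  omega

@[fun_prop]
theorem pt_keptColorCount (hF : PT F) : PT fun x => keptColorCount (F x) := by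
  unfold keptColorCount; fun_prop

@[fun_prop]
theorem pt_bitSymbols (hv : PT v) : PT fun x => bitSymbols (v x) := by
  unfold bitSymbols; fun_prop

@[fun_prop]
theorem pt_colorSymbols (hF : PT F) (hv : PT v) : PT fun x => colorSymbols (F x) (v x) := by
  unfold colorSymbols; fun_prop

@[fun_prop]
theorem pt_recordSymbols (hF : PT F) (hv : PT v) : PT fun x => recordSymbols (F x) (v x) := by
  unfold recordSymbols; fun_prop

theorem pt_kernelSymbols (hF : PT F) : PT fun x => kernelSymbols (F x) := by
  unfold kernelSymbols; fun_prop

end polytime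

end HappyVertices

namespace HappyVertices

/-! ### Correctness of the kernelization -/

section abstract

variable {C : Type*} (r : ℕ → ℕ → Prop) (p : ℕ → Option C)

/-- The vertex `v` is happy in the graph induced on `X`. -/
def HappyOn (X : Finset ℕ) (c : ℕ → C) (v : ℕ) : Prop := ∀ u ∈ X, r v u → c u = c v

open Classical in
/-- The happy vertices of the graph induced on `X`. -/
noncomputable def happySet (X : Finset ℕ) (c : ℕ → C) : Finset ℕ := {v ∈ X | HappyOn r X c v}

/-- Some coloring that extends `p` makes `k` vertices of the graph induced on `X` happy. -/
def YesOn (X : Finset ℕ) (k : ℕ) : Prop :=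
  ∃ c : ℕ → C, (∀ v ∈ X, ∀ a, p v = some a → c v = a) ∧ k ≤ (happySet r X c).card

open Classical in
/-- The vertices of `X` outside `S` all of whose closed neighbours can have the color `i`. -/
noncomputable def candidates (X S : Finset ℕ) (i : C) : Finset ℕ :=
  {v ∈ X \ S | ∀ u ∈ X, u = v ∨ r v u → ∀ a, p u = some a → a = i}

variable {r p}

theorem mem_happySet {X : Finset ℕ} {c : ℕ → C} {v : ℕ} :
    v ∈ happySet r X c ↔ v ∈ X ∧ ∀ u ∈ X, r v u → c u = c v := by
  classical
  unfold happySet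
  rw [Finset.mem_filter]
  rfl

theorem mem_candidates {X S : Finset ℕ} {i : C} {v : ℕ} :
    v ∈ candidates r p X S i ↔
      (v ∈ X ∧ v ∉ S) ∧ ∀ u ∈ X, u = v ∨ r v u → ∀ a, p u = some a → a = i := by
  simp [candidates]

/-- If there are many candidates for a color, this color can be given to all vertices. -/
theorem yesOn_of_le_card_candidates {X S : Finset ℕ} {k : ℕ} {i : C}
    (h : k ≤ (candidates r p X S i).card) : YesOn r p X k := by
  refine ⟨fun v => (p v).getD i, fun v _ a ha => by simp [ha], h.trans (Finset.card_le_card ?_)⟩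
  intro v hv
  obtain ⟨⟨hX, -⟩, hv⟩ := mem_candidates.1 hv
  have key : ∀ u ∈ X, u = v ∨ r v u → (p u).getD i = i := by
    intro u hu huv
    cases hpu : p u with
    | none => rfl
    | some a => exact hv u hu huv a hpu
  exact mem_happySet.2 ⟨hX, fun u hu huv => by rw [key u hu (.inr huv), key v hX (.inl rfl)]⟩

/-- Deleting vertices `X \ W` of a clique preserves the answer, if the target is decreased by the
number of deleted vertices that are candidates for a relevant color. -/
theorem yesOn_iff_of_kept {X S W : Finset ℕ} {k D : ℕ} (hsymm : ∀ u v, r u v → r v u)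
    (hSW : S ⊆ W) (hWX : W ⊆ X)
    (hclique : ∀ u ∈ X, u ∉ S → ∀ v ∈ X, v ∉ S → u ≠ v → r u v)
    (hcommon : ∀ u ∈ S, ∀ w ∈ S, ∀ v ∈ X, v ∉ S → r u v → r w v →
      ∃ x ∈ W, x ∉ S ∧ r u x ∧ r w x)
    (hcolor : ∀ u ∈ S, ∀ e, (∀ x ∈ W, x ∉ S → r u x → ∀ b, p x = some b → b = e) →
      ∀ x ∈ X, x ∉ S → r u x → ∀ b, p x = some b → b = e)
    (hcolor' : ∀ e, (∀ x ∈ W, x ∉ S → ∀ b, p x = some b → b = e) →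
      ∀ x ∈ X, x ∉ S → ∀ b, p x = some b → b = e)
    (hneighbour : ∀ i, ∀ v ∈ candidates r p X S i, v ∉ W → ∀ u ∈ S, r u v →
      ∃ M ⊆ candidates r p X S i ∩ W, S.card ≤ M.card ∧ ∀ x ∈ M, r u x)
    (hdel : ∀ i, (candidates r p X S i \ W).card ≤ D ∧
      ((candidates r p X S i \ W).card = D ∨ (candidates r p X S i ∩ W).card + S.card < k))
    (hD : D = 0 ∨ S.card < k) (hlt : ∀ i, (candidates r p X S i ∩ W).card < k) :
    YesOn r p W k ↔ YesOn r p X (k + D) := by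
  classical
  constructor
  · rintro ⟨c, hc, hk⟩
    -- Either a clique vertex is happy, and the kept part of the clique is monochromatic, or all
    -- happy vertices lie in `S`.
    by_cases hex : ∃ x ∈ happySet r W c, x ∉ S
    · obtain ⟨x₀, hx₀, hx₀S⟩ := hex
      obtain ⟨hx₀W, hx₀⟩ := mem_happySet.1 hx₀
      set i := c x₀ with hi
      have hmono : ∀ x ∈ W, x ∉ S → c x = i := by
        intro x hx hxS
        by_cases h : x = x₀
        · rw [h]
        · exact hx₀ x hx (hclique _ (hWX hx₀W) hx₀S _ (hWX hx) hxS (Ne.symm h))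
      have hpK : ∀ x ∈ X, x ∉ S → ∀ b, p x = some b → b = i :=
        hcolor' i fun x hx hxS b hb => (hc x hx b hb).symm.trans (hmono x hx hxS)
      have hcand : ∀ v ∈ happySet r W c, v ∉ S → v ∈ candidates r p X S i ∩ W := by
        intro v hv hvS
        obtain ⟨hvW, hv⟩ := mem_happySet.1 hv
        refine Finset.mem_inter.2 ⟨mem_candidates.2 ⟨⟨hWX hvW, hvS⟩, fun u hu huv a ha => ?_⟩, hvW⟩
        by_cases huS : u ∈ S
        · rcases huv with rfl | huv
          · exact absurd huS hvS
          · rw [← hc u (hSW huS) a ha, hv u (hSW huS) huv, hmono v hvW hvS]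
        · exact hpK u hu huS a ha
      have hsplit : ∀ A ⊆ candidates r p X S i ∩ W, (∀ v ∈ happySet r W c, v ∉ S → v ∈ A) →
          (happySet r W c).card ≤ S.card + A.card := by
        intro A _ hA
        refine (Finset.card_le_card fun v hv => ?_).trans (Finset.card_union_le S A)
        by_cases hvS : v ∈ S
        · exact Finset.mem_union_left _ hvS
        · exact Finset.mem_union_right _ (hA v hv hvS)
      -- If `u` had another color, its |S| kept neighbours in `M` would all be unhappy. Even with
      -- all of `S` happy this leaves at most |candidates ∩ W| < k happy vertices.
      have hforced : ∀ v ∈ candidates r p X S i, v ∉ W → ∀ u ∈ S, r u v → c u = i := by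
        intro v hv hvW u hu huv
        by_contra hne
        obtain ⟨M, hM, hMc, hMr⟩ := hneighbour i v hv hvW u hu huv
        have h₁ := hsplit ((candidates r p X S i ∩ W) \ M) Finset.sdiff_subset fun x hx hxS => by
          refine Finset.mem_sdiff.2 ⟨hcand x hx hxS, fun hxM => hne ?_⟩
          obtain ⟨hxW, hx⟩ := mem_happySet.1 hx
          rw [hx u (hSW hu) (hsymm _ _ (hMr x hxM)), hmono x hxW hxS]
        rw [Finset.card_sdiff_of_subset hM] at h₁
        have h₂ := Finset.card_le_card hM
        have h₃ := hlt i
        omega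
      -- The alternative in `hdel` would leave fewer than `k` possible happy vertices in the kernel.
      have hDeq : (candidates r p X S i \ W).card = D := by
        refine (hdel i).2.resolve_right fun h => ?_
        have := hsplit _ Finset.Subset.rfl hcand
        omega
      let c' : ℕ → C := fun v => if v ∈ S then c v else i
      have hc'S : ∀ v ∈ S, c' v = c v := fun v hv => if_pos hv
      have hc'K : ∀ v, v ∉ S → c' v = i := fun v hv => if_neg hv
      have hc'W : ∀ v ∈ W, c' v = c v := fun v hv => by
        by_cases hvS : v ∈ S
        · exact hc'S v hvS
        · rw [hc'K v hvS, hmono v hv hvS]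
      refine ⟨c', fun v hv a ha => ?_, ?_⟩
      · by_cases hvS : v ∈ S
        · rw [hc'S v hvS]; exact hc v (hSW hvS) a ha
        · rw [hc'K v hvS]; exact (hpK v hv hvS a ha).symm
      · have hdisj : Disjoint (happySet r W c) (candidates r p X S i \ W) :=
          Finset.disjoint_left.2 fun v hv hv' =>
            (Finset.mem_sdiff.1 hv').2 (mem_happySet.1 hv).1
        refine (Nat.add_le_add hk hDeq.ge).trans ?_
        rw [← Finset.card_union_of_disjoint hdisj]
        refine Finset.card_le_card fun v hv => ?_
        rcases Finset.mem_union.1 hv with hv | hv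
        · obtain ⟨hvW, hv⟩ := mem_happySet.1 hv
          refine mem_happySet.2 ⟨hWX hvW, fun u hu huv => ?_⟩
          rw [hc'W v hvW]
          by_cases huS : u ∈ S
          · rw [hc'S u huS]; exact hv u (hSW huS) huv
          · rw [hc'K u huS]
            by_cases hvS : v ∈ S
            -- The happy vertex `v` of `S` has a deleted neighbour. By `hcommon` for the pair (v, v)
            -- it also has a kept clique neighbour, so its color is `i`.
            · obtain ⟨x, hxW, hxS, hvx, -⟩ := hcommon v hvS v hvS u hu huS huv huv
              rw [← hv x hxW hvx, hmono x hxW hxS]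
            · rw [hmono v hvW hvS]
        · obtain ⟨hv, hvW⟩ := Finset.mem_sdiff.1 hv
          obtain ⟨⟨hvX, hvS⟩, -⟩ := mem_candidates.1 hv
          refine mem_happySet.2 ⟨hvX, fun u hu huv => ?_⟩
          rw [hc'K v hvS]
          by_cases huS : u ∈ S
          · rw [hc'S u huS]; exact hforced v hv hvW u huS (hsymm _ _ huv)
          · exact hc'K u huS
    · push Not at hex
      have hkS : k ≤ S.card := hk.trans (Finset.card_le_card hex)
      -- With at most |S| happy vertices the target was not lowered, so the deleted vertices only
      -- have to spoil nothing.
      obtain rfl : D = 0 := hD.resolve_right (by omega)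
      -- A deleted vertex takes its precolor, or else the color of some happy neighbour in `S`; the
      -- default `c 0` is used only where no happy vertex is concerned.
      let c' : ℕ → C := fun v => if v ∈ W then c v else (p v).getD
        (if h : ∃ u ∈ happySet r W c, r u v then c h.choose else c 0)
      have hc'W : ∀ v ∈ W, c' v = c v := fun v hv => if_pos hv
      refine ⟨c', fun v hv a ha => ?_, hk.trans (Finset.card_le_card fun u hu => ?_)⟩
      · by_cases hvW : v ∈ W
        · rw [hc'W v hvW]; exact hc v hvW a ha
        · simp [c', hvW, ha]
      · have huS := hex u hu
        obtain ⟨huW, huh⟩ := mem_happySet.1 hu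
        refine mem_happySet.2 ⟨hWX huW, fun v hv huv => ?_⟩
        rw [hc'W u huW]
        by_cases hvW : v ∈ W
        · rw [hc'W v hvW]; exact huh v hvW huv
        have hvS : v ∉ S := fun h => hvW (hSW h)
        cases hpv : p v with
        | some a =>
          have : c' v = a := by simp [c', hvW, hpv]
          rw [this]
          exact hcolor u huS (c u) (fun x hx _ hux b hb => by rw [← hc x hx b hb, huh x hx hux])
            v hv hvS huv a hpv
        | none =>
          have h : ∃ u ∈ happySet r W c, r u v := ⟨u, hu, huv⟩
          have : c' v = c h.choose := by simp only [c', hvW, hpv, if_false, Option.getD_none, dif_pos h]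
          rw [this]
          obtain ⟨hwH, hwv⟩ := h.choose_spec
          generalize h.choose = w at hwH hwv ⊢
          -- The choice of the happy neighbour does not matter: two happy vertices with a common
          -- kept neighbour share its color.
          obtain ⟨x, hxW, -, hux, hwx⟩ := hcommon u huS w (hex w hwH) v hv hvS huv hwv
          rw [← huh x hxW hux, (mem_happySet.1 hwH).2 x hxW hwx]
  · rintro ⟨c, hc, hk⟩
    refine ⟨c, fun v hv => hc v (hWX hv), ?_⟩
    have hsub : happySet r X c ∩ W ⊆ happySet r W c := by
      intro v hv
      obtain ⟨hv, hvW⟩ := Finset.mem_inter.1 hv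
      exact mem_happySet.2 ⟨hvW, fun u hu => (mem_happySet.1 hv).2 u (hWX hu)⟩
    have hcard := Finset.card_inter_add_card_sdiff (happySet r X c) W
    -- Restriction keeps happy vertices happy, so only the deleted ones are lost. If one of these is
    -- happy, the clique has its color and all of them are candidates for this color.
    suffices h : (happySet r X c \ W).card ≤ D by
      have := Finset.card_le_card hsub
      omega
    rcases (happySet r X c \ W).eq_empty_or_nonempty with h | ⟨x₀, hx₀⟩
    · simp [h]
    · obtain ⟨hx₀, hx₀W⟩ := Finset.mem_sdiff.1 hx₀
      obtain ⟨hx₀X, hx₀⟩ := mem_happySet.1 hx₀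
      have hx₀S : x₀ ∉ S := fun h => hx₀W (hSW h)
      have hmono : ∀ x ∈ X, x ∉ S → c x = c x₀ := by
        intro x hx hxS
        by_cases h : x = x₀
        · rw [h]
        · exact hx₀ x hx (hclique _ hx₀X hx₀S _ hx hxS (Ne.symm h))
      refine (Finset.card_le_card fun v hv => ?_).trans (hdel (c x₀)).1
      obtain ⟨hv, hvW⟩ := Finset.mem_sdiff.1 hv
      obtain ⟨hvX, hv⟩ := mem_happySet.1 hv
      have hvS : v ∉ S := fun h => hvW (hSW h)
      refine Finset.mem_sdiff.2 ⟨mem_candidates.2 ⟨⟨hvX, hvS⟩, fun u hu huv a ha => ?_⟩, hvW⟩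
      rw [← hmono v hvX hvS, ← hc u hu a ha]
      rcases huv with rfl | huv
      · rfl
      · exact hv u hu huv

/-- The elements of low rank in a finite set of numbers that is ordered by a key. -/
theorem card_filter_rank_lt (U : Finset ℕ) (key : ℕ → ℕ) (hkey : Set.InjOn key U) (D : ℕ) :
    {v ∈ U | {u ∈ U | key u < key v}.card < D}.card = min D U.card := by
  set rank : ℕ → ℕ := fun v => {u ∈ U | key u < key v}.card with hrank
  have hlt : ∀ v ∈ U, rank v < U.card := fun v hv =>
    Finset.card_lt_card (Finset.filter_ssubset.2 ⟨v, hv, lt_irrefl _⟩)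
  have hmono : ∀ u ∈ U, ∀ v, key u < key v → rank u < rank v := fun u hu v huv =>
    Finset.card_lt_card ⟨fun w hw => by simp at hw ⊢; exact ⟨hw.1, hw.2.trans huv⟩, fun h => by
      have := h (Finset.mem_filter.2 ⟨hu, huv⟩)
      simp at this⟩
  have hinj : Set.InjOn rank U := by
    intro u hu v hv huv
    rcases lt_trichotomy (key u) (key v) with h | h | h
    · exact absurd huv (hmono u hu v h).ne
    · exact hkey hu hv h
    · exact absurd huv (hmono v hv u h).ne'
  -- The ranks are distinct and below |U|, so each number below |U| occurs exactly once.
  have himage : U.image rank = Finset.range U.card :=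
    Finset.eq_of_subset_of_card_le (by
      intro m hm
      obtain ⟨v, hv, rfl⟩ := Finset.mem_image.1 hm
      exact Finset.mem_range.2 (hlt v hv)) (by
      rw [Finset.card_image_of_injOn hinj, Finset.card_range])
  have h : {v ∈ U | rank v < D}.image rank = {m ∈ Finset.range U.card | m < D} := by
    rw [← himage, Finset.filter_image]
  have hcard := congrArg Finset.card h
  rw [Finset.card_image_of_injOn (hinj.mono fun v hv => (Finset.mem_filter.1 hv).1)] at hcard
  rw [hcard, show {m ∈ Finset.range U.card | m < D} = Finset.range (min D U.card) by
    ext m; simp [and_comm], Finset.card_range]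

end abstract

end HappyVertices

namespace HappyVertices

open Turing Computability StackProgram

/-! ### The greedy modulator. -/

section modulator

variable {F : List (List Bool)}

theorem foldl_invariant {α σ : Type*} {step : σ → α → σ} {P : σ → Prop} {l : List α} {s : σ}
    (h : ∀ s, ∀ a ∈ l, P s → P (step s a)) (hs : P s) : P (l.foldl step s) := by
  induction l generalizing s with
  | nil => exact hs
  | cons a l ih =>
    exact ih (fun s b hb => h s b (by simp [hb])) (h s a (by simp) hs)

/-- Every element achieves its property when it is processed, and the accumulated list only grows
afterwards. -/
theorem foldl_eventually {α β : Type*} {step : List β → α → List β} {P : α → List β → Prop}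
    (hsub : ∀ s a, s ⊆ step s a) (hstep : ∀ s a, P a (step s a))
    (hmono : ∀ a s t, s ⊆ t → P a s → P a t) {l : List α} (s : List β) :
    ∀ a ∈ l, P a (l.foldl step s) := by
  induction l generalizing s with
  | nil => simp
  | cons b l ih =>
    intro a ha
    rcases List.mem_cons.1 ha with rfl | ha
    · exact foldl_invariant (P := P a) (s := step s a) (fun s b _ h => hmono a _ _ (hsub s b) h)
        (hstep s a)
    · exact ih _ a ha

/-- The step of the greedy algorithm for the modulator. -/
def modulatorStep (F : List (List Bool)) (u : ℕ) (S : List ℕ) (v : ℕ) : List ℕ :=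
  bif !u.beq v && !adj F u v && !memNat u S && !memNat v S then u :: v :: S else S

theorem modulatorStep_of (u : ℕ) (S : List ℕ) (v : ℕ) :
    (modulatorStep F u S v = u :: v :: S ∧ u ≠ v ∧ adj F u v = false ∧ u ∉ S ∧ v ∉ S) ∨
    (modulatorStep F u S v = S ∧ (u ≠ v → adj F u v = false → u ∈ S ∨ v ∈ S)) := by
  unfold modulatorStep
  by_cases h : u ≠ v ∧ adj F u v = false ∧ u ∉ S ∧ v ∉ S
  · left
    refine ⟨?_, h⟩
    have : (!u.beq v && !adj F u v && !memNat u S && !memNat v S) = true := by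
      simp [h, ← Bool.not_eq_true]
    rw [this]
    rfl
  · right
    constructor
    · have : (!u.beq v && !adj F u v && !memNat u S && !memNat v S) = false := by
        rw [← Bool.not_eq_true]
        simpa [← Bool.not_eq_true, and_assoc] using h
      rw [this]
      rfl
    · tauto

theorem subset_modulatorStep (u : ℕ) (S : List ℕ) (v : ℕ) : S ⊆ modulatorStep F u S v := by
  rcases modulatorStep_of (F := F) u S v with h | h <;> rw [h.1]
  · exact fun x hx => by simp [hx]
  · exact List.Subset.refl S

theorem modulator_invariant {P : List ℕ → Prop} (h0 : P [])
    (h : ∀ S u v, u < vertexCount F → v < vertexCount F → u ≠ v → adj F u v = false → u ∉ S →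
      v ∉ S → P S → P (u :: v :: S)) : P (modulator F) := by
  refine foldl_invariant (fun S u hu hS => ?_) h0
  refine foldl_invariant (step := modulatorStep F u) (fun S v hv hS => ?_) hS
  rcases modulatorStep_of (F := F) u S v with h' | h' <;> rw [h'.1]
  · exact h S u v (List.mem_range.1 hu) (List.mem_range.1 hv) h'.2.1 h'.2.2.1 h'.2.2.2.1
      h'.2.2.2.2 hS
  · exact hS

theorem lt_of_mem_modulator {u : ℕ} (h : u ∈ modulator F) : u < vertexCount F :=
  modulator_invariant (P := fun S => ∀ u ∈ S, u < vertexCount F) (by simp)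
    (fun S u v hu hv _ _ _ _ hS => by simpa [hu, hv] using hS) u h

theorem nodup_modulator : (modulator F).Nodup :=
  modulator_invariant (P := List.Nodup) List.nodup_nil
    (fun S u v _ _ huv _ hu hv hS => by simp [huv, hu, hv, hS])

theorem adj_of_notMem_modulator {u v : ℕ} (hu : u < vertexCount F) (hv : v < vertexCount F)
    (huS : u ∉ modulator F) (hvS : v ∉ modulator F) (huv : u ≠ v) : adj F u v = true := by
  by_contra hadj
  rw [Bool.not_eq_true] at hadj
  have hinner : ∀ u S, S ⊆ (List.range (vertexCount F)).foldl (modulatorStep F u) S := fun u S =>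
    foldl_invariant (P := fun T => S ⊆ T)
      (fun T v _ hT => List.Subset.trans hT (subset_modulatorStep u T v)) (List.Subset.refl S)
  -- When the nonadjacent pair is inspected, either one of its vertices has been chosen already or
  -- both are chosen now.
  have h : u ∈ modulator F ∨ v ∈ modulator F := by
    refine foldl_eventually (P := fun u S => ∀ v, v < vertexCount F → u ≠ v → adj F u v = false →
      u ∈ S ∨ v ∈ S) (fun S u => hinner u S) (fun S u v hv => ?_)
      (fun u S T hST h v hv h₁ h₂ => (h v hv h₁ h₂).imp (@hST _) (@hST _)) [] u
      (List.mem_range.2 hu) v hv huv hadj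
    refine foldl_eventually (P := fun v S => u ≠ v → adj F u v = false → u ∈ S ∨ v ∈ S)
      (subset_modulatorStep u) (fun S v h₁ h₂ => ?_)
      (fun v S T hST h h₁ h₂ => (h h₁ h₂).imp (@hST _) (@hST _)) S v (List.mem_range.2 hv)
    rcases modulatorStep_of (F := F) u S v with h' | h' <;> rw [h'.1]
    · simp
    · exact h'.2 h₁ h₂
  exact h.elim huS hvS

/-- The greedy modulator is at most twice as large as any other modulator. -/
theorem length_modulator_le (T : Finset ℕ)
    (hT : ∀ u v, u < vertexCount F → v < vertexCount F → u ∉ T → v ∉ T → u ≠ v →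
      adj F u v = true) : (modulator F).length ≤ 2 * T.card := by
  have h : (modulator F).length ≤ 2 * (T ∩ (modulator F).toFinset).card := by
    refine modulator_invariant (P := fun S => S.length ≤ 2 * (T ∩ S.toFinset).card) (by simp) ?_
    intro S u v hu hv huv hadj huS hvS hS
    -- Two nonadjacent vertices cannot both be outside `T`. As the matched pairs are disjoint, each
    -- contributes a new element of `T`.
    have huvT : u ∈ T ∨ v ∈ T := by
      by_contra! h
      simp [hT u v hu hv h.1 h.2 huv] at hadj
    obtain ⟨w, hwT, hwS, hw⟩ : ∃ w ∈ T, w ∉ S ∧ (w = u ∨ w = v) := by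
      rcases huvT with h | h
      exacts [⟨u, h, huS, .inl rfl⟩, ⟨v, h, hvS, .inr rfl⟩]
    have hsub : insert w (T ∩ S.toFinset) ⊆ T ∩ (u :: v :: S).toFinset := by
      intro x hx
      rcases Finset.mem_insert.1 hx with rfl | hx
      · rcases hw with rfl | rfl <;> simp [hwT]
      · simp only [Finset.mem_inter, List.mem_toFinset] at hx
        simp [hx]
    have hcard := Finset.card_le_card hsub
    rw [Finset.card_insert_of_notMem (by simp [hwS])] at hcard
    simp only [List.length_cons]
    omega
  exact h.trans (Nat.mul_le_mul_left 2 (Finset.card_le_card Finset.inter_subset_left))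

end modulator

/-- The fields `F` describe a graph and a precoloring. -/
structure Represents {C : Type} (F : List (List Bool)) (r : ℕ → ℕ → Prop) (p : ℕ → Option C)
    (e : Option C → List Bool) : Prop where
  symm : ∀ u v, r u v → r v u
  adj_iff : ∀ u < vertexCount F, ∀ v < vertexCount F, adj F u v = true ↔ r u v
  color_eq : ∀ v < vertexCount F, color F v = e (p v)
  injective : Function.Injective e
  map_none : e none = []

/-! ### Signatures, candidates, and the number of deleted vertices. -/

namespace Represents

variable {C : Type} {F : List (List Bool)} {r : ℕ → ℕ → Prop} {p : ℕ → Option C}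
  {e : Option C → List Bool}

theorem map_some_ne (h : Represents F r p e) (a : C) : e (some a) ≠ [] := by
  rw [← h.map_none]
  exact fun h' => by simpa using h.injective h'

theorem mem_clique {F : List (List Bool)} {v : ℕ} :
    v ∈ clique F ↔ v < vertexCount F ∧ v ∉ modulator F := by
  simp [clique, ← Bool.not_eq_true]

theorem mem_palette (h : Represents F r p e) {v : ℕ} (hv : v < vertexCount F) {a : List Bool} :
    a ∈ palette F v ↔
      ∃ u < vertexCount F, (u = v ∨ r v u) ∧ ∃ b, p u = some b ∧ e (some b) = a := by
  simp only [palette, List.mem_map, List.mem_filter, List.mem_range, Bool.and_eq_true,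
    Bool.or_eq_true, Nat.beq_eq, Bool.not_eq_true', List.isEmpty_eq_false_iff]
  refine exists_congr fun u => ⟨fun ⟨⟨hu, huv, hne⟩, ha⟩ => ?_, fun ⟨hu, huv, b, hb, ha⟩ => ?_⟩
  · rw [h.color_eq u hu] at hne ha
    refine ⟨hu, huv.imp_right (h.adj_iff v hv u hu).1, ?_⟩
    cases hpu : p u with
    | none => rw [hpu] at hne; exact absurd h.map_none hne
    | some b => exact ⟨b, rfl, hpu ▸ ha⟩
  · have hcu := h.color_eq u hu
    rw [hb] at hcu
    exact ⟨⟨hu, huv.imp_right (h.adj_iff v hv u hu).2, hcu ▸ h.map_some_ne b⟩, hcu ▸ ha⟩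

theorem mem_alive {v : ℕ} : v ∈ alive F ↔
    (v < vertexCount F ∧ v ∉ modulator F) ∧ ∀ a ∈ palette F v, ∀ b ∈ palette F v, a = b := by
  simp only [alive, List.mem_filter, mem_clique, isDead, Bool.not_eq_true', ← Bool.not_eq_true,
    List.any_eq_true, not_exists, not_and, eqBits_iff, not_not]

theorem signature_eq {v : ℕ} (hv : v ∈ alive F) {a : List Bool} (ha : a ∈ palette F v) :
    signature F v = a := by
  have := (mem_alive.1 hv).2
  unfold signature
  cases hp : palette F v with
  | nil => rw [hp] at ha; simp at ha
  | cons b l => exact this b (by simp [hp]) a ha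

theorem signature_mem {v : ℕ} (hv : signature F v ≠ []) : signature F v ∈ palette F v := by
  unfold signature at *
  cases hp : palette F v with
  | nil => simp [hp] at hv
  | cons b l => simp

variable (h : Represents F r p e)

/-- The vertices of the instance. -/
abbrev verts (F : List (List Bool)) : Finset ℕ := Finset.range (vertexCount F)

/-- The modulator as a finite set. -/
abbrev modSet (F : List (List Bool)) : Finset ℕ := (modulator F).toFinset

theorem mem_verts_sdiff {v : ℕ} :
    v ∈ verts F ∧ v ∉ modSet F ↔ v < vertexCount F ∧ v ∉ modulator F := by simp

/-- The vertices of the kernel as a finite set. -/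
abbrev keptSet (F : List (List Bool)) : Finset ℕ := (kept F).toFinset

include h

/-- All precolors seen by a candidate coincide, so the first one in its palette decides. This links
the computed lists with the abstract candidate sets. -/
theorem mem_candidates_iff {v : ℕ} {i : C} : v ∈ candidates r p (verts F) (modSet F) i ↔
    v ∈ alive F ∧ (signature F v = [] ∨ signature F v = e (some i)) := by
  rw [mem_candidates, mem_verts_sdiff]
  constructor
  · rintro ⟨hv, hcol⟩
    have hpal : ∀ a ∈ palette F v, a = e (some i) := fun a ha => by
      obtain ⟨u, hu, huv, b, hb, rfl⟩ := (h.mem_palette hv.1).1 ha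
      rw [hcol u (Finset.mem_range.2 hu) huv b hb]
    refine ⟨mem_alive.2 ⟨hv, fun a ha b hb => (hpal a ha).trans (hpal b hb).symm⟩, ?_⟩
    by_cases hs : signature F v = []
    · exact .inl hs
    · exact .inr (hpal _ (signature_mem hs))
  · rintro ⟨hv, hs⟩
    have hv' := (mem_alive.1 hv).1
    refine ⟨hv', fun u hu huv a ha => ?_⟩
    have hsig := signature_eq hv
      ((h.mem_palette hv'.1).2 ⟨u, Finset.mem_range.1 hu, huv, a, ha, rfl⟩)
    rcases hs with hs | hs
    · exact absurd (hsig.symm.trans hs) (h.map_some_ne a)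
    · exact Option.some.inj (h.injective (hsig.symm.trans hs))

theorem exists_mem_candidates [Nonempty C] {v : ℕ} (hv : v ∈ alive F) :
    ∃ i, v ∈ candidates r p (verts F) (modSet F) i := by
  by_cases hs : signature F v = []
  · exact ⟨Classical.arbitrary C, h.mem_candidates_iff.2 ⟨hv, .inl hs⟩⟩
  · obtain ⟨u, -, -, b, -, hb⟩ := (h.mem_palette (mem_alive.1 hv).1.1).1 (signature_mem hs)
    exact ⟨b, h.mem_candidates_iff.2 ⟨hv, .inr hb.symm⟩⟩

omit h in
theorem mem_aliveWith {u v : ℕ} : u ∈ aliveWith F v ↔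
    u ∈ alive F ∧ (signature F u = [] ∨ signature F u = signature F v) := by
  simp [aliveWith]

omit h in
theorem nodup_alive : (alive F).Nodup := (List.nodup_range.filter _).filter _

omit h in
theorem nodup_aliveWith {v : ℕ} : (aliveWith F v).Nodup := nodup_alive.filter _

/-- The number of colors may be exponential in the input length, so the algorithm cannot try them
all. A color that is no signature has only candidates of empty signature, and any of these
represents it. -/
theorem exists_candidates_eq {i : C}
    (hne : (candidates r p (verts F) (modSet F) i).Nonempty) :
    ∃ v ∈ alive F, candidates r p (verts F) (modSet F) i = (aliveWith F v).toFinset := by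
  by_cases hex : ∃ v ∈ alive F, signature F v = e (some i)
  · obtain ⟨v, hv, hs⟩ := hex
    refine ⟨v, hv, Finset.ext fun u => ?_⟩
    rw [h.mem_candidates_iff, List.mem_toFinset, mem_aliveWith, hs]
  · push Not at hex
    obtain ⟨v, hv⟩ := hne
    have hv := h.mem_candidates_iff.1 hv
    refine ⟨v, hv.1, Finset.ext fun u => ?_⟩
    rw [h.mem_candidates_iff, List.mem_toFinset, mem_aliveWith, hv.2.resolve_right (hex v hv.1),
      or_self]
    exact and_congr_right fun hu => or_iff_left (hex u hu)

theorem card_candidates_lt (h1 : 0 < target F)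
    (hlt : ∀ v ∈ alive F, (aliveWith F v).length < target F) (i : C) :
    (candidates r p (verts F) (modSet F) i).card < target F := by
  rcases (candidates r p (verts F) (modSet F) i).eq_empty_or_nonempty with h0 | h0
  · rwa [h0]
  · obtain ⟨v, hv, hc⟩ := h.exists_candidates_eq h0
    rw [hc]
    exact (List.toFinset_card_le _).trans_lt (hlt v hv)

omit h in
theorem mem_kept {v : ℕ} : v ∈ kept F ↔ v < vertexCount F ∧
    (v ∈ modulator F ∨ isMarked F v = true ∨
      isDead F v = false ∧ target F - threshold F ≤ deletionRank F v) := by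
  simp only [kept, isDeleted, List.mem_filter, List.mem_range, Bool.not_eq_true', Bool.and_eq_false_iff,
    Bool.or_eq_false_iff, Bool.not_eq_false', memNat_iff, ← Bool.not_eq_true (Nat.ble _ _),
    Nat.ble_eq, or_assoc, not_le, Nat.lt_succ_iff]

omit h in
theorem isDead_of_mem_alive {v : ℕ} (hv : v ∈ alive F) : isDead F v = false := by
  simpa using (List.mem_filter.1 hv).2

theorem deletionKey_injOn (i : C) :
    Set.InjOn (deletionKey F) (candidates r p (verts F) (modSet F) i) := by
  intro u hu v hv huv
  have hu' := (mem_alive.1 (h.mem_candidates_iff.1 hu).1).1.1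
  have hv' := (mem_alive.1 (h.mem_candidates_iff.1 hv).1).1.1
  have hkey : ∀ v, deletionKey F v = v ∨ deletionKey F v = vertexCount F + v := fun v => by
    unfold deletionKey
    cases (signature F v).isEmpty
    exacts [.inr rfl, .inl rfl]
  rcases hkey u with h₁ | h₁ <;> rcases hkey v with h₂ | h₂ <;> omega

/-- The rank does not depend on the color `i`. If `v` has signature `i`, its list is the candidate
set of `i`. If its signature is empty, its key is below the vertex count, and only vertices of empty
signature, common to all candidate sets, have smaller keys. -/
theorem deletionRank_eq {i : C} {v : ℕ} (hv : v ∈ candidates r p (verts F) (modSet F) i) :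
    deletionRank F v = {u ∈ {u ∈ candidates r p (verts F) (modSet F) i | isMarked F u = false} |
      deletionKey F u < deletionKey F v}.card := by
  unfold deletionRank
  rw [← List.toFinset_card_of_nodup (nodup_aliveWith.filter _)]
  congr 1
  ext u
  simp only [List.mem_toFinset, List.mem_filter, Finset.mem_filter, Bool.and_eq_true,
    Bool.not_eq_true', Nat.ble_eq, ← and_assoc, Nat.succ_le_iff]
  have hv := h.mem_candidates_iff.1 hv
  rw [h.mem_candidates_iff]
  by_cases hkey : deletionKey F u < deletionKey F v
  · refine and_congr_left fun _ => and_congr_left fun _ => ?_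
    rw [mem_aliveWith]
    refine and_congr_right fun hu => ?_
    rcases hv.2 with hs | hs
    · rw [hs, or_self]
      refine ⟨.inl, fun h' => by_contra fun hne => ?_⟩
      have := (mem_alive.1 hv.1).1.1
      have hu' : deletionKey F u = vertexCount F + u := by
        unfold deletionKey
        rw [List.isEmpty_eq_false_iff.2 hne]
        rfl
      have hv' : deletionKey F v = v := by
        unfold deletionKey
        rw [hs]
        rfl
      omega
    · rw [hs]
  · simp [hkey]

theorem mem_candidates_sdiff_kept {i : C} :
    candidates r p (verts F) (modSet F) i \ keptSet F =
      {v ∈ {v ∈ candidates r p (verts F) (modSet F) i | isMarked F v = false} |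
        {u ∈ {u ∈ candidates r p (verts F) (modSet F) i | isMarked F u = false} |
          deletionKey F u < deletionKey F v}.card < target F - threshold F} := by
  ext v
  simp only [Finset.mem_sdiff, Finset.mem_filter (s := Finset.filter _ _), List.mem_toFinset]
  rw [Finset.mem_filter (s := candidates r p (verts F) (modSet F) i), and_assoc]
  refine and_congr_right fun hv => ?_
  have hv' := (h.mem_candidates_iff.1 hv).1
  rw [← h.deletionRank_eq hv, mem_kept, isDead_of_mem_alive hv']
  have := (mem_alive.1 hv').1
  simp only [this, true_and, false_or, not_or, not_le, Bool.not_eq_true]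

/-- Exactly the unmarked candidates of rank below D are deleted, and the ranks within one color are
consecutive from 0. -/
theorem card_candidates_sdiff_kept (i : C) :
    (candidates r p (verts F) (modSet F) i \ keptSet F).card = min (target F - threshold F)
      {v ∈ candidates r p (verts F) (modSet F) i | isMarked F v = false}.card := by
  rw [h.mem_candidates_sdiff_kept]
  exact card_filter_rank_lt _ _ ((h.deletionKey_injOn i).mono fun v hv =>
    (Finset.mem_filter.1 hv).1) _

omit h in
theorem length_flatMap_le {α β : Type*} (l : List α) (f : α → List β) (m : ℕ)
    (hf : ∀ a ∈ l, (f a).length ≤ m) : (l.flatMap f).length ≤ l.length * m := by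
  induction l with
  | nil => simp
  | cons a l ih =>
    have h₁ := hf a (by simp)
    have h₂ := ih fun b hb => hf b (by simp [hb])
    simp only [List.flatMap_cons, List.length_append, List.length_cons, Nat.succ_mul]
    omega

omit h in
theorem length_commonMarks_le :
    (commonMarks F).length ≤ (modulator F).length * (modulator F).length :=
  length_flatMap_le _ _ _ fun u _ => (length_flatMap_le _ _ 1 fun w _ => by simp).trans (by simp)

omit h in
theorem length_spread_le (l : List ℕ) : (spread F l).length ≤ 2 := by
  have h₁ : (l.take 1).length ≤ 1 := by simp
  have h₂ := length_flatMap_le (l.take 1)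
    (fun x => (l.filter fun y => !eqBits (color F x) (color F y)).take 1) 1 (by simp)
  rw [spread, List.length_append]
  omega

omit h in
theorem length_colorMarks_le : (colorMarks F).length ≤ 2 * ((modulator F).length + 1) := by
  rw [colorMarks, List.length_append]
  have h₁ := length_spread_le (F := F) ((clique F).filter fun v => !(color F v).isEmpty)
  have h₂ := length_flatMap_le (modulator F)
    (fun u => spread F ((clique F).filter fun v => !(color F v).isEmpty && adj F u v)) 2
    fun _ _ => length_spread_le _
  omega

omit h in
theorem isMarked_iff {v : ℕ} : isMarked F v = true ↔ v ∈ commonMarks F ∨ v ∈ colorMarks F ∨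
    ∃ u ∈ modulator F, v ∈ neighbourMarks F u (signature F v) := by
  simp [isMarked, or_assoc]

/-- A candidate has the empty signature or signature `i`, so only two families of neighbour marks
matter, with s² elements each. The common marks give another s², the color marks 2(s + 1). -/
theorem card_marked_candidates_le (i : C) :
    {v ∈ candidates r p (verts F) (modSet F) i | isMarked F v = true}.card ≤
      3 * ((modulator F).length * (modulator F).length) + 2 * ((modulator F).length + 1) := by
  have hnb : ∀ a, ((modulator F).flatMap fun u => neighbourMarks F u a).length ≤
      (modulator F).length * (modulator F).length := fun a =>
    length_flatMap_le _ _ _ fun u _ => by simp [neighbourMarks]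
  have hsub : {v ∈ candidates r p (verts F) (modSet F) i | isMarked F v = true} ⊆
      (commonMarks F ++ colorMarks F ++ ((modulator F).flatMap fun u => neighbourMarks F u []) ++
        (modulator F).flatMap fun u => neighbourMarks F u (e (some i))).toFinset := by
    intro v hv
    obtain ⟨hv, hm⟩ := Finset.mem_filter.1 hv
    simp only [List.mem_toFinset, List.mem_append, List.mem_flatMap]
    rcases isMarked_iff.1 hm with hm | hm | hm
    · simp [hm]
    · simp [hm]
    · rcases (h.mem_candidates_iff.1 hv).2 with hs | hs <;> rw [hs] at hm
      · exact .inl (.inr hm)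
      · exact .inr hm
  refine (Finset.card_le_card hsub).trans ((List.toFinset_card_le _).trans ?_)
  simp only [List.length_append]
  have h₁ := length_commonMarks_le (F := F)
  have h₂ := length_colorMarks_le (F := F)
  have h₃ := hnb []
  have h₄ := hnb (e (some i))
  omega

end Represents

end HappyVertices

namespace HappyVertices

open Turing Computability StackProgram

/-! ### Equivalence and size of the kernel. -/

namespace Represents

variable {C : Type} {F : List (List Bool)} {r : ℕ → ℕ → Prop} {p : ℕ → Option C}
  {e : Option C → List Bool}

theorem exists_mem_take_one {l : List ℕ} {v : ℕ} (hv : v ∈ l) : ∃ x ∈ l, x ∈ l.take 1 := by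
  cases l with
  | nil => simp at hv
  | cons x l => exact ⟨x, by simp, by simp⟩

theorem mem_of_mem_take {l : List ℕ} {n v : ℕ} (hv : v ∈ l.take n) : v ∈ l :=
  List.take_subset n l hv

theorem mem_of_mem_spread {l : List ℕ} {v : ℕ} (hv : v ∈ spread F l) : v ∈ l := by
  rcases List.mem_append.1 hv with hv | hv
  · exact mem_of_mem_take hv
  · obtain ⟨x, -, hv⟩ := List.mem_flatMap.1 hv
    exact (List.mem_filter.1 (mem_of_mem_take hv)).1

/-- If two colors occur in the list, two of them already occur in its `spread`. -/
theorem color_eq_of_spread {l : List ℕ} {a : List Bool} (h : ∀ x ∈ spread F l, color F x = a) :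
    ∀ y ∈ l, color F y = a := by
  intro y hy
  by_contra hne
  obtain ⟨x, -, hx⟩ := exists_mem_take_one hy
  have hxa := h x (List.mem_append.2 (.inl hx))
  have hy' : y ∈ l.filter fun y => !eqBits (color F x) (color F y) := by
    rw [List.mem_filter]
    refine ⟨hy, ?_⟩
    rw [Bool.not_eq_true', ← Bool.not_eq_true, eqBits_iff, hxa]
    exact fun h => hne h.symm
  obtain ⟨z, hz, hz'⟩ := exists_mem_take_one hy'
  have hza := h z (List.mem_append.2 (.inr (List.mem_flatMap.2 ⟨x, hx, hz'⟩)))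
  have := (List.mem_filter.1 hz).2
  rw [Bool.not_eq_true', ← Bool.not_eq_true, eqBits_iff, hxa, hza] at this
  exact this rfl

theorem mem_alive_of_mem_neighbourMarks {u v : ℕ} {a : List Bool}
    (hv : v ∈ neighbourMarks F u a) : v ∈ alive F ∧ adj F u v = true ∧ signature F v = a := by
  simpa using List.mem_filter.1 (mem_of_mem_take hv)

theorem lt_of_isMarked {v : ℕ} (hv : isMarked F v = true) : v < vertexCount F := by
  have hclique : v ∈ clique F := by
    rcases isMarked_iff.1 hv with hv | hv | ⟨u, -, hv⟩
    · obtain ⟨u, -, hv⟩ := List.mem_flatMap.1 hv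
      obtain ⟨w, -, hv⟩ := List.mem_flatMap.1 hv
      exact (List.mem_filter.1 (mem_of_mem_take hv)).1
    · rcases List.mem_append.1 hv with hv | hv
      · exact (List.mem_filter.1 (mem_of_mem_spread hv)).1
      · obtain ⟨u, -, hv⟩ := List.mem_flatMap.1 hv
        exact (List.mem_filter.1 (mem_of_mem_spread hv)).1
    · exact (List.mem_filter.1 (mem_alive_of_mem_neighbourMarks hv).1).1
  exact (mem_clique.1 hclique).1

theorem mem_kept_of_isMarked {v : ℕ} (hv : isMarked F v = true) : v ∈ kept F :=
  mem_kept.2 ⟨lt_of_isMarked hv, .inr (.inl hv)⟩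

variable (h : Represents F r p e)

include h

theorem color_ne_nil_iff {v : ℕ} (hv : v < vertexCount F) : color F v ≠ [] ↔ ∃ a, p v = some a := by
  rw [h.color_eq v hv]
  cases hp : p v with
  | none => simp [h.map_none]
  | some a => simp [h.map_some_ne]

/-- If the marked precolored vertices with the property `q` have the color `i`, then all precolored
vertices of the clique with this property have it. -/
theorem color_eq_of_marks {q : ℕ → Bool} {i : C}
    (hq : ∀ x ∈ spread F ((clique F).filter fun v => !(color F v).isEmpty && q v),
      x ∈ colorMarks F)
    (hW : ∀ x ∈ keptSet F, x ∉ modSet F → q x = true → ∀ b, p x = some b → b = i) {x : ℕ} {b : C}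
    (hx : x ∈ clique F) (hqx : q x = true) (hb : p x = some b) : b = i := by
  have hmem : ∀ y, y ∈ (clique F).filter (fun v => !(color F v).isEmpty && q v) ↔
      y ∈ clique F ∧ (∃ a, p y = some a) ∧ q y = true := by
    intro y
    rw [List.mem_filter, Bool.and_eq_true, Bool.not_eq_true', List.isEmpty_eq_false_iff]
    refine and_congr_right fun hy => ?_
    rw [← h.color_ne_nil_iff (mem_clique.1 hy).1]
  have hall := color_eq_of_spread (F := F) (a := e (some i)) (fun y hy => by
    obtain ⟨hyc, ⟨a, ha⟩, hqy⟩ := (hmem y).1 (mem_of_mem_spread hy)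
    have hyk := mem_kept_of_isMarked (isMarked_iff.2 (.inr (.inl (hq y hy))))
    rw [h.color_eq y (mem_clique.1 hyc).1, ha, hW y (List.mem_toFinset.2 hyk)
      (fun h => (mem_clique.1 hyc).2 (List.mem_toFinset.1 h)) hqy a ha]) x
    ((hmem x).2 ⟨hx, ⟨b, hb⟩, hqx⟩)
  rw [h.color_eq x (mem_clique.1 hx).1, hb] at hall
  exact Option.some.inj (h.injective hall)

/-- If D candidates are deleted, fewer than target - D remain. Otherwise all unmarked ones are
deleted and D > 0, so the new target is the threshold, which exceeds the marked candidates and `S`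
together. -/
theorem card_candidates_inter_kept (h1 : 0 < target F)
    (hlt : ∀ v ∈ alive F, (aliveWith F v).length < target F) (i : C) :
    ((candidates r p (verts F) (modSet F) i \ keptSet F).card = target F - threshold F ∧
      (candidates r p (verts F) (modSet F) i ∩ keptSet F).card <
        target F - (target F - threshold F)) ∨
    (candidates r p (verts F) (modSet F) i ∩ keptSet F).card + (modSet F).card <
      target F - (target F - threshold F) := by
  have hs : (modSet F).card ≤ (modulator F).length := List.toFinset_card_le _
  have h₁ := Finset.card_inter_add_card_sdiff (candidates r p (verts F) (modSet F) i) (keptSet F)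
  have h₂ := h.card_candidates_sdiff_kept i
  have h₃ := h.card_marked_candidates_le i
  have h₄ := h.card_candidates_lt h1 hlt i
  have h₅ : {v ∈ candidates r p (verts F) (modSet F) i | isMarked F v = true}.card +
      {v ∈ candidates r p (verts F) (modSet F) i | isMarked F v = false}.card =
      (candidates r p (verts F) (modSet F) i).card := by
    simpa using Finset.card_filter_add_card_filter_not (s := candidates r p (verts F) (modSet F) i)
      (fun v => isMarked F v = true)
  unfold threshold at *
  omega

/-- The induced subgraph on the kept vertices is equivalent to the given instance. -/
theorem yesOn_kept_iff (h1 : 0 < target F)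
    (hlt : ∀ v ∈ alive F, (aliveWith F v).length < target F) :
    YesOn r p (keptSet F) (target F - (target F - threshold F)) ↔
      YesOn r p (verts F) (target F) := by
  have hk : target F - (target F - threshold F) + (target F - threshold F) = target F := by omega
  have hX : ∀ v, v ∈ verts F → v ∉ modSet F → v ∈ clique F := fun v hv hvS =>
    mem_clique.2 (mem_verts_sdiff.1 ⟨hv, hvS⟩)
  have hS : ∀ v, v ∈ modSet F ↔ v ∈ modulator F := fun v => List.mem_toFinset
  have hcl : ∀ v, v ∈ clique F → v ∉ modSet F := fun v hv h =>
    (mem_clique.1 hv).2 (List.mem_toFinset.1 h)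
  have hadj : ∀ u ∈ modulator F, ∀ v ∈ clique F, adj F u v = true ↔ r u v := fun u hu v hv =>
    h.adj_iff u (lt_of_mem_modulator hu) v (mem_clique.1 hv).1
  have hcardS : (modSet F).card = (modulator F).length :=
    List.toFinset_card_of_nodup nodup_modulator
  conv_rhs => rw [← hk]
  refine yesOn_iff_of_kept (S := modSet F) h.symm ?_ ?_ ?_ ?_ ?_ ?_ ?_ ?_ ?_ ?_
  · intro v hv
    exact List.mem_toFinset.2 (mem_kept.2 ⟨lt_of_mem_modulator ((hS v).1 hv), .inl ((hS v).1 hv)⟩)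
  · intro v hv
    exact Finset.mem_range.2 (mem_kept.1 (List.mem_toFinset.1 hv)).1
  · intro u hu huS v hv hvS huv
    have hu := mem_clique.1 (hX u hu huS)
    have hv := mem_clique.1 (hX v hv hvS)
    exact (h.adj_iff u hu.1 v hv.1).1 (adj_of_notMem_modulator hu.1 hv.1 hu.2 hv.2 huv)
  · intro u hu w hw v hv hvS huv hwv
    have hv := hX v hv hvS
    have hvl : v ∈ (clique F).filter fun v => adj F u v && adj F w v := by
      rw [List.mem_filter, Bool.and_eq_true, hadj u ((hS u).1 hu) v hv, hadj w ((hS w).1 hw) v hv]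
      exact ⟨hv, huv, hwv⟩
    obtain ⟨x, hx, hx'⟩ := exists_mem_take_one hvl
    rw [List.mem_filter, Bool.and_eq_true] at hx
    have hm : x ∈ commonMarks F := List.mem_flatMap.2
      ⟨u, (hS u).1 hu, List.mem_flatMap.2 ⟨w, (hS w).1 hw, hx'⟩⟩
    exact ⟨x, List.mem_toFinset.2 (mem_kept_of_isMarked (isMarked_iff.2 (.inl hm))), hcl x hx.1,
      (hadj u ((hS u).1 hu) x hx.1).1 hx.2.1, (hadj w ((hS w).1 hw) x hx.1).1 hx.2.2⟩
  · intro u hu i hi x hx hxS hux b hb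
    have hu := (hS u).1 hu
    have hx := hX x hx hxS
    refine h.color_eq_of_marks (q := adj F u) (fun y hy => List.mem_append.2 (.inr
      (List.mem_flatMap.2 ⟨u, hu, hy⟩))) (fun y hy hyS huy => hi y hy hyS ?_) hx
      ((hadj u hu x hx).2 hux) hb
    exact (h.adj_iff u (lt_of_mem_modulator hu) y (mem_kept.1 (List.mem_toFinset.1 hy)).1).1 huy
  · intro i hi x hx hxS b hb
    -- The trivial property selects the marks made for the clique as a whole.
    refine h.color_eq_of_marks (q := fun _ => true) (fun y hy => List.mem_append.2 (.inl ?_))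
      (fun y hy hyS _ => hi y hy hyS) (hX x hx hxS) rfl hb
    simpa using hy
  · intro i v hv hvW u hu huv
    have hu := (hS u).1 hu
    have hv' := h.mem_candidates_iff.1 hv
    refine ⟨(neighbourMarks F u (signature F v)).toFinset, fun x hx => ?_, ?_, fun x hx => ?_⟩
    · have hx := List.mem_toFinset.1 hx
      have hx' := mem_alive_of_mem_neighbourMarks hx
      refine Finset.mem_inter.2 ⟨h.mem_candidates_iff.2 ⟨hx'.1, hx'.2.2.symm ▸ hv'.2⟩, ?_⟩
      exact List.mem_toFinset.2 (mem_kept_of_isMarked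
        (isMarked_iff.2 (.inr (.inr ⟨u, hu, hx'.2.2.symm ▸ hx⟩))))
    · have hvnot : v ∉ neighbourMarks F u (signature F v) := fun hm =>
        hvW (List.mem_toFinset.2 (mem_kept_of_isMarked (isMarked_iff.2 (.inr (.inr ⟨u, hu, hm⟩)))))
      have hvl : v ∈ (alive F).filter
          fun x => adj F u x && eqBits (signature F x) (signature F v) := by
        rw [List.mem_filter, Bool.and_eq_true, eqBits_iff]
        exact ⟨hv'.1, (hadj u hu v (List.mem_filter.1 hv'.1).1).2 huv, rfl⟩
      have hnodup : (neighbourMarks F u (signature F v)).Nodup :=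
        (List.Nodup.filter _ nodup_alive).sublist (List.take_sublist _ _)
      rw [List.toFinset_card_of_nodup hnodup, hcardS]
      unfold neighbourMarks at hvnot ⊢
      rw [List.length_take]
      -- With fewer than |S| marks, `take` would have returned the whole list, including the deleted
      -- vertex `v`.
      by_contra hlen
      rw [List.take_of_length_le (by omega)] at hvnot
      exact hvnot hvl
    · have hx := mem_alive_of_mem_neighbourMarks (List.mem_toFinset.1 hx)
      exact (hadj u hu x (List.mem_filter.1 hx.1).1).1 hx.2.1
  · intro i
    refine ⟨?_, (h.card_candidates_inter_kept h1 hlt i).imp_left And.left⟩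
    rw [h.card_candidates_sdiff_kept]
    exact min_le_left _ _
  -- If D > 0, the new target equals the threshold, which is larger than s.
  · rw [hcardS]
    unfold threshold
    omega
  · intro i
    rcases h.card_candidates_inter_kept h1 hlt i with h | h <;> omega

/-- The colors that are relevant for the vertices that are not dead. -/
theorem exists_colors [Nonempty C] : ∃ J : Finset C, J.card ≤ (modulator F).length + 2 ∧
    ∀ v ∈ alive F, ∃ i ∈ J, v ∈ candidates r p (verts F) (modSet F) i := by
  classical
  let i₀ := Classical.arbitrary C
  -- A precolored clique vertex is in the closed neighbourhood of every clique vertex. Hence a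
  -- signature coming from the clique must be the color of this one vertex.
  let j : C := if hex : ∃ a, ∃ x ∈ clique F, p x = some a then hex.choose else i₀
  refine ⟨insert i₀ (insert j ((modulator F).map fun u => (p u).getD i₀).toFinset), ?_, ?_⟩
  · have h₁ := Finset.card_insert_le i₀
      (insert j ((modulator F).map fun u => (p u).getD i₀).toFinset)
    have h₂ := Finset.card_insert_le j ((modulator F).map fun u => (p u).getD i₀).toFinset
    have h₃ := List.toFinset_card_le ((modulator F).map fun u => (p u).getD i₀)
    rw [List.length_map] at h₃
    omega
  · intro v hv
    have hv' := mem_alive.1 hv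
    by_cases hs : signature F v = []
    · exact ⟨i₀, by simp, h.mem_candidates_iff.2 ⟨hv, .inl hs⟩⟩
    · obtain ⟨u, hu, huv, b, hub, hb⟩ := (h.mem_palette hv'.1.1).1 (signature_mem hs)
      refine ⟨b, ?_, h.mem_candidates_iff.2 ⟨hv, .inr hb.symm⟩⟩
      by_cases huS : u ∈ modulator F
      · refine Finset.mem_insert_of_mem (Finset.mem_insert_of_mem ?_)
        rw [List.mem_toFinset, List.mem_map]
        exact ⟨u, huS, by rw [hub]; rfl⟩
      · refine Finset.mem_insert_of_mem (Finset.mem_insert.2 (.inl ?_))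
        have hex : ∃ a, ∃ x ∈ clique F, p x = some a := ⟨b, u, mem_clique.2 ⟨hu, huS⟩, hub⟩
        have hj : j = hex.choose := dif_pos hex
        obtain ⟨x, hx, hpx⟩ := hex.choose_spec
        rw [← hj] at hpx
        have hx' := mem_clique.1 hx
        have hxv : x = v ∨ r v x := by
          by_cases hxv : x = v
          · exact .inl hxv
          · exact .inr ((h.adj_iff v hv'.1.1 x hx'.1).1
              (adj_of_notMem_modulator hv'.1.1 hx'.1 hv'.1.2 hx'.2 (Ne.symm hxv)))
        have := signature_eq hv ((h.mem_palette hv'.1.1).2 ⟨x, hx'.1, hxv, j, hpx, rfl⟩)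
        exact Option.some.inj (h.injective (hb.trans this))

/-- Dead vertices survive only through common or color marks. The living ones are covered by the
candidate sets of s + 2 colors, each keeping fewer vertices than the threshold. -/
theorem length_kept_le [Nonempty C] (h1 : 0 < target F)
    (hlt : ∀ v ∈ alive F, (aliveWith F v).length < target F) :
    (kept F).length ≤ (modulator F).length + (modulator F).length * (modulator F).length +
      2 * ((modulator F).length + 1) + ((modulator F).length + 2) * threshold F := by
  classical
  obtain ⟨J, hJ, hcover⟩ := h.exists_colors
  have hsub : keptSet F ⊆ modSet F ∪ (commonMarks F).toFinset ∪ (colorMarks F).toFinset ∪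
      J.biUnion fun i => candidates r p (verts F) (modSet F) i ∩ keptSet F := by
    intro v hv
    have hv' := mem_kept.1 (List.mem_toFinset.1 hv)
    have hal : v ∈ alive F → v ∈ J.biUnion
        fun i => candidates r p (verts F) (modSet F) i ∩ keptSet F := fun hva => by
      obtain ⟨i, hi, hvi⟩ := hcover v hva
      exact Finset.mem_biUnion.2 ⟨i, hi, Finset.mem_inter.2 ⟨hvi, hv⟩⟩
    by_cases hvS : v ∈ modulator F
    · simp [hvS]
    · rcases hv'.2.resolve_left hvS with hm | hd
      · rcases isMarked_iff.1 hm with hm | hm | ⟨u, hu, hm⟩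
        · simp [hm]
        · simp [hm]
        · exact Finset.mem_union_right _ (hal (mem_alive_of_mem_neighbourMarks hm).1)
      · refine Finset.mem_union_right _ (hal ?_)
        rw [alive, List.mem_filter, mem_clique, hd.1]
        exact ⟨⟨hv'.1, hvS⟩, rfl⟩
  have hnodup : (kept F).Nodup := List.nodup_range.filter _
  rw [← List.toFinset_card_of_nodup hnodup]
  refine (Finset.card_le_card hsub).trans ((Finset.card_union_le _ _).trans (add_le_add
    ((Finset.card_union_le _ _).trans (add_le_add ((Finset.card_union_le _ _).trans (add_le_add
      (List.toFinset_card_le _) ((List.toFinset_card_le _).trans length_commonMarks_le)))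
      ((List.toFinset_card_le _).trans length_colorMarks_le))) ?_))
  refine (Finset.card_biUnion_le_card_mul J _ (threshold F) fun i _ => ?_).trans
    (Nat.mul_le_mul_right _ hJ)
  rcases h.card_candidates_inter_kept h1 hlt i with h | h <;> omega

end Represents

end HappyVertices

namespace HappyVertices

open Turing Computability StackProgram

/-! ### Instances and their induced subgraphs -/

/-- An instance is a yes-instance if and only if a copy of it on natural numbers is. -/
theorem MHVInstance.isYes_iff_yesOn (J : MHVInstance) {r : ℕ → ℕ → Prop}
    {p : ℕ → Option (Fin J.ℓ)} {X : Finset ℕ} {f : Fin J.n → ℕ} (hf : Function.Injective f)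
    (hX : ∀ v, v ∈ X ↔ ∃ i, f i = v) (hr : ∀ u v, J.graph.Adj u v ↔ r (f u) (f v))
    (hp : ∀ v, p (f v) = J.precoloring v) : J.IsYes ↔ YesOn r p X J.k.toNat := by
  classical
  have hcard : ∀ (c : Fin J.n → Fin J.ℓ) (c' : ℕ → Fin J.ℓ), (∀ i, c' (f i) = c i) →
      {v | IsHappy J.graph c v}.ncard = (happySet r X c').card := by
    intro c c' hc
    rw [← Set.ncard_image_of_injective _ hf, ← Set.ncard_coe_finset]
    congr 1
    ext v
    simp only [Set.mem_image, Set.mem_ofPred_eq, Finset.mem_coe, mem_happySet, hX, IsHappy]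
    constructor
    · rintro ⟨i, hi, rfl⟩
      refine ⟨⟨i, rfl⟩, ?_⟩
      rintro _ ⟨j, rfl⟩ hij
      rw [hc, hc]
      exact hi j ((hr i j).2 hij)
    · rintro ⟨⟨i, rfl⟩, hi⟩
      refine ⟨i, fun j hij => ?_, rfl⟩
      rw [← hc, ← hc]
      exact hi _ ⟨j, rfl⟩ ((hr i j).1 hij)
  constructor
  · rintro ⟨c, hc, hk⟩
    have hc' : ∀ i, Function.extend f c (fun _ => ⟨0, J.ℓ_pos⟩) (f i) = c i := hf.extend_apply c _
    refine ⟨Function.extend f c fun _ => ⟨0, J.ℓ_pos⟩, fun v hv a ha => ?_, ?_⟩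
    · obtain ⟨i, rfl⟩ := (hX v).1 hv
      rw [hc']
      exact hc i a ((hp i).symm.trans ha)
    · rw [← hcard c _ hc']
      exact Int.toNat_le.2 hk
  · rintro ⟨c, hc, hk⟩
    refine ⟨fun i => c (f i), fun i a ha => hc _ ((hX _).2 ⟨i, rfl⟩) a ((hp i).trans ha), ?_⟩
    rw [hcard _ c fun _ => rfl]
    exact Int.toNat_le.1 hk

/-- The colors can be changed if the pattern of the precoloring is the same and there are
sufficiently many new colors. -/
theorem YesOn.change_colors {C C' : Type*} [Fintype C] [Fintype C'] [Nonempty C']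
    {r : ℕ → ℕ → Prop} {p : ℕ → Option C} {p' : ℕ → Option C'} {X : Finset ℕ} {k : ℕ}
    (hnone : ∀ v ∈ X, p v = none → p' v = none)
    (heq : ∀ u ∈ X, ∀ v ∈ X, p u = p v ↔ p' u = p' v)
    (hcard : min (Fintype.card C) X.card ≤ Fintype.card C') (h : YesOn r p X k) :
    YesOn r p' X k := by
  classical
  obtain ⟨c, hc, hk⟩ := h
  -- Only the colors used on `X` matter, and there are at most min(|C|, |X|) of them.
  let B : Finset C := X.image c
  have hB : B.card ≤ Fintype.card C' :=
    (le_min (Finset.card_le_univ B) Finset.card_image_le).trans hcard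
  -- The translation of precolors is well defined and injective because `heq` preserves equality of
  -- precolors in both directions.
  let g : C → C' := fun a =>
    if h : ∃ v ∈ X, p v = some a ∧ (p' v).isSome then (p' h.choose).get h.choose_spec.2.2
    else Classical.arbitrary C'
  have hg : ∀ v ∈ X, ∀ a, p v = some a → ∀ a', p' v = some a' → g a = a' := by
    intro v hv a ha a' ha'
    have hex : ∃ v ∈ X, p v = some a ∧ (p' v).isSome := ⟨v, hv, ha, by simp [ha']⟩
    have hspec := hex.choose_spec
    have h₁ : p' hex.choose = some a' := by
      rw [← ha', ← heq _ hspec.1 v hv, hspec.2.1, ha]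
    simp only [g, dif_pos hex]
    exact Option.get_of_eq_some _ h₁
  let s : Finset B := {b | ∃ v ∈ X, p v = some b.1 ∧ (p' v).isSome}
  have hinj : Set.InjOn (fun b : B => g b) s := by
    intro a ha b hb hab
    simp only [s, Finset.coe_filter, Finset.mem_univ, true_and, Set.mem_ofPred_eq] at ha hb
    obtain ⟨u, hu, hua, hu'⟩ := ha
    obtain ⟨v, hv, hvb, hv'⟩ := hb
    obtain ⟨a', ha'⟩ := Option.isSome_iff_exists.1 hu'
    obtain ⟨b', hb'⟩ := Option.isSome_iff_exists.1 hv'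
    have h₁ := hg u hu _ hua a' ha'
    have h₂ := hg v hv _ hvb b' hb'
    have h₃ : p u = p v := (heq u hu v hv).2 (by rw [ha', hb', ← h₁, ← h₂]; exact congrArg some hab)
    rw [hua, hvb] at h₃
    exact Subtype.ext (Option.some.inj h₃)
  obtain ⟨t, hst, -, ht⟩ := Finset.exists_subsuperset_card_eq
    (s := s.image fun b : B => g b) (Finset.subset_univ _)
    (Finset.card_image_le.trans ((Finset.card_le_univ s).trans (by simp)))
    (show B.card ≤ (Finset.univ : Finset C').card by simpa using hB)
  -- The forced translation of the precolors extends to a bijection from the used colors onto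
  -- equally many new ones.
  obtain ⟨φ, hφ⟩ := Finset.exists_equiv_extend_of_card_eq (α := B) (t := t) (by simpa using ht.symm)
    hst hinj
  let ψ : C → C' := fun a => if h : a ∈ B then φ ⟨a, h⟩ else Classical.arbitrary C'
  refine ⟨fun v => ψ (c v), fun v hv a' ha' => ?_, hk.trans (Finset.card_le_card fun v hv => ?_)⟩
  · cases hpv : p v with
    | none => rw [hnone v hv hpv] at ha'; cases ha'
    | some a =>
      have hcv := hc v hv a hpv
      have haB : a ∈ B := hcv ▸ Finset.mem_image_of_mem c hv
      have hs : (⟨a, haB⟩ : B) ∈ s := by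
        simp only [s, Finset.mem_filter, Finset.mem_univ, true_and]
        exact ⟨v, hv, hpv, by simp [ha']⟩
      simp only [hcv, ψ, dif_pos haB]
      rw [hφ _ hs]
      exact hg v hv a hpv a' ha'
  · rw [mem_happySet] at hv ⊢
    exact ⟨hv.1, fun u hu huv => congrArg ψ (hv.2 u hu huv)⟩

/-! ### The fields of the string of an instance -/

theorem fields_cons (x : Bool × Bool) (w : List (Bool × Bool)) :
    fields (x :: w) = bif x.1 then (x.2 :: (fields w).headD []) :: (fields w).tail
      else [] :: fields w := by
  simp only [fields, List.foldl_reverse, List.foldr_cons]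

theorem fields_append (l : List Bool) (b : Bool) (w : List (Bool × Bool)) :
    fields (l.map (fun b => (true, b)) ++ (false, b) :: w) = l :: fields w := by
  induction l with
  | nil => simp [fields_cons]
  | cons a l ih => simp [fields_cons, ih]

theorem map_ofSymbol_encodeBinary (m : ℕ) :
    (encodeBinary m).map ofSymbol = (encodeNat m).map fun b => (true, b) := by
  simp [encodeBinary, ofSymbol]

/-- The word of bits for a precolor. -/
def colorBits {l : ℕ} : Option (Fin l) → List Bool
  | none => []
  | some i => encodeNat (i.val + 1)

theorem map_ofSymbol_encodeColor {l : ℕ} (a : Option (Fin l)) :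
    (encodeColor a).map ofSymbol = (colorBits a).map fun b => (true, b) := by
  cases a with
  | none => rfl
  | some i => exact map_ofSymbol_encodeBinary _

theorem map_bit_colorBits {l : ℕ} (a : Option (Fin l)) :
    (colorBits a).map Γ'.bit = encodeColor a := by
  cases a <;> rfl

theorem colorBits_injective {l : ℕ} : Function.Injective (colorBits (l := l)) := fun a b h =>
  encodeColor_injective (by rw [← map_bit_colorBits, h, map_bit_colorBits])

open Classical in
/-- The bits of a row of the adjacency matrix. -/
noncomputable def rowBits {n : ℕ} (G : SimpleGraph (Fin n)) (v : Fin n) : List Bool :=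
  (List.finRange n).map fun u => decide (G.Adj v u)

theorem map_ofSymbol_encodeRow {n : ℕ} (G : SimpleGraph (Fin n)) (v : Fin n) :
    (encodeRow G v).map ofSymbol = (rowBits G v).map fun b => (true, b) := by
  simp [encodeRow, rowBits, ofSymbol]

/-- The fields of the string of an instance. -/
noncomputable def MHVInstance.fields (I : MHVInstance) : List (List Bool) :=
  StackProgram.fields (I.encode.map ofSymbol)

theorem MHVInstance.fields_eq (I : MHVInstance) : I.fields =
    (decide (I.k < 0) :: encodeNat I.k.natAbs) :: encodeNat I.ℓ ::
      (List.finRange I.n).flatMap fun v => [rowBits I.graph v, colorBits (I.precoloring v)] := by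
  have hrec : ∀ L : List (Fin I.n), StackProgram.fields
      (((L.map fun v => I.record v ++ [Γ'.ket]).flatten).map ofSymbol) =
      L.flatMap fun v => [rowBits I.graph v, colorBits (I.precoloring v)] := by
    intro L
    induction L with
    | nil => rfl
    | cons v L ih =>
      have h : (((v :: L).map fun v => I.record v ++ [Γ'.ket]).flatten).map ofSymbol =
          (rowBits I.graph v).map (fun b => (true, b)) ++ (false, false) ::
          ((colorBits (I.precoloring v)).map (fun b => (true, b)) ++ (false, true) ::
          ((L.map fun v => I.record v ++ [Γ'.ket]).flatten).map ofSymbol) := by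
        simp [MHVInstance.record, map_ofSymbol_encodeRow, map_ofSymbol_encodeColor, ofSymbol]
      rw [h, fields_append, fields_append, ih]
      rfl
  have h : I.encode.map ofSymbol =
      (decide (I.k < 0) :: encodeNat I.k.natAbs).map (fun b => (true, b)) ++ (false, false) ::
      ((encodeNat I.ℓ).map (fun b => (true, b)) ++ (false, false) ::
        (((List.finRange I.n).map fun v => I.record v ++ [Γ'.ket]).flatten).map ofSymbol) := by
    simp [MHVInstance.encode, encodeInt, map_ofSymbol_encodeBinary, ofSymbol]
  rw [MHVInstance.fields, h, fields_append, fields_append, hrec]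

theorem getElem?_flatMap_pair {α β : Type*} (f g : α → β) (L : List α) (i : ℕ) :
    (L.flatMap fun v => [f v, g v])[2 * i]? = L[i]?.map f ∧
    (L.flatMap fun v => [f v, g v])[2 * i + 1]? = L[i]?.map g := by
  induction L generalizing i with
  | nil => simp
  | cons v L ih =>
    cases i with
    | zero => simp
    | succ i => simpa [Nat.mul_succ] using ih i

namespace MHVInstance

variable (I : MHVInstance)

theorem fields_row (v : Fin I.n) : I.fields.getD (2 + 2 * v) [] = rowBits I.graph v := by
  rw [I.fields_eq, List.getD_eq_getElem?_getD, add_comm, List.getElem?_cons_succ,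
    List.getElem?_cons_succ, (getElem?_flatMap_pair _ _ _ _).1]
  simp

theorem fields_color (v : Fin I.n) :
    color I.fields v = colorBits (I.precoloring v) := by
  rw [color, I.fields_eq, List.getD_eq_getElem?_getD, show 3 + 2 * v.val = 2 * v.val + 1 + 1 + 1 by omega,
    List.getElem?_cons_succ, List.getElem?_cons_succ, (getElem?_flatMap_pair _ _ _ _).2]
  simp

theorem vertexCount_fields : vertexCount I.fields = I.n := by
  -- Without vertices there is no field of index 2, and the default, the empty row, gives the right
  -- count.
  rcases Nat.eq_zero_or_pos I.n with h | h
  · have : List.finRange I.n = [] := by simp [h]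
    rw [vertexCount, I.fields_eq, this]
    exact h.symm
  · have := I.fields_row ⟨0, h⟩
    rw [vertexCount]
    change (I.fields.getD (2 + 2 * 0) []).length = _
    rw [this]
    simp [rowBits]

theorem adj_fields (u v : Fin I.n) : adj I.fields u v = true ↔ I.graph.Adj u v := by
  rw [adj, I.fields_row u, rowBits, List.getD_eq_getElem?_getD]
  simp

/-- Adjacency as a relation on natural numbers. -/
def rel (u v : ℕ) : Prop := ∃ (hu : u < I.n) (hv : v < I.n), I.graph.Adj ⟨u, hu⟩ ⟨v, hv⟩

/-- The precoloring as a function on natural numbers. -/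
def precolor (v : ℕ) : Option (Fin I.ℓ) := if h : v < I.n then I.precoloring ⟨v, h⟩ else none

theorem represents : Represents I.fields I.rel I.precolor colorBits where
  symm := fun u v ⟨hu, hv, h⟩ => ⟨hv, hu, h.symm⟩
  adj_iff := by
    rw [I.vertexCount_fields]
    intro u hu v hv
    exact (I.adj_fields ⟨u, hu⟩ ⟨v, hv⟩).trans ⟨fun h => ⟨hu, hv, h⟩, fun ⟨_, _, h⟩ => h⟩
  color_eq := by
    rw [I.vertexCount_fields]
    intro v hv
    rw [precolor, dif_pos hv]
    exact I.fields_color ⟨v, hv⟩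
  injective := colorBits_injective
  map_none := rfl

theorem isYes_iff : I.IsYes ↔ YesOn I.rel I.precolor (Represents.verts I.fields) I.k.toNat := by
  refine I.isYes_iff_yesOn Fin.val_injective (fun v => ?_) (fun u v => ?_) fun v => ?_
  · rw [Finset.mem_range, I.vertexCount_fields]
    exact ⟨fun h => ⟨⟨v, h⟩, rfl⟩, fun ⟨i, hi⟩ => hi ▸ i.2⟩
  · exact ⟨fun h => ⟨u.2, v.2, h⟩, fun ⟨_, _, h⟩ => h⟩
  · exact dif_pos v.2

theorem target_fields : target I.fields = min I.k.natAbs (I.n + 1) := by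
  rw [target, I.vertexCount_fields, I.fields_eq]
  exact bitsVal_encodeNat _ _

theorem keptColorCount_fields : keptColorCount I.fields = min I.ℓ (kept I.fields).length := by
  rw [keptColorCount]
  conv_lhs => arg 2; rw [I.fields_eq]
  exact bitsVal_encodeNat _ _

theorem sign_fields : (I.fields.getD 0 []).headD false = decide (I.k < 0) := by
  rw [I.fields_eq]
  rfl

theorem length_modulator_fields_le : (modulator I.fields).length ≤ 2 * distanceToClique I.graph := by
  obtain ⟨S, hS, hd⟩ : distanceToClique I.graph ∈
      {d | ∃ S : Finset (Fin I.n), IsCliqueModulator I.graph S ∧ S.card = d} :=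
    -- The set of all vertices is a modulator, so the minimum is attained.
    Nat.sInf_mem ⟨_, Finset.univ, by simp [IsCliqueModulator], rfl⟩
  rw [← hd, ← Finset.card_map Fin.valEmbedding]
  refine length_modulator_le _ fun u v hu hv huS hvS huv => ?_
  rw [I.vertexCount_fields] at hu hv
  refine (I.adj_fields ⟨u, hu⟩ ⟨v, hv⟩).2 (@hS ⟨u, hu⟩ ?_ ⟨v, hv⟩ ?_ ?_)
  · exact fun h => huS (Finset.mem_map.2 ⟨_, h, rfl⟩)
  · exact fun h => hvS (Finset.mem_map.2 ⟨_, h, rfl⟩)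
  · exact fun h => huv (congrArg Fin.val h)

end MHVInstance

end HappyVertices

namespace HappyVertices

open Turing Computability StackProgram

/-! ### The kernel as an instance -/

theorem colorIndex_eq_idxOf (l : List (List Bool)) (a : List Bool) : colorIndex l a = l.idxOf a := by
  unfold colorIndex
  rw [List.foldl_reverse]
  induction l with
  | nil => rfl
  | cons b l ih =>
    rw [List.foldr_cons, ih, List.idxOf_cons, eqBits]
    by_cases hb : b = a
    · simp [hb]
    · rw [decide_eq_false hb, beq_false_of_ne hb]

section keptColors

variable {F : List (List Bool)}

theorem keptColors_spec : (keptColors F).Nodup ∧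
    ∀ a, a ∈ keptColors F ↔ a ≠ [] ∧ a ∈ (kept F).map (color F) := by
  have h : ∀ (l s : List (List Bool)), s.Nodup →
      (l.foldl (fun s a => bif a.isEmpty || s.any (eqBits a) then s else a :: s) s).Nodup ∧
      ∀ a, a ∈ l.foldl (fun s a => bif a.isEmpty || s.any (eqBits a) then s else a :: s) s ↔
        a ∈ s ∨ a ≠ [] ∧ a ∈ l := by
    intro l
    induction l with
    | nil => intro s hs; simp [hs]
    | cons b l ih =>
      intro s hs
      rw [List.foldl_cons]
      by_cases hb : b = [] ∨ b ∈ s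
      · have : (b.isEmpty || s.any (eqBits b)) = true := by simpa using hb
        rw [this]
        refine ⟨(ih s hs).1, fun a => ?_⟩
        rw [cond_true, (ih s hs).2, List.mem_cons]
        refine ⟨by tauto, ?_⟩
        rintro (h | ⟨h, rfl | h'⟩) <;> tauto
      · have : (b.isEmpty || s.any (eqBits b)) = false := by
          rw [← Bool.not_eq_true]
          simpa using hb
        rw [this]
        push Not at hb
        have hs' : (b :: s).Nodup := List.nodup_cons.2 ⟨hb.2, hs⟩
        refine ⟨(ih _ hs').1, fun a => ?_⟩
        rw [cond_false, (ih _ hs').2, List.mem_cons, List.mem_cons]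
        constructor
        · rintro ((rfl | h) | h) <;> tauto
        · tauto
  refine ⟨(h _ [] List.nodup_nil).1, fun a => ?_⟩
  rw [keptColors, (h _ [] List.nodup_nil).2]
  simp

theorem length_keptColors_le_length_kept : (keptColors F).length ≤ (kept F).length := by
  rw [← List.toFinset_card_of_nodup keptColors_spec.1, ← List.length_map (as := kept F) (color F)]
  refine (Finset.card_le_card fun a ha => ?_).trans (List.toFinset_card_le ((kept F).map (color F)))
  exact List.mem_toFinset.2 ((keptColors_spec.2 a).1 (List.mem_toFinset.1 ha)).2

theorem colorIndex_lt {v : ℕ} (hv : v ∈ kept F) (hc : color F v ≠ []) :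
    colorIndex (keptColors F) (color F v) < (keptColors F).length := by
  rw [colorIndex_eq_idxOf, List.idxOf_lt_length_iff]
  exact (keptColors_spec.2 _).2 ⟨hc, List.mem_map_of_mem hv⟩

theorem color_eq_of_colorIndex_eq {u v : ℕ} (hu : u ∈ kept F) (huc : color F u ≠ [])
    (h : colorIndex (keptColors F) (color F u) = colorIndex (keptColors F) (color F v)) :
    color F u = color F v := by
  rw [colorIndex_eq_idxOf, colorIndex_eq_idxOf] at h
  exact (List.idxOf_inj ((keptColors_spec.2 _).2 ⟨huc, List.mem_map_of_mem hu⟩)).1 h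

end keptColors

theorem Represents.length_keptColors_le {l : ℕ} {F : List (List Bool)} {r : ℕ → ℕ → Prop}
    {p : ℕ → Option (Fin l)} {e : Option (Fin l) → List Bool} (h : Represents F r p e) :
    (keptColors F).length ≤ l := by
  rw [← List.toFinset_card_of_nodup keptColors_spec.1]
  have hsub : (keptColors F).toFinset ⊆ Finset.univ.image fun i : Fin l => e (some i) := by
    intro a ha
    obtain ⟨hne, ha⟩ := (keptColors_spec.2 a).1 (List.mem_toFinset.1 ha)
    obtain ⟨v, hv, rfl⟩ := List.mem_map.1 ha
    have hv' := (Represents.mem_kept.1 hv).1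
    obtain ⟨i, hi⟩ := (h.color_ne_nil_iff hv').1 hne
    exact Finset.mem_image.2 ⟨i, Finset.mem_univ _, by rw [h.color_eq v hv', hi]⟩
  exact (Finset.card_le_card hsub).trans (Finset.card_image_le.trans (by simp))

theorem map_toSymbol_bitSymbols (m : ℕ) : (bitSymbols m).map toSymbol = encodeBinary m := by
  simp [bitSymbols, encodeBinary, toSymbol]

theorem length_encodeBinary_le (m : ℕ) : (encodeBinary m).length ≤ m := by
  simpa [encodeBinary] using length_encodeNat_le m

/-- The instance without vertices, one color and target `k`. -/
def emptyInstance (k : ℤ) : MHVInstance := ⟨0, ⊥, 1, one_pos, Fin.elim0, k⟩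

theorem isYes_emptyInstance (k : ℤ) : (emptyInstance k).IsYes ↔ k ≤ 0 := by
  have h : ∀ c : Fin (emptyInstance k).n → Fin (emptyInstance k).ℓ,
      {v | IsHappy (emptyInstance k).graph c v}.ncard = 0 := fun c => by
    rw [Set.ncard_eq_zero]
    exact Set.eq_empty_of_forall_notMem fun v => v.elim0
  constructor
  · rintro ⟨c, -, hk⟩
    exact hk.trans_eq (congrArg Nat.cast (h c))
  · intro hk
    exact ⟨fun v => v.elim0, fun v => v.elim0, hk.trans_eq (congrArg Nat.cast (h _)).symm⟩

/-! ### Trivial cases, the kernel instance, its encoding and the final bounds. -/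

section main

variable (I : MHVInstance)

theorem isYes_of_isTrivialYes (h : isTrivialYes I.fields = true) : I.IsYes := by
  have hR := I.represents
  have : Nonempty (Fin I.ℓ) := ⟨⟨0, I.ℓ_pos⟩⟩
  rw [isTrivialYes, I.sign_fields, Bool.or_eq_true, Bool.or_eq_true, Nat.beq_eq, I.target_fields,
    List.any_eq_true, decide_eq_true_iff] at h
  rw [I.isYes_iff]
  rcases h with (h | h) | ⟨v, hv, h⟩
  · rw [show I.k.toNat = 0 by omega]
    exact yesOn_of_le_card_candidates (S := ∅) (i := Classical.arbitrary _) (Nat.zero_le _)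
  · rw [show I.k.toNat = 0 by omega]
    exact yesOn_of_le_card_candidates (S := ∅) (i := Classical.arbitrary _) (Nat.zero_le _)
  · obtain ⟨i, hi⟩ := hR.exists_mem_candidates hv
    rw [Nat.ble_eq] at h
    have hi' := (hR.mem_candidates_iff.1 hi).2
    have hsub : (aliveWith I.fields v).toFinset ⊆
        candidates I.rel I.precolor (Represents.verts I.fields) (Represents.modSet I.fields) i := by
      intro u hu
      have hu := Represents.mem_aliveWith.1 (List.mem_toFinset.1 hu)
      refine hR.mem_candidates_iff.2 ⟨hu.1, ?_⟩
      rcases hu.2 with hs | hs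
      · exact .inl hs
      · rw [hs]; exact hi'
    have hcard := Finset.card_le_card hsub
    rw [List.toFinset_card_of_nodup Represents.nodup_aliveWith] at hcard
    -- There are at most n candidates, so a truncated target that they reach was not affected by the
    -- truncation at n + 1.
    have hn : (candidates I.rel I.precolor (Represents.verts I.fields)
        (Represents.modSet I.fields) i).card ≤ I.n := by
      rw [← I.vertexCount_fields, ← Finset.card_range (vertexCount I.fields)]
      exact Finset.card_le_card fun u hu => (mem_candidates.1 hu).1.1
    exact yesOn_of_le_card_candidates (i := i) (le_trans (by omega) hcard)

theorem not_isTrivialYes (h : isTrivialYes I.fields = false) : 0 < I.k ∧ 0 < target I.fields ∧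
    ∀ v ∈ alive I.fields, (aliveWith I.fields v).length < target I.fields := by
  rw [isTrivialYes, I.sign_fields, Bool.or_eq_false_iff, Bool.or_eq_false_iff,
    ← Bool.not_eq_true (Nat.beq _ _), Nat.beq_eq, decide_eq_false_iff_not, List.any_eq_false] at h
  have ht := I.target_fields
  refine ⟨by omega, by omega, fun v hv => ?_⟩
  have := h.2 v hv
  rw [Nat.ble_eq] at this
  omega

/-- With empty modulator the graph is complete: one happy vertex makes the coloring constant, so all
happy vertices are candidates for one color, too few for the target. For d = 0 the bound d³ leaves
no vertices, so this case must be decided outright. A truncated target n + 1 asks for more happy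
vertices than there are. -/
theorem not_isYes_of_isTrivialNo (h : isTrivialYes I.fields = false)
    (h' : isTrivialNo I.fields = true) : ¬ I.IsYes := by
  obtain ⟨hk, ht, hlt⟩ := not_isTrivialYes I h
  have hR := I.represents
  have htarget := I.target_fields
  rw [I.isYes_iff]
  rintro ⟨c, hc, hkc⟩
  rw [isTrivialNo, Bool.or_eq_true, Nat.ble_eq, List.isEmpty_iff, I.vertexCount_fields] at h'
  rcases h' with h' | h'
  · obtain ⟨x₀, hx₀⟩ : (happySet I.rel (Represents.verts I.fields) c).Nonempty :=
      Finset.card_pos.1 (by omega)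
    rw [mem_happySet] at hx₀
    have hlt' := hR.card_candidates_lt ht hlt (c x₀)
    refine absurd (Finset.card_le_card fun v hv => ?_) (hlt'.trans_le (le_trans (by omega) hkc)).not_ge
    rw [mem_happySet] at hv
    have hvx : c v = c x₀ := by
      by_cases hvx : v = x₀
      · rw [hvx]
      · refine hx₀.2 v hv.1 ((hR.adj_iff x₀ (Finset.mem_range.1 hx₀.1) v
          (Finset.mem_range.1 hv.1)).1 (adj_of_notMem_modulator (Finset.mem_range.1 hx₀.1)
          (Finset.mem_range.1 hv.1) (by simp [h']) (by simp [h']) (Ne.symm hvx)))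
    refine mem_candidates.2 ⟨⟨hv.1, by simp [h']⟩, fun u hu huv a ha => ?_⟩
    rw [← hvx, ← hc u hu a ha]
    rcases huv with rfl | huv
    · rfl
    · exact hv.2 u hu huv
  · have hn : (happySet I.rel (Represents.verts I.fields) c).card ≤ I.n := by
      rw [← I.vertexCount_fields, ← Finset.card_range (vertexCount I.fields)]
      exact Finset.card_le_card fun u hu => (mem_happySet.1 hu).1
    omega

/-- The precoloring of the kernel on the vertices of the given instance. -/
noncomputable def kernelColor (F : List (List Bool)) (v : ℕ) : Option (Fin (keptColorCount F)) :=
  if h : color F v ≠ [] ∧ colorIndex (keptColors F) (color F v) < keptColorCount F then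
    some ⟨_, h.2⟩ else none

/-- The index bound in `kernelColor` always holds on kept vertices: there are at most ℓ listed
colors and at most as many as kept vertices. -/
theorem kernelColor_spec {v : ℕ} (hv : v ∈ kept I.fields) :
    (color I.fields v = [] ∧ kernelColor I.fields v = none) ∨
    (color I.fields v ≠ [] ∧ ∃ i, kernelColor I.fields v = some i ∧
      i.val = colorIndex (keptColors I.fields) (color I.fields v)) := by
  by_cases hc : color I.fields v = []
  · exact .inl ⟨hc, dif_neg fun h => h.1 hc⟩
  · have h₁ := colorIndex_lt hv hc
    have h₂ := I.represents.length_keptColors_le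
    have h₃ := length_keptColors_le_length_kept (F := I.fields)
    have h₄ : colorIndex (keptColors I.fields) (color I.fields v) < keptColorCount I.fields := by
      rw [I.keptColorCount_fields]
      omega
    exact .inr ⟨hc, ⟨_, h₄⟩, dif_pos ⟨hc, h₄⟩, rfl⟩

theorem encodeColor_kernelColor {v : ℕ} (hv : v ∈ kept I.fields) :
    encodeColor (kernelColor I.fields v) = (colorSymbols I.fields v).map toSymbol := by
  unfold colorSymbols
  rcases kernelColor_spec I hv with ⟨hc, h⟩ | ⟨hc, i, h, hi⟩
  · rw [h, hc]
    rfl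
  · rw [h, List.isEmpty_eq_false_iff.2 hc, cond_false, map_toSymbol_bitSymbols, ← hi]
    rfl

/-- Renumbering preserves which kept vertices are precolored and which precolors agree. With min(ℓ,
|W|) new colors, W being the set of kept vertices, `YesOn.change_colors` applies in both directions.
-/
theorem yesOn_kernelColor_iff (hne : kept I.fields ≠ []) (k : ℕ) :
    YesOn I.rel (kernelColor I.fields) (Represents.keptSet I.fields) k ↔
      YesOn I.rel I.precolor (Represents.keptSet I.fields) k := by
  have hR := I.represents
  have hlen := List.length_pos_iff.2 hne
  have hcount := I.keptColorCount_fields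
  have hl := I.ℓ_pos
  have : Nonempty (Fin I.ℓ) := ⟨⟨0, hl⟩⟩
  have : Nonempty (Fin (keptColorCount I.fields)) := ⟨⟨0, by omega⟩⟩
  have hcard : (Represents.keptSet I.fields).card = (kept I.fields).length :=
    List.toFinset_card_of_nodup (List.nodup_range.filter _)
  have hnone : ∀ v ∈ Represents.keptSet I.fields, I.precolor v = none ↔
      kernelColor I.fields v = none := by
    intro v hv
    have hv := List.mem_toFinset.1 hv
    have h₁ := hR.color_ne_nil_iff (Represents.mem_kept.1 hv).1
    rw [← not_iff_not, ← ne_eq, Option.ne_none_iff_exists', ← h₁]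
    rcases kernelColor_spec I hv with ⟨hc, h⟩ | ⟨hc, i, h, hi⟩ <;> simp [hc, h]
  have heq : ∀ u ∈ Represents.keptSet I.fields, ∀ v ∈ Represents.keptSet I.fields,
      I.precolor u = I.precolor v ↔ kernelColor I.fields u = kernelColor I.fields v := by
    intro u hu v hv
    have hu := List.mem_toFinset.1 hu
    have hv := List.mem_toFinset.1 hv
    rw [← hR.injective.eq_iff, ← hR.color_eq u (Represents.mem_kept.1 hu).1,
      ← hR.color_eq v (Represents.mem_kept.1 hv).1]
    rcases kernelColor_spec I hu with ⟨hc, h⟩ | ⟨hc, i, h, hi⟩ <;>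
      rcases kernelColor_spec I hv with ⟨hc', h'⟩ | ⟨hc', i', h', hi'⟩
    · simp [hc, h, hc', h']
    · simp [hc, h, h', Ne.symm hc']
    · simp [hc, h, h', hc']
    · rw [h, h', Option.some.injEq, Fin.ext_iff, hi, hi']
      exact ⟨fun h => by rw [h], color_eq_of_colorIndex_eq hu hc⟩
  constructor
  · refine YesOn.change_colors (fun v hv => (hnone v hv).2) (fun u hu v hv => (heq u hu v hv).symm) ?_
    rw [Fintype.card_fin, Fintype.card_fin, hcard]
    omega
  · refine YesOn.change_colors (fun v hv => (hnone v hv).1) heq ?_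
    rw [Fintype.card_fin, Fintype.card_fin, hcard]
    omega

/-- The instance on the kept vertices. -/
noncomputable def kernelInstance (hne : kept I.fields ≠ []) : MHVInstance where
  n := (kept I.fields).length
  graph :=
    { Adj := fun u v => I.rel ((kept I.fields).get u) ((kept I.fields).get v)
      symm := ⟨fun _ _ => I.represents.symm _ _⟩
      loopless := ⟨fun _ ⟨_, _, h⟩ => h.ne rfl⟩ }
  ℓ := keptColorCount I.fields
  ℓ_pos := by
    rw [I.keptColorCount_fields]
    exact lt_min I.ℓ_pos (List.length_pos_iff.2 hne)
  precoloring := fun v => kernelColor I.fields ((kept I.fields).get v)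
  k := (target I.fields - (target I.fields - threshold I.fields) : ℕ)

theorem isYes_kernelInstance (hne : kept I.fields ≠ []) : (kernelInstance I hne).IsYes ↔
    YesOn I.rel I.precolor (Represents.keptSet I.fields)
      (target I.fields - (target I.fields - threshold I.fields)) := by
  rw [← yesOn_kernelColor_iff I hne]
  refine MHVInstance.isYes_iff_yesOn (kernelInstance I hne) (f := (kept I.fields).get)
    (p := kernelColor I.fields) ?_ (fun v => ?_) (fun u v => Iff.rfl) (fun v => rfl)
  · exact List.nodup_iff_injective_get.1 (List.nodup_range.filter _)
  · rw [List.mem_toFinset]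
    exact List.mem_iff_get

theorem encode_kernelInstance (hne : kept I.fields ≠ []) (h : isTrivialYes I.fields = false)
    (h' : isTrivialNo I.fields = false) :
    (kernelInstance I hne).encode = (kernelSymbols I.fields).map toSymbol := by
  have hrow : ∀ v : Fin (kept I.fields).length, encodeRow (kernelInstance I hne).graph v =
      ((kept I.fields).map fun u => (true, adj I.fields ((kept I.fields).get v) u)).map toSymbol := by
    intro v
    have hmap : ∀ g : ℕ → Bool × Bool, (kept I.fields).map g =
        (List.finRange (kept I.fields).length).map (g ∘ (kept I.fields).get) := fun g => by
      conv_lhs => rw [← List.map_get_finRange (kept I.fields), List.map_map]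
    rw [hmap, List.map_map]
    refine List.map_congr_left fun u _ => ?_
    have hadj := I.represents.adj_iff _ (Represents.mem_kept.1 (List.get_mem (kept I.fields) v)).1 _
      (Represents.mem_kept.1 (List.get_mem (kept I.fields) u)).1
    exact congrArg Γ'.bit 
      (Bool.eq_iff_iff.2 ((@decide_eq_true_iff _ (Classical.propDecidable _)).trans hadj.symm))
  have hrec : ∀ v : Fin (kept I.fields).length,
      (kernelInstance I hne).record v ++ [Γ'.ket] =
        (recordSymbols I.fields ((kept I.fields).get v)).map toSymbol := by
    intro v
    rw [recordSymbols, List.map_append, List.map_cons, List.map_append,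
      ← encodeColor_kernelColor I (List.get_mem (kept I.fields) v), ← hrow]
    exact List.append_assoc _ _ _
  have hall : ((List.finRange (kept I.fields).length).map fun v =>
      (kernelInstance I hne).record v ++ [Γ'.ket]).flatten =
      ((kept I.fields).flatMap (recordSymbols I.fields)).map toSymbol := by
    conv_rhs => rw [← List.map_get_finRange (kept I.fields)]
    rw [List.flatMap_map, List.map_flatMap, List.flatMap_def]
    exact congrArg List.flatten (List.map_congr_left fun v _ => hrec v)
  rw [kernelSymbols, h, h', cond_false, cond_false, List.map_cons, List.map_append, List.map_cons,
    List.map_append, List.map_cons, map_toSymbol_bitSymbols, map_toSymbol_bitSymbols, ← hall]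
  rfl

/-- Numbers are bounded by their values, which is crude but polynomial. The 3 counts the sign bit
and two commas; a record consists of a row, a color and two separators. -/
theorem length_encode_kernelInstance_le (hne : kept I.fields ≠ []) :
    (kernelInstance I hne).encode.length ≤ 3 + threshold I.fields + (kept I.fields).length +
      (kept I.fields).length * (2 * (kept I.fields).length + 2) := by
  have hcount : keptColorCount I.fields ≤ (kept I.fields).length := by
    rw [I.keptColorCount_fields]
    exact min_le_right _ _
  have hcolor : ∀ c : Option (Fin (keptColorCount I.fields)),
      (encodeColor c).length ≤ (kept I.fields).length := by
    rintro (_ | i)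
    · exact Nat.zero_le _
    · exact (length_encodeBinary_le _).trans (i.2.trans_le hcount)
  have h₁ := length_encodeBinary_le (target I.fields - (target I.fields - threshold I.fields))
  have h₂ := (length_encodeBinary_le (keptColorCount I.fields)).trans hcount
  have h₃ : (((List.finRange (kept I.fields).length).map fun v =>
      (kernelInstance I hne).record v ++ [Γ'.ket]).flatten).length ≤
      (kept I.fields).length * (2 * (kept I.fields).length + 2) := by
    refine (congrArg List.length List.flatMap_def).symm.trans_le ?_
    refine (Represents.length_flatMap_le _ _ (2 * (kept I.fields).length + 2) fun v _ => ?_).trans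
      (Nat.mul_le_mul_right _ List.length_finRange.le)
    have := hcolor (kernelColor I.fields ((kept I.fields).get v))
    have hrow : (encodeRow (kernelInstance I hne).graph v).length = (kept I.fields).length := by
      rw [encodeRow, List.length_map, List.length_finRange]
      rfl
    change ((encodeRow (kernelInstance I hne).graph v ++ Γ'.comma ::
      encodeColor (kernelColor I.fields ((kept I.fields).get v))) ++ [Γ'.ket]).length ≤ _
    rw [List.length_append, List.length_append, List.length_cons, hrow, List.length_singleton]
    omega
  have hk : encodeInt (kernelInstance I hne).k =
      Γ'.bit false :: encodeBinary (target I.fields - (target I.fields - threshold I.fields)) := rfl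
  rw [MHVInstance.encode, List.length_append, List.length_cons, List.length_append, List.length_cons,
    hk, List.length_cons]
  change _ + ((encodeBinary (keptColorCount I.fields)).length + (_ + 1) + 1) ≤ _
  refine le_trans (Nat.add_le_add_left (Nat.add_le_add_right (Nat.add_le_add_left
    (Nat.add_le_add_right h₃ 1) _) 1) _) ?_
  omega

/-- The kernel of an instance. -/
theorem exists_kernel : ∃ J : MHVInstance, (kernelSymbols I.fields).map toSymbol = J.encode ∧
    (J.IsYes ↔ I.IsYes) ∧ J.n ≤ 264 * distanceToClique I.graph ^ 3 ∧
    J.encode.length ≤ 5 + 3 * (4 * distanceToClique I.graph ^ 2 + 2 * distanceToClique I.graph + 1) +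
      264 * distanceToClique I.graph ^ 3 + 264 * distanceToClique I.graph ^ 3 *
        (2 * (264 * distanceToClique I.graph ^ 3) + 2) := by
  set d := distanceToClique I.graph
  cases h : isTrivialYes I.fields with
  | true =>
    have henc : (kernelSymbols I.fields).map toSymbol = (emptyInstance 0).encode := by
      rw [kernelSymbols, h, cond_true]
      rfl
    refine ⟨emptyInstance 0, henc, ?_, Nat.zero_le _, ?_⟩
    · simp only [isYes_emptyInstance, isYes_of_isTrivialYes I h, le_refl]
    · rw [← henc, kernelSymbols, h, cond_true]
      -- The constant outputs have at most five symbols, whence the summand 5 in the bound.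
      exact le_trans (by decide) (show 5 ≤ _ by omega)
  | false =>
    obtain ⟨hk, ht, hlt⟩ := not_isTrivialYes I h
    cases h' : isTrivialNo I.fields with
    | true =>
      have henc : (kernelSymbols I.fields).map toSymbol = (emptyInstance 1).encode := by
        rw [kernelSymbols, h, h', cond_false, cond_true]
        rfl
      refine ⟨emptyInstance 1, henc, ?_, Nat.zero_le _, ?_⟩
      · rw [isYes_emptyInstance, iff_false_right (not_isYes_of_isTrivialNo I h h')]
        decide
      · rw [← henc, kernelSymbols, h, h', cond_false, cond_true]
        exact le_trans (by decide) (show 5 ≤ _ by omega)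
    | false =>
      have h'' := h'
      rw [isTrivialNo, Bool.or_eq_false_iff, List.isEmpty_eq_false_iff,
        ← Bool.not_eq_true (Nat.ble _ _), Nat.ble_eq, I.vertexCount_fields] at h''
      obtain ⟨hS, hn⟩ := h''
      have hne : kept I.fields ≠ [] := by
        obtain ⟨u, hu⟩ := List.exists_mem_of_ne_nil _ hS
        exact List.ne_nil_of_mem (Represents.mem_kept.2 ⟨lt_of_mem_modulator hu, .inl hu⟩)
      -- The target is positive and at most n here, so neither sign nor truncation plays a role.
      have htarget : target I.fields = I.k.toNat := by
        have := I.target_fields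
        omega
      have : Nonempty (Fin I.ℓ) := ⟨⟨0, I.ℓ_pos⟩⟩
      have hs : (modulator I.fields).length ≤ 2 * d := I.length_modulator_fields_le
      have hs1 : 1 ≤ (modulator I.fields).length := List.length_pos_iff.2 hS
      have hkept := I.represents.length_kept_le ht hlt
      have hthr : threshold I.fields ≤ 3 * (4 * d ^ 2 + 2 * d + 1) := by
        unfold threshold
        have := Nat.mul_le_mul hs hs
        refine Nat.mul_le_mul_left 3 ?_
        calc _ ≤ 2 * d * (2 * d) + 2 * d + 1 := by omega
          _ = _ := by ring
      have hN : (kept I.fields).length ≤ 264 * d ^ 3 := by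
        unfold threshold at hkept
        generalize (modulator I.fields).length = s at *
        -- At s = 1 the bound is 1 + 1 + 4 + 27 = 33, and s ≥ 1 lets s³ absorb the lower powers.
        -- Then s ≤ 2d gives 33 · 8 = 264.
        have h₁ : (kept I.fields).length ≤ 33 * s ^ 3 := by
          refine hkept.trans ?_
          obtain ⟨m, rfl⟩ : ∃ m, s = m + 1 := ⟨s - 1, by omega⟩
          ring_nf
          omega
        calc _ ≤ 33 * s ^ 3 := h₁
          _ ≤ 33 * (2 * d) ^ 3 := by gcongr
          _ = _ := by ring
      refine ⟨kernelInstance I hne, (encode_kernelInstance I hne h h').symm, ?_, hN, ?_⟩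
      · rw [isYes_kernelInstance, I.represents.yesOn_kept_iff ht hlt, htarget, I.isYes_iff]
      · refine (length_encode_kernelInstance_le I hne).trans ?_
        gcongr
        omega

end main

end HappyVertices

theorem mainTheorem9 :
    ∃ (kernel : HappyVertices.MHVInstance → HappyVertices.MHVInstance) (C : ℕ)
      (q : Polynomial ℕ),
      Nonempty (Turing.TM2ComputableInPolyTime HappyVertices.MHVInstance.encode
        HappyVertices.MHVInstance.encode kernel) ∧
      ∀ I : HappyVertices.MHVInstance,
        ((kernel I).IsYes ↔ I.IsYes) ∧
        (kernel I).n ≤ C * HappyVertices.distanceToClique I.graph ^ 3 ∧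
        (kernel I).encode.length ≤ q.eval (HappyVertices.distanceToClique I.graph) := by
  -- The kernel may be chosen noncomputably: `henc` says that its string is the one produced by the
  -- polynomial time list function.
  choose kernel henc hyes hn hlen using HappyVertices.exists_kernel
  refine ⟨kernel, 264, 5 + 3 * (4 * Polynomial.X ^ 2 + 2 * Polynomial.X + 1) +
    264 * Polynomial.X ^ 3 + 264 * Polynomial.X ^ 3 * (2 * (264 * Polynomial.X ^ 3) + 2),
    ?_, fun I => ⟨hyes I, hn I, ?_⟩⟩
  · exact StackProgram.PT.nonempty_tm2ComputableInPolyTime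
      (HappyVertices.pt_kernelSymbols (StackProgram.PT.fields .id)) henc
  · simpa using hlen I
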